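/- \textbf{Setting.} Let $N$ be a lattice, $M=\mathrm{Hom}(N,\mathbf Z)$, $N_{\mathbf R}=N\otimes\mathbf R$, $M_{\mathbf R}$ its dual. For a cone $\sigma\subset N_{\mathbf R}$ let $\check\sigma\subset M_{\mathbf R}$ be its dual cone; a face of $\sigma$ is a set $\sigma\cap u^\perp$ with $u\in\check\sigma$. For a subsemigroup $\Gamma\subset M$ (with $0$) and a cone $\tau$, let $M(\tau,\Gamma)$ be the group generated by $\Gamma\cap\tau^\perp$ and $\Gamma_\tau=\Gamma+M(\tau,\Gamma)$. A \emph{toric triple} $(N,\Sigma,\Gamma)$ consists of a nonempty fan $\Sigma$ of strictly convex rational cones in $N_{\mathbf R}$ and finitely generated semigroups $\Gamma_\sigma\subset M$ ($\sigma\in\Sigma$) with $\mathbf Z\Gamma_\sigma=M$, $\mathbf R_{\ge0}\Gamma_\sigma=\check\sigma$, and $\Gamma_\tau=\Gamma_\sigma+M(\tau,\Gamma_\sigma)$ for every face $\tau$ of $\sigma$. For a commutative ring $A$ it defines a toric scheme over $\mathrm{Spec}\,A$, the gluing of the charts $\mathrm{Spec}\,A[t^{\Gamma_\sigma}]$ along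 the open subschemes $\mathrm{Spec}\,A[t^{\Gamma_{\sigma\cap\sigma'}}]$. Let $\sigma\subset N_{\mathbf R}$ be a strictly convex rational cone, $\Gamma\subset M$ a finitely generated semigroup with $\mathbf Z\Gamma=M$ and $\mathbf R_{\ge0}\Gamma=\check\sigma$, and $S\subset\Gamma$ a finite nonempty set. Put $\mathrm{ord}_S(\nu)=\min_{m\in S}\langle\nu,m\rangle$ on $\sigma$, and for $m\in S$ let $\sigma_m=\{\nu\in\sigma:\mathrm{ord}_S(\nu)=\langle\nu,m\rangle\}$. Let $V\subset S$ be the set of those $m$ for which $\sigma_m$ is maximal with respect to inclusion among the cones $\sigma_{m'}$, $m'\in S$. Let $\Sigma(S)$ be the set of all faces of the cones $\sigma_m$, $m\in V$, and for $m\in V$ let $\Gamma_m=\Gamma+\langle m'-m: m'\in S\rangle$. \textbf{Proposition.} (0) If $\sigma$ has full dimension, then $V$ is the set of vertices of the Newton polyhedron, i.e. of the convex hull of $\bigcup_{m\in S}(m+\check\sigma)$ in $M_{\mathbf R}$. (1) $\Sigma(S)$ is the fan of a toric triple whose semigroups are $\Gamma_m$ for the cone $\sigma_m$ and $\Gamma_{m,\tau}=(\Gamma_m)_\tau$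 for each face $\tau$ of $\sigma_m$, $m\in V$. (2) For every commutative ring $A$, let $B$ be the toric scheme over $\mathrm{Spec}\,A$ defined by this triple. The inclusions of $\Gamma$ in the semigroups of the triple determine a morphism $\pi\colon B\to\mathrm{Spec}\,A[t^\Gamma]$ over $\mathrm{Spec}\,A$, and $\pi$ is the blowing up of the monomial ideal $\mathcal I=(t^m)_{m\in S}$ of $A[t^\Gamma]$. \textbf{Corollary.} Let $k$ be a field, $X$ the toric variety over $k$ of a toric triple $(N,\Sigma,\Gamma)$, and $\mathcal I$ a nonzero torus-equivariant (quasi-coherent) sheaf of ideals on $X$. Then the blowing up $\pi\colon X'\to X$ of $\mathcal I$ is the toric variety over $k$ of a toric triple $(N,\Sigma',\Gamma')$. For every $\sigma\in\Sigma$: the ideal $\mathcal I|_{\mathrm{Spec}\,k[t^{\Gamma_\sigma}]}$ is generated by the monomials $t^m$, $m\in S$, for some finite nonempty $S\subset\Gamma_\sigma$; the inverse image $\pi^{-1}(\mathrm{Spec}\,k[t^{\Gamma_\sigma}])$ is the union of the charts of $X'$ for the cones $\tau\in\Sigma'$ contained in $\sigma$, on which $\pi$ is given by the inclusions $\Gamma_\sigma\subset\Gamma'_\tau$;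 and for every finite $S\subset\Gamma_\sigma$ such that the monomials $t^m$, $m\in S$, generate this ideal, these cones and their semigroups are those of (1) for $\sigma$, $\Gamma_\sigma$, $S$. Here the blowing up of $\mathcal I$ on $X$ is the morphism $\pi\colon B\to X$ such that $\pi^{-1}\mathcal I\cdot\mathcal O_B$ is invertible and every $f\colon Z\to X$ with $f^{-1}\mathcal I\cdot\mathcal O_Z$ invertible factors uniquely through $\pi$. -/

import Mathlib

open AlgebraicGeometry CategoryTheory CategoryTheory.Limits
open scoped TensorProduct

universe u

namespace ToricBlowup

noncomputable section

section Cones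

variable (N : Type u) [AddCommGroup N]

/-- The dual lattice `M = Hom(N, ℤ)`. -/
abbrev CharLattice : Type u := N →ₗ[ℤ] ℤ

/-- The real vector space `N_ℝ = ℝ ⊗ N`. -/
abbrev RealSpace : Type u := ℝ ⊗[ℤ] N

/-- The real vector space `M_ℝ`, realised as the dual of `N_ℝ`. -/
abbrev DualSpace : Type u := Module.Dual ℝ (RealSpace N)

variable {N}

/-- The natural map `M → M_ℝ`; `realify m ν` is the pairing `⟨ν, m⟩`. -/
def realify : CharLattice N →+ DualSpace N where
  toFun m := (TensorProduct.AlgebraTensorModule.rid ℤ ℝ ℝ).toLinearMap ∘ₗ m.baseChange ℝ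
  map_zero' := by simp
  map_add' m m' := by rw [LinearMap.baseChange_add, LinearMap.comp_add]

theorem realify_tmul (m : CharLattice N) (r : ℝ) (n : N) :
    realify m (r ⊗ₜ[ℤ] n) = r * (m n : ℝ) := by
  simp [realify, mul_comm]

/-- The dual cone `σ̌ ⊆ M_ℝ` of a cone `σ ⊆ N_ℝ`. -/
def dualCone (σ : PointedCone ℝ (RealSpace N)) : PointedCone ℝ (DualSpace N) :=
  PointedCone.dual (Module.Dual.eval ℝ (RealSpace N)) (σ : Set (RealSpace N))

theorem mem_dualCone {σ : PointedCone ℝ (RealSpace N)} {u : DualSpace N} :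
    u ∈ dualCone σ ↔ ∀ ν ∈ σ, 0 ≤ u ν := Iff.rfl

/-- The cone `ℝ≥0 Γ ⊆ M_ℝ` generated by a semigroup `Γ ⊆ M`. -/
def realCone (Γ : AddSubmonoid (CharLattice N)) : PointedCone ℝ (DualSpace N) :=
  PointedCone.hull ℝ (realify '' (Γ : Set (CharLattice N)))

/-- Rational polyhedral cones: those generated by finitely many vectors of the lattice `N`. -/
def IsRational (σ : PointedCone ℝ (RealSpace N)) : Prop :=
  ∃ s : Finset N, σ = PointedCone.hull ℝ ((fun n : N => (1 : ℝ) ⊗ₜ[ℤ] n) '' (s : Set N))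

/-- Strictly convex cones: those that contain no line. -/
def IsStrictlyConvex (σ : PointedCone ℝ (RealSpace N)) : Prop :=
  ∀ ν, ν ∈ σ → -ν ∈ σ → ν = 0

/-- `τ` is a face of `σ`: it is cut out of `σ` by a supporting hyperplane `u = 0`, `u ∈ σ̌`. -/
def IsFace (τ σ : PointedCone ℝ (RealSpace N)) : Prop :=
  ∃ u ∈ dualCone σ, ∀ ν, ν ∈ τ ↔ ν ∈ σ ∧ u ν = 0

/-- A fan: a (nonempty) finite set of strictly convex rational polyhedral cones that contains every
face of each of its members, and any two members of which meet along a common face. -/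
structure IsFan (F : Set (PointedCone ℝ (RealSpace N))) : Prop where
  finite : F.Finite
  nonempty : F.Nonempty
  rational : ∀ σ ∈ F, IsRational σ
  strictlyConvex : ∀ σ ∈ F, IsStrictlyConvex σ
  face_mem : ∀ σ ∈ F, ∀ τ, IsFace τ σ → τ ∈ F
  inf_face : ∀ σ ∈ F, ∀ σ' ∈ F, IsFace (σ ⊓ σ') σ ∧ IsFace (σ ⊓ σ') σ'

/-- The lattice `M(τ, Γ)` spanned by `Γ ∩ τ^⊥`. -/
def perpLattice (Γ : AddSubmonoid (CharLattice N)) (τ : PointedCone ℝ (RealSpace N)) :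
    AddSubgroup (CharLattice N) :=
  AddSubgroup.closure {m | m ∈ Γ ∧ ∀ ν ∈ τ, realify m ν = 0}

/-- The semigroup `Γ_τ = Γ + M(τ, Γ)`. -/
def faceSemigroup (Γ : AddSubmonoid (CharLattice N)) (τ : PointedCone ℝ (RealSpace N)) :
    AddSubmonoid (CharLattice N) :=
  Γ ⊔ (perpLattice Γ τ).toAddSubmonoid

variable (N) in
/-- The combinatorial datum `(N, Σ, Γ)` of a toric scheme: a fan `Σ` in `N_ℝ` with finitely
generated semigroups `Γ_σ ⊆ M` such that `ℤ Γ_σ = M`, `ℝ≥0 Γ_σ = σ̌`, and `Γ_τ = Γ_σ + M(τ, Γ_σ)`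
for every face `τ` of `σ`. -/
structure ToricTriple where
  cones : Set (PointedCone ℝ (RealSpace N))
  isFan : IsFan cones
  semigroup : cones → AddSubmonoid (CharLattice N)
  fg : ∀ σ, (semigroup σ).FG
  closure_eq_top : ∀ σ, AddSubgroup.closure (semigroup σ : Set (CharLattice N)) = ⊤
  realCone_eq : ∀ σ : cones, realCone (semigroup σ) = dualCone (σ : PointedCone ℝ (RealSpace N))
  compatible : ∀ σ τ : cones,
    IsFace (τ : PointedCone ℝ (RealSpace N)) (σ : PointedCone ℝ (RealSpace N)) →
      semigroup τ = faceSemigroup (semigroup σ) (τ : PointedCone ℝ (RealSpace N))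

end Cones

section Rationality

/-- Finitely many positive reals can be made positive rationals by a `ℚ`-linear map `ℝ → ℚ`. -/
theorem exists_rat_functional (s : Finset ℝ) (hs : ∀ c ∈ s, 0 < c) :
    ∃ φ : ℝ →ₗ[ℚ] ℚ, ∀ c ∈ s, 0 < φ c := by
  classical
  let b := Module.Basis.ofVectorSpace ℚ ℝ
  let ι := Module.Basis.ofVectorSpaceIndex ℚ ℝ
  let U : Set (ι → ℝ) := {r | ∀ c ∈ s, 0 < ∑ j ∈ (b.repr c).support, (b.repr c j : ℝ) * r j}
  have hU : IsOpen U := by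
    have : U = ⋂ c ∈ s, {r | 0 < ∑ j ∈ (b.repr c).support, (b.repr c j : ℝ) * r j} := by
      ext r; simp [U]
    rw [this]
    refine isOpen_biInter_finset fun c _ => isOpen_lt continuous_const ?_
    fun_prop
  have hne : U.Nonempty := by
    refine ⟨fun j => b j, fun c hc => ?_⟩
    have h := b.linearCombination_repr c
    rw [Finsupp.linearCombination_apply, Finsupp.sum] at h
    have h2 : ∑ j ∈ (b.repr c).support, (b.repr c j : ℝ) * b j = c := by
      simpa only [Rat.smul_def] using h
    rw [h2]; exact hs c hc
  have hd : DenseRange (Pi.map (fun (_ : ι) (q : ℚ) => (q : ℝ))) :=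
    DenseRange.piMap fun _ => Rat.denseRange_cast
  obtain ⟨q, hq⟩ := hd.exists_mem_open hU hne
  refine ⟨b.constr ℚ q, fun c hc => ?_⟩
  have := hq c hc
  rw [Module.Basis.constr_apply, Finsupp.sum]
  simp only [Pi.map_apply, smul_eq_mul] at this ⊢
  exact_mod_cast this


theorem exists_common_denominator (s : Finset ℚ) (hs : ∀ q ∈ s, 0 ≤ q) :
    ∃ D : ℕ, 0 < D ∧ ∀ q ∈ s, ∃ k : ℕ, (D : ℚ) * q = k := by
  classical
  induction s using Finset.induction_on with
  | empty => exact ⟨1, one_pos, by simp⟩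
  | insert a s _ ih =>
    obtain ⟨D, hD, h⟩ := ih fun q hq => hs q (Finset.mem_insert_of_mem hq)
    refine ⟨D * a.den, Nat.mul_pos hD a.den_pos, fun q hq => ?_⟩
    rcases Finset.mem_insert.1 hq with rfl | hq
    · refine ⟨D * q.num.toNat, ?_⟩
      have h1 : ((q.num.toNat : ℤ) : ℚ) = q.num := by
        rw [Int.toNat_of_nonneg (Rat.num_nonneg.2 (hs q (Finset.mem_insert_self _ _)))]
      have h2 : (q.den : ℚ) * q = q.num := Rat.den_mul_eq_num q
      push_cast at h1 ⊢
      rw [mul_assoc, h2, h1]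
    · obtain ⟨k, hk⟩ := h q hq
      refine ⟨k * a.den, ?_⟩
      push_cast
      rw [← hk]; ring

variable {N : Type u} [AddCommGroup N]

theorem realCone_repr {Γ : AddSubmonoid (CharLattice N)} {u : DualSpace N} (hu : u ∈ realCone Γ) :
    ∃ (t : Finset (CharLattice N)) (c : CharLattice N → ℝ), (∀ γ ∈ t, γ ∈ Γ ∧ 0 < c γ) ∧
      u = ∑ γ ∈ t, c γ • realify γ := by
  obtain ⟨l, hl, rfl⟩ := (Finsupp.mem_span_image_iff_linearCombination _).1 hu
  refine ⟨l.support, fun γ => (l γ : ℝ), fun γ hγ => ⟨hl hγ, ?_⟩, ?_⟩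
  · exact lt_of_le_of_ne (l γ).2 fun h => (Finsupp.mem_support_iff.1 hγ) (Subtype.ext h.symm)
  · rw [Finsupp.linearCombination_apply, Finsupp.sum]
    rfl

/-- A character in the cone `ℝ≥0 Γ` has a positive multiple in `Γ`. -/
theorem exists_nsmul_mem {Γ : AddSubmonoid (CharLattice N)} {x : CharLattice N}
    (hx : realify x ∈ realCone Γ) : ∃ n : ℕ, 0 < n ∧ n • x ∈ Γ := by
  classical
  obtain ⟨t, c, htc, he⟩ := realCone_repr hx
  obtain ⟨φ, hφ⟩ := exists_rat_functional (insert 1 (t.image c)) (by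
    intro r hr
    rcases Finset.mem_insert.1 hr with rfl | hr
    · exact one_pos
    · obtain ⟨γ, hγ, rfl⟩ := Finset.mem_image.1 hr
      exact (htc γ hγ).2)
  obtain ⟨D, hD, hDk⟩ := exists_common_denominator (insert (φ 1) (t.image fun γ => φ (c γ))) (by
    intro r hr
    rcases Finset.mem_insert.1 hr with rfl | hr
    · exact (hφ 1 (Finset.mem_insert_self _ _)).le
    · obtain ⟨γ, hγ, rfl⟩ := Finset.mem_image.1 hr
      exact (hφ _ (Finset.mem_insert_of_mem (Finset.mem_image_of_mem c hγ))).le)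
  obtain ⟨n, hn⟩ := hDk _ (Finset.mem_insert_self _ _)
  have hk : ∀ γ : CharLattice N, ∃ k : ℕ, γ ∈ t → (D : ℚ) * φ (c γ) = k := by
    intro γ
    by_cases hγ : γ ∈ t
    · obtain ⟨k, hk⟩ := hDk _ (Finset.mem_insert_of_mem (Finset.mem_image_of_mem _ hγ))
      exact ⟨k, fun _ => hk⟩
    · exact ⟨0, fun h => absurd h hγ⟩
  choose k hk using hk
  have hn0 : 0 < n := by
    have h1 : (0 : ℚ) < (D : ℚ) * φ 1 :=
      mul_pos (by exact_mod_cast hD) (hφ 1 (Finset.mem_insert_self _ _))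
    rw [hn] at h1
    exact_mod_cast h1
  refine ⟨n, hn0, ?_⟩
  have key : n • x = ∑ γ ∈ t, k γ • γ := by
    ext v
    have h1 : (x v : ℝ) = ∑ γ ∈ t, c γ * (γ v : ℝ) := by
      have := congrArg (fun u : DualSpace N => u ((1 : ℝ) ⊗ₜ[ℤ] v)) he
      simpa [realify_tmul] using this
    have hφz : ∀ (r : ℝ) (z : ℤ), φ (r * (z : ℝ)) = φ r * z := by
      intro r z
      rw [mul_comm, ← zsmul_eq_mul, map_zsmul, zsmul_eq_mul, mul_comm]
    have h2 := congrArg φ h1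
    rw [map_sum] at h2
    simp only [hφz] at h2
    have h3 : φ (x v : ℝ) = φ 1 * x v := by
      have := hφz 1 (x v)
      rwa [one_mul] at this
    rw [h3] at h2
    have h4 := congrArg (fun q : ℚ => (D : ℚ) * q) h2
    simp only [← mul_assoc, hn, Finset.mul_sum] at h4
    rw [Finset.sum_congr rfl fun γ hγ => by rw [hk γ hγ]] at h4
    simp only [LinearMap.smul_apply, LinearMap.sum_apply, nsmul_eq_mul]
    exact_mod_cast h4
  rw [key]
  exact sum_mem fun γ hγ => Γ.nsmul_mem (htc γ hγ).1 _

end Rationality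

section Faces

variable {N : Type u} [AddCommGroup N]

/-- A face of `σ` is cut out by an element `m` of `Γ`, and `Γ_τ = Γ + ℕ(-m)`. -/
theorem exists_cutting {σ τ : PointedCone ℝ (RealSpace N)} {Γ : AddSubmonoid (CharLattice N)}
    (hfg : Γ.FG) (hΓ : realCone Γ = dualCone σ) (hτ : IsFace τ σ) :
    ∃ m ∈ Γ, (∀ ν, ν ∈ τ ↔ ν ∈ σ ∧ realify m ν = 0) ∧
      ∀ x, x ∈ faceSemigroup Γ τ ↔ ∃ k : ℕ, x + k • m ∈ Γ := by
  classical
  obtain ⟨u, hu, hτu⟩ := hτ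
  obtain ⟨s, hs⟩ := hfg
  have hpos : ∀ γ ∈ Γ, ∀ ν ∈ σ, 0 ≤ realify γ ν := by
    intro γ hγ ν hν
    have : realify γ ∈ dualCone σ := by
      rw [← hΓ]; exact Submodule.subset_span ⟨γ, hγ, rfl⟩
    exact mem_dualCone.1 this ν hν
  have hsΓ : ∀ γ ∈ s, γ ∈ Γ := fun γ hγ => by
    rw [← hs]; exact AddSubmonoid.subset_closure hγ
  set s' := s.filter fun γ => ∀ ν ∈ τ, realify γ ν = 0 with hs'
  set m := ∑ γ ∈ s', γ with hm
  have hs's : ∀ γ ∈ s', γ ∈ Γ ∧ ∀ ν ∈ τ, realify γ ν = 0 := fun γ hγ =>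
    ⟨hsΓ γ (Finset.mem_filter.1 hγ).1, (Finset.mem_filter.1 hγ).2⟩
  have hmΓ : m ∈ Γ := sum_mem fun γ hγ => (hs's γ hγ).1
  have hle : τ ≤ σ := fun ν hν => ((hτu ν).1 hν).1
  -- elements of `Γ` vanishing on `τ` are sums of elements of `s'`
  have hperp : ∀ x ∈ Γ, (∀ ν ∈ τ, realify x ν = 0) →
      x ∈ AddSubmonoid.closure (s' : Set (CharLattice N)) := by
    intro x hx
    rw [← hs] at hx
    induction hx using AddSubmonoid.closure_induction with
    | mem x h => exact fun h' => AddSubmonoid.subset_closure (Finset.mem_filter.2 ⟨h, h'⟩)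
    | zero => exact fun _ => zero_mem _
    | add x y hx hy ihx ihy =>
      intro h
      rw [hs] at hx hy
      have h0 : ∀ ν ∈ τ, realify x ν = 0 ∧ realify y ν = 0 := by
        intro ν hν
        have h1 := h ν hν
        rw [map_add, LinearMap.add_apply] at h1
        have h2 := hpos x hx ν (hle hν)
        have h3 := hpos y hy ν (hle hν)
        constructor <;> linarith
      exact add_mem (ihx fun ν hν => (h0 ν hν).1) (ihy fun ν hν => (h0 ν hν).2)
  -- multiples of `m` dominate
  have hdom : ∀ x ∈ AddSubmonoid.closure (s' : Set (CharLattice N)),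
      ∃ k : ℕ, k • m - x ∈ Γ := by
    intro x hx
    induction hx using AddSubmonoid.closure_induction with
    | mem x h =>
      refine ⟨1, ?_⟩
      rw [one_smul, hm, ← Finset.add_sum_erase _ _ h, add_sub_cancel_left]
      exact sum_mem fun γ hγ => (hs's γ (Finset.mem_of_mem_erase hγ)).1
    | zero => exact ⟨0, by simp⟩
    | add x y _ _ ihx ihy =>
      obtain ⟨k, hk⟩ := ihx
      obtain ⟨l, hl⟩ := ihy
      refine ⟨k + l, ?_⟩
      have : (k + l) • m - (x + y) = (k • m - x) + (l • m - y) := by rw [add_smul]; abel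
      rw [this]; exact add_mem hk hl
  refine ⟨m, hmΓ, fun ν => ⟨fun hν => ⟨hle hν, ?_⟩, fun ⟨hν, h0⟩ => ?_⟩, fun x => ⟨fun hx => ?_, ?_⟩⟩
  · rw [hm, map_sum, LinearMap.sum_apply]
    exact Finset.sum_eq_zero fun γ hγ => (hs's γ hγ).2 ν hν
  · refine (hτu ν).2 ⟨hν, ?_⟩
    rw [← hΓ] at hu
    obtain ⟨t, c, htc, rfl⟩ := realCone_repr hu
    have hvan : ∀ γ ∈ t, ∀ ν ∈ τ, realify γ ν = 0 := by
      intro γ hγ ν hν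
      obtain ⟨hνσ, h⟩ := (hτu ν).1 hν
      rw [LinearMap.sum_apply] at h
      have h1 := (Finset.sum_eq_zero_iff_of_nonneg fun γ hγ =>
        mul_nonneg (htc γ hγ).2.le (hpos γ (htc γ hγ).1 ν hνσ)).1 h γ hγ
      exact (mul_eq_zero.1 h1).resolve_left (htc γ hγ).2.ne'
    rw [LinearMap.sum_apply]
    refine Finset.sum_eq_zero fun γ hγ => ?_
    obtain ⟨k, hk⟩ := hdom γ (hperp γ (htc γ hγ).1 (hvan γ hγ))
    have h1 := hpos _ hk ν hν
    have h2 := hpos _ (htc γ hγ).1 ν hν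
    rw [map_sub, map_nsmul, LinearMap.sub_apply, LinearMap.smul_apply, h0, smul_zero, zero_sub] at h1
    have h3 : realify γ ν = 0 := by linarith
    rw [LinearMap.smul_apply, h3, smul_zero]
  · obtain ⟨y, hy, z, hz, rfl⟩ := AddSubmonoid.mem_sup.1 hx
    have hz' : (∃ k : ℕ, z + k • m ∈ Γ) ∧ ∃ k : ℕ, -z + k • m ∈ Γ := by
      have hz' : z ∈ perpLattice Γ τ := hz
      unfold perpLattice at hz'
      clear hx hz
      induction hz' using AddSubgroup.closure_induction with
      | mem z h =>
        obtain ⟨k, hk⟩ := hdom z (hperp z h.1 h.2)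
        exact ⟨⟨0, by simpa using h.1⟩, k, by rwa [neg_add_eq_sub]⟩
      | zero => exact ⟨⟨0, by simp⟩, 0, by simp⟩
      | add a b _ _ iha ihb =>
        obtain ⟨⟨k, hk⟩, k', hk'⟩ := iha
        obtain ⟨⟨l, hl⟩, l', hl'⟩ := ihb
        refine ⟨⟨k + l, ?_⟩, k' + l', ?_⟩
        · have : a + b + (k + l) • m = (a + k • m) + (b + l • m) := by rw [add_smul]; abel
          rw [this]; exact add_mem hk hl
        · have : -(a + b) + (k' + l') • m = (-a + k' • m) + (-b + l' • m) := by
            rw [add_smul]; abel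
          rw [this]; exact add_mem hk' hl'
      | neg a _ iha => exact ⟨iha.2, by simpa using iha.1⟩
    obtain ⟨⟨k, hk⟩, -⟩ := hz'
    exact ⟨k, by rw [add_assoc]; exact add_mem hy hk⟩
  · rintro ⟨k, hk⟩
    have h1 : x = (x + k • m) + (-(k • m)) := by abel
    rw [h1]
    refine AddSubmonoid.add_mem_sup hk ?_
    change -(k • m) ∈ perpLattice Γ τ
    have hmem : m ∈ perpLattice Γ τ := by
      refine AddSubgroup.subset_closure ⟨hmΓ, fun ν hν => ?_⟩
      rw [hm, map_sum, LinearMap.sum_apply]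
      exact Finset.sum_eq_zero fun γ hγ => (hs's γ hγ).2 ν hν
    exact neg_mem (nsmul_mem hmem _)

end Faces

section Algebra

variable {N : Type u} [AddCommGroup N] (A : Type u) [CommRing A]

/-- The monomial `t^γ` of the semigroup algebra `A[t^Γ]`. -/
def monomial {Γ : AddSubmonoid (CharLattice N)} (γ : Γ) : AddMonoidAlgebra A Γ :=
  AddMonoidAlgebra.single γ 1

/-- The map `A[t^Γ] → A[t^Γ']` induced by an inclusion `Γ ⊆ Γ'`. -/
def inclusionHom {Γ Γ' : AddSubmonoid (CharLattice N)} (h : Γ ≤ Γ') :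
    AddMonoidAlgebra A Γ →ₐ[A] AddMonoidAlgebra A Γ' :=
  AddMonoidAlgebra.mapDomainAlgHom A A (AddSubmonoid.inclusion h)

theorem inclusionHom_single {Γ Γ' : AddSubmonoid (CharLattice N)} (h : Γ ≤ Γ') (γ : Γ) (a : A) :
    inclusionHom A h (AddMonoidAlgebra.single γ a) =
      AddMonoidAlgebra.single (AddSubmonoid.inclusion h γ) a := by
  simp [inclusionHom]

theorem inclusionHom_refl (Γ : AddSubmonoid (CharLattice N)) :
    inclusionHom A (le_refl Γ) = AlgHom.id A _ := by
  ext γ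
  simp [inclusionHom_single]
  rfl

theorem inclusionHom_trans {Γ Γ' Γ'' : AddSubmonoid (CharLattice N)} (h : Γ ≤ Γ') (h' : Γ' ≤ Γ'') :
    inclusionHom A (h.trans h') = (inclusionHom A h').comp (inclusionHom A h) := by
  ext γ
  simp [inclusionHom_single]
  rfl

theorem inclusionHom_injective {Γ Γ' : AddSubmonoid (CharLattice N)} (h : Γ ≤ Γ') :
    Function.Injective (inclusionHom A h) :=
  AddMonoidAlgebra.mapDomain_injective (AddSubmonoid.inclusion_injective h)

theorem isLocalization_inclusionHom {Γ Γ' : AddSubmonoid (CharLattice N)} (h : Γ ≤ Γ') (m : Γ)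
    (hm : ∀ x, x ∈ Γ' ↔ ∃ k : ℕ, x + k • (m : CharLattice N) ∈ Γ) :
    letI := (inclusionHom A h).toRingHom.toAlgebra
    IsLocalization.Away (monomial A m) (AddMonoidAlgebra A Γ') := by
  let _ := (inclusionHom A h).toRingHom.toAlgebra
  have halg : ∀ x, algebraMap (AddMonoidAlgebra A Γ) (AddMonoidAlgebra A Γ') x =
    inclusionHom A h x := fun _ => rfl
  have hneg : -(m : CharLattice N) ∈ Γ' := (hm _).2 ⟨1, by simp⟩
  have hpow : ∀ k : ℕ, monomial A m ^ k = AddMonoidAlgebra.single (k • m) 1 := by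
    intro k; simp [monomial, AddMonoidAlgebra.single_pow]
  refine ⟨⟨?_, ?_, ?_⟩⟩
  · rintro ⟨_, k, rfl⟩
    rw [map_pow]
    refine IsUnit.pow _ (IsUnit.of_mul_eq_one (AddMonoidAlgebra.single ⟨_, hneg⟩ 1) ?_)
    rw [halg, monomial, inclusionHom_single, AddMonoidAlgebra.single_mul_single,
      AddMonoidAlgebra.one_def, one_mul]
    congr 1
    ext1
    simp
  · intro z
    suffices ∃ (k : ℕ) (y : AddMonoidAlgebra A Γ),
        z * inclusionHom A h (monomial A m ^ k) = inclusionHom A h y by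
      obtain ⟨k, y, hy⟩ := this
      exact ⟨⟨y, ⟨_, k, rfl⟩⟩, hy⟩
    induction z using AddMonoidAlgebra.induction_linear with
    | zero => exact ⟨0, 0, by simp⟩
    | add f g hf hg =>
      obtain ⟨k, y, hy⟩ := hf
      obtain ⟨l, w, hw⟩ := hg
      refine ⟨k + l, y * monomial A m ^ l + w * monomial A m ^ k, ?_⟩
      rw [map_add, map_mul, map_mul, ← hy, ← hw, pow_add, map_mul]
      ring
    | single x a =>
      obtain ⟨k, hk⟩ := (hm x).1 x.2
      refine ⟨k, AddMonoidAlgebra.single ⟨_, hk⟩ a, ?_⟩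
      rw [hpow, inclusionHom_single, inclusionHom_single, AddMonoidAlgebra.single_mul_single,
        mul_one]
      congr 1
  · intro x y hxy
    refine ⟨1, ?_⟩
    rw [inclusionHom_injective A h hxy]

end Algebra

section Scheme

variable {N : Type u} [AddCommGroup N] (A : Type u) [CommRing A]

/-- The affine toric scheme `Spec A[t^Γ]`. -/
abbrev affineToric (Γ : AddSubmonoid (CharLattice N)) : Scheme.{u} :=
  Spec (CommRingCat.of (AddMonoidAlgebra A Γ))

/-- The morphism `Spec A[t^Γ'] ⟶ Spec A[t^Γ]` induced by an inclusion `Γ ⊆ Γ'`. -/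
def affineToricMap {Γ Γ' : AddSubmonoid (CharLattice N)} (h : Γ ≤ Γ') :
    affineToric A Γ' ⟶ affineToric A Γ :=
  Spec.map (CommRingCat.ofHom (inclusionHom A h).toRingHom)

/-- The structure morphism `Spec A[t^Γ] ⟶ Spec A`. -/
def affineToricStructure (Γ : AddSubmonoid (CharLattice N)) :
    affineToric A Γ ⟶ Spec (CommRingCat.of A) :=
  Spec.map (CommRingCat.ofHom (algebraMap A (AddMonoidAlgebra A Γ)))

theorem affineToricMap_refl (Γ : AddSubmonoid (CharLattice N)) :
    affineToricMap A (le_refl Γ) = 𝟙 _ := by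
  rw [affineToricMap, inclusionHom_refl]
  exact Spec.map_id _

theorem affineToricMap_trans {Γ Γ' Γ'' : AddSubmonoid (CharLattice N)} (h : Γ ≤ Γ')
    (h' : Γ' ≤ Γ'') :
    affineToricMap A (h.trans h') = affineToricMap A h' ≫ affineToricMap A h := by
  rw [affineToricMap, inclusionHom_trans, affineToricMap, affineToricMap, ← Spec.map_comp]
  rfl

theorem affineToricMap_structure {Γ Γ' : AddSubmonoid (CharLattice N)} (h : Γ ≤ Γ') :
    affineToricMap A h ≫ affineToricStructure A Γ = affineToricStructure A Γ' := by
  rw [affineToricMap, affineToricStructure, affineToricStructure, ← Spec.map_comp,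
    ← CommRingCat.ofHom_comp]
  congr 2
  exact (inclusionHom A h).comp_algebraMap

theorem isOpenImmersion_affineToricMap {Γ Γ' : AddSubmonoid (CharLattice N)} (h : Γ ≤ Γ') (m : Γ)
    (hm : ∀ x, x ∈ Γ' ↔ ∃ k : ℕ, x + k • (m : CharLattice N) ∈ Γ) :
    IsOpenImmersion (affineToricMap A h) := by
  let _ := (inclusionHom A h).toRingHom.toAlgebra
  have := isLocalization_inclusionHom A h m hm
  exact IsOpenImmersion.of_isLocalization (monomial A m)

theorem range_affineToricMap {Γ Γ' : AddSubmonoid (CharLattice N)} (h : Γ ≤ Γ') (m : Γ)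
    (hm : ∀ x, x ∈ Γ' ↔ ∃ k : ℕ, x + k • (m : CharLattice N) ∈ Γ) (x : affineToric A Γ) :
    (∃ y, affineToricMap A h y = x) ↔ monomial A m ∉ (x : PrimeSpectrum _).asIdeal := by
  let _ := (inclusionHom A h).toRingHom.toAlgebra
  have := isLocalization_inclusionHom A h m hm
  have h1 := PrimeSpectrum.localization_away_comap_range (AddMonoidAlgebra A Γ') (monomial A m)
  have h2 := Set.ext_iff.1 h1 x
  exact h2

end Scheme

namespace ToricTriple

variable {N : Type u} [AddCommGroup N] (D : ToricTriple N) (A : Type u) [CommRing A]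

theorem isFace_of_le {σ τ : D.cones} (h : τ ≤ σ) :
    IsFace (τ : PointedCone ℝ (RealSpace N)) (σ : PointedCone ℝ (RealSpace N)) := by
  have := (D.isFan.inf_face τ.1 τ.2 σ.1 σ.2).2
  rwa [inf_eq_left.2 (show τ.1 ≤ σ.1 from h)] at this

theorem semigroup_le {σ τ : D.cones} (h : τ ≤ σ) : D.semigroup σ ≤ D.semigroup τ := by
  rw [D.compatible σ τ (D.isFace_of_le h)]
  exact le_sup_left

theorem exists_cutting {σ τ : D.cones} (h : τ ≤ σ) : ∃ m : D.semigroup σ,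
    (∀ ν, ν ∈ τ.1 ↔ ν ∈ σ.1 ∧ realify (m : CharLattice N) ν = 0) ∧
      ∀ x, x ∈ D.semigroup τ ↔ ∃ k : ℕ, x + k • (m : CharLattice N) ∈ D.semigroup σ := by
  have hf := D.isFace_of_le h
  obtain ⟨m, hm, h1, h2⟩ := ToricBlowup.exists_cutting (D.fg σ) (D.realCone_eq σ) hf
  refine ⟨⟨m, hm⟩, h1, ?_⟩
  rw [D.compatible σ τ hf]
  exact h2

/-- The charts `Spec A[t^{Γ_σ}]`, `σ ∈ Σ`, with the open immersions
`Spec A[t^{Γ_τ}] ⟶ Spec A[t^{Γ_σ}]` for `τ ⊆ σ`. -/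
def diagram : D.cones ⥤ Scheme.{u} where
  obj σ := affineToric A (D.semigroup σ)
  map f := affineToricMap A (D.semigroup_le (leOfHom f))
  map_id _ := affineToricMap_refl A _
  map_comp f g := affineToricMap_trans A (D.semigroup_le (leOfHom g)) (D.semigroup_le (leOfHom f))

instance isOpenImmersion_diagram_map {σ τ : D.cones} (f : σ ⟶ τ) :
    IsOpenImmersion ((D.diagram A).map f) := by
  obtain ⟨m, -, hm⟩ := D.exists_cutting (leOfHom f)
  exact isOpenImmersion_affineToricMap A _ m hm

/-- On the chart of `σ`, the charts of two faces meet in the chart of their intersection. -/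
theorem dvd_cutting {σ τ₁ τ₂ τ : D.cones}
    (hτ : ∀ ν, ν ∈ τ.1 ↔ ν ∈ τ₁.1 ∧ ν ∈ τ₂.1) (m₁ m₂ m : D.semigroup σ)
    (h₁ : ∀ ν, ν ∈ τ₁.1 ↔ ν ∈ σ.1 ∧ realify (m₁ : CharLattice N) ν = 0)
    (h₂ : ∀ ν, ν ∈ τ₂.1 ↔ ν ∈ σ.1 ∧ realify (m₂ : CharLattice N) ν = 0)
    (hm : ∀ ν, ν ∈ τ.1 ↔ ν ∈ σ.1 ∧ realify (m : CharLattice N) ν = 0) :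
    ∃ (k : ℕ) (y : D.semigroup σ), k • (m₁ + m₂) = m + y := by
  classical
  have hpos : ∀ γ : D.semigroup σ, ∀ ν ∈ σ.1, 0 ≤ realify (γ : CharLattice N) ν := by
    intro γ ν hν
    have : realify (γ : CharLattice N) ∈ dualCone σ.1 := by
      rw [← D.realCone_eq]; exact Submodule.subset_span ⟨γ, γ.2, rfl⟩
    exact mem_dualCone.1 this ν hν
  obtain ⟨s, hs⟩ := D.isFan.rational σ.1 σ.2
  have hsσ : ∀ v ∈ s, (1 : ℝ) ⊗ₜ[ℤ] v ∈ σ.1 := fun v hv => by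
    rw [hs]; exact Submodule.subset_span ⟨v, hv, rfl⟩
  have hk : ∀ v ∈ s, ∃ k : ℕ, realify (m : CharLattice N) ((1 : ℝ) ⊗ₜ[ℤ] v) ≤
      k * realify ((m₁ : CharLattice N) + (m₂ : CharLattice N)) ((1 : ℝ) ⊗ₜ[ℤ] v) := by
    intro v hv
    have p₁ := hpos m₁ _ (hsσ v hv)
    have p₂ := hpos m₂ _ (hsσ v hv)
    rw [map_add, LinearMap.add_apply]
    rcases (add_nonneg p₁ p₂).eq_or_lt with h0 | h0
    · have e₁ : realify (m₁ : CharLattice N) ((1 : ℝ) ⊗ₜ[ℤ] v) = 0 := by linarith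
      have e₂ : realify (m₂ : CharLattice N) ((1 : ℝ) ⊗ₜ[ℤ] v) = 0 := by linarith
      have hvτ := (hτ _).2 ⟨(h₁ _).2 ⟨hsσ v hv, e₁⟩, (h₂ _).2 ⟨hsσ v hv, e₂⟩⟩
      exact ⟨0, by rw [((hm _).1 hvτ).2]; simp⟩
    · obtain ⟨k, hk⟩ := exists_nat_ge (realify (m : CharLattice N) ((1 : ℝ) ⊗ₜ[ℤ] v) /
        (realify (m₁ : CharLattice N) ((1 : ℝ) ⊗ₜ[ℤ] v) +
          realify (m₂ : CharLattice N) ((1 : ℝ) ⊗ₜ[ℤ] v)))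
      exact ⟨k, (div_le_iff₀ h0).1 hk⟩
  choose! k hk using hk
  set K := ∑ v ∈ s, k v with hK
  have hx : realify (K • ((m₁ : CharLattice N) + (m₂ : CharLattice N)) - (m : CharLattice N)) ∈ realCone (D.semigroup σ) := by
    rw [D.realCone_eq, mem_dualCone]
    intro ν hν
    rw [hs] at hν
    induction hν using Submodule.span_induction with
    | mem ν hν =>
      obtain ⟨v, hv, rfl⟩ := hν
      have h1 := hk v hv
      have h2 : k v ≤ K := Finset.single_le_sum (fun _ _ => Nat.zero_le _) hv
      have h3 : (0 : ℝ) ≤ realify ((m₁ : CharLattice N) + (m₂ : CharLattice N)) ((1 : ℝ) ⊗ₜ[ℤ] v) :=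
        hpos (m₁ + m₂) _ (hsσ v hv)
      have h4 : (k v : ℝ) ≤ K := by exact_mod_cast h2
      have h5 := mul_le_mul_of_nonneg_right h4 h3
      have h6 : realify (K • ((m₁ : CharLattice N) + (m₂ : CharLattice N)) - (m : CharLattice N)) ((1 : ℝ) ⊗ₜ[ℤ] v) =
          K * realify ((m₁ : CharLattice N) + (m₂ : CharLattice N)) ((1 : ℝ) ⊗ₜ[ℤ] v) -
            realify (m : CharLattice N) ((1 : ℝ) ⊗ₜ[ℤ] v) := by
        rw [map_sub, map_nsmul, LinearMap.sub_apply, LinearMap.smul_apply, nsmul_eq_mul]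
      change 0 ≤ realify (K • ((m₁ : CharLattice N) + (m₂ : CharLattice N)) - (m : CharLattice N)) ((1 : ℝ) ⊗ₜ[ℤ] v)
      rw [h6]; linarith
    | zero => rw [map_zero]
    | add x y _ _ hx hy => rw [map_add]; exact add_nonneg hx hy
    | smul c x _ hx =>
      have : c • x = (c : ℝ) • x := rfl
      rw [this, map_smul]; exact mul_nonneg c.2 hx
  obtain ⟨n, hn, hmem⟩ := exists_nsmul_mem hx
  obtain ⟨n, rfl⟩ : ∃ l, n = l + 1 := ⟨n - 1, by omega⟩
  refine ⟨(n + 1) * K, ⟨_, hmem⟩ + n • m, ?_⟩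
  ext1
  push_cast
  rw [mul_smul, smul_sub, add_smul _ _ (m : CharLattice N), one_smul]
  abel

instance isLocallyDirected_diagram : (D.diagram A ⋙ Scheme.forget).IsLocallyDirected := by
  constructor
  intro τ₁ τ₂ σ f₁ f₂ x₁ x₂ hx
  have l₁ := leOfHom f₁
  have l₂ := leOfHom f₂
  let τ : D.cones := ⟨τ₁.1 ⊓ τ₂.1, D.isFan.face_mem _ τ₁.2 _
    (D.isFan.inf_face _ τ₁.2 _ τ₂.2).1⟩
  have t₁ : τ ≤ τ₁ := show τ₁.1 ⊓ τ₂.1 ≤ τ₁.1 from inf_le_left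
  have t₂ : τ ≤ τ₂ := show τ₁.1 ⊓ τ₂.1 ≤ τ₂.1 from inf_le_right
  obtain ⟨m₁, c₁, e₁⟩ := D.exists_cutting l₁
  obtain ⟨m₂, c₂, e₂⟩ := D.exists_cutting l₂
  obtain ⟨m, c, e⟩ := D.exists_cutting (t₁.trans l₁)
  obtain ⟨k, y, hk⟩ := D.dvd_cutting (τ := τ) (fun _ => Iff.rfl) m₁ m₂ m c₁ c₂ c
  change (D.diagram A).map f₁ x₁ = (D.diagram A).map f₂ x₂ at hx
  have n₁ := (range_affineToricMap A (D.semigroup_le l₁) m₁ e₁ ((D.diagram A).map f₁ x₁)).1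
    ⟨x₁, rfl⟩
  have n₂ := (range_affineToricMap A (D.semigroup_le l₂) m₂ e₂ ((D.diagram A).map f₁ x₁)).1
    ⟨x₂, hx.symm⟩
  have hn : monomial A m ∉ ((D.diagram A).map f₁ x₁ : PrimeSpectrum _).asIdeal := by
    intro hmem
    have h1 : monomial A m * monomial A y = (monomial A m₁ * monomial A m₂) ^ k := by
      simp only [monomial, AddMonoidAlgebra.single_mul_single, AddMonoidAlgebra.single_pow, one_mul,
        one_pow, hk]
    have h2 := Ideal.mul_mem_right (monomial A y) _ hmem
    rw [h1] at h2
    have hp := ((D.diagram A).map f₁ x₁ : PrimeSpectrum _).isPrime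
    rcases hp.mem_or_mem (hp.mem_of_pow_mem _ h2) with h3 | h3
    · exact n₁ h3
    · exact n₂ h3
  obtain ⟨z, hz⟩ : ∃ z : (D.diagram A).obj τ,
      (D.diagram A).map (homOfLE (t₁.trans l₁)) z = (D.diagram A).map f₁ x₁ :=
    (range_affineToricMap A (D.semigroup_le (t₁.trans l₁)) m e _).2 hn
  refine ⟨τ, homOfLE t₁, homOfLE t₂, z, ?_, ?_⟩
  · apply ((D.diagram A).map f₁).isOpenEmbedding.injective
    have h1 : (D.diagram A).map f₁ ((D.diagram A).map (homOfLE t₁) z) =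
        (D.diagram A).map (homOfLE (t₁.trans l₁)) z := by
      rw [← Scheme.Hom.comp_apply, ← Functor.map_comp]
      rfl
    exact h1.trans hz
  · apply ((D.diagram A).map f₂).isOpenEmbedding.injective
    have h1 : (D.diagram A).map f₂ ((D.diagram A).map (homOfLE t₂) z) =
        (D.diagram A).map (homOfLE (t₁.trans l₁)) z := by
      rw [← Scheme.Hom.comp_apply, ← Functor.map_comp]
      rfl
    exact h1.trans (hz.trans hx)

/-- The toric scheme `T_Σ^Γ` over `A`: the gluing of the charts `Spec A[t^{Γ_σ}]`, `σ ∈ Σ`, along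
the open subschemes `Spec A[t^{Γ_τ}]`, `τ = σ ∩ σ'`. -/
def scheme : Scheme.{u} := colimit (D.diagram A)

/-- The open immersion of the chart `Spec A[t^{Γ_σ}]` in `T_Σ^Γ`. -/
def chart (σ : D.cones) : affineToric A (D.semigroup σ) ⟶ D.scheme A :=
  colimit.ι (D.diagram A) σ

instance (σ : D.cones) : IsOpenImmersion (D.chart A σ) :=
  inferInstanceAs (IsOpenImmersion (colimit.ι (D.diagram A) σ))

/-- The structure morphism of `T_Σ^Γ` over `Spec A`. -/
def structureMorphism : D.scheme A ⟶ Spec (CommRingCat.of A) :=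
  colimit.desc (D.diagram A)
    { pt := Spec (CommRingCat.of A)
      ι :=
        { app := fun σ => affineToricStructure A (D.semigroup σ)
          naturality := fun _ _ f =>
            (affineToricMap_structure A (D.semigroup_le (leOfHom f))).trans
              (Category.comp_id _).symm } }

end ToricTriple

section BlowupCombinatorics

variable {N : Type u} [AddCommGroup N]

/-- The order function `ord_S(ν) = min_{m ∈ S} ⟨ν, m⟩` of a finite nonempty set `S ⊆ M`. -/
def orderFunction (S : Set (CharLattice N)) (ν : RealSpace N) : ℝ :=
  sInf ((fun m => realify m ν) '' S)

/-- The cone `{ν ∈ σ | ord_S(ν) = ⟨ν, m⟩}`, for `m ∈ S`, on which the order function is given by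
the linear form `m`. -/
def linearityCone (σ : PointedCone ℝ (RealSpace N)) (S : Set (CharLattice N)) (m : CharLattice N) :
    PointedCone ℝ (RealSpace N) where
  carrier := {ν | ν ∈ σ ∧ ∀ m' ∈ S, realify m ν ≤ realify m' ν}
  zero_mem' := ⟨zero_mem _, fun m' _ => by simp⟩
  add_mem' {x y} hx hy := ⟨add_mem hx.1 hy.1, fun m' hm' => by
    rw [map_add, map_add]; exact add_le_add (hx.2 m' hm') (hy.2 m' hm')⟩
  smul_mem' c x hx := ⟨σ.smul_mem c.2 hx.1, fun m' hm' => by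
    have h : c • x = (c : ℝ) • x := rfl
    rw [h, map_smul, map_smul]
    exact mul_le_mul_of_nonneg_left (hx.2 m' hm') c.2⟩

theorem mem_linearityCone {σ : PointedCone ℝ (RealSpace N)} {S : Set (CharLattice N)}
    (hS : S.Finite) {m : CharLattice N} (hm : m ∈ S) (ν : RealSpace N) :
    ν ∈ linearityCone σ S m ↔ ν ∈ σ ∧ orderFunction S ν = realify m ν := by
  have hb : BddBelow ((fun m => realify m ν) '' S) := (hS.image _).bddBelow
  constructor
  · rintro ⟨h1, h2⟩
    refine ⟨h1, le_antisymm (csInf_le hb ⟨m, hm, rfl⟩) ?_⟩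
    refine le_csInf ⟨_, m, hm, rfl⟩ ?_
    rintro _ ⟨m', hm', rfl⟩
    exact h2 m' hm'
  · rintro ⟨h1, h2⟩
    refine ⟨h1, fun m' hm' => ?_⟩
    rw [← h2]
    exact csInf_le hb ⟨m', hm', rfl⟩

/-- The elements of `S` that define the maximal cones of linearity of the order function. When `σ`
has full dimension these are the vertices of the Newton polyhedron. -/
def vertexExponents (σ : PointedCone ℝ (RealSpace N)) (S : Set (CharLattice N)) :
    Set (CharLattice N) :=
  {m | m ∈ S ∧ ∀ m' ∈ S, linearityCone σ S m ≤ linearityCone σ S m' →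
    linearityCone σ S m' = linearityCone σ S m}

/-- The fan `Σ(S)` subdividing `σ`: the maximal cones of linearity of the order function on `σ`,
together with their faces. -/
def blowupFan (σ : PointedCone ℝ (RealSpace N)) (S : Set (CharLattice N)) :
    Set (PointedCone ℝ (RealSpace N)) :=
  {τ | ∃ m ∈ vertexExponents σ S, IsFace τ (linearityCone σ S m)}

/-- The Newton polyhedron: the convex hull in `M_ℝ` of the sets `m + σ̌`, `m ∈ S`. -/
def newtonPolyhedron (σ : PointedCone ℝ (RealSpace N)) (S : Set (CharLattice N)) :
    Set (DualSpace N) :=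
  convexHull ℝ {u | ∃ m ∈ S, ∃ w ∈ dualCone σ, u = realify m + w}

/-- The semigroup `Γ + ⟨m' - m : m' ∈ S⟩`. -/
def chartSemigroup (Γ : AddSubmonoid (CharLattice N)) (S : Set (CharLattice N))
    (m : CharLattice N) : AddSubmonoid (CharLattice N) :=
  Γ ⊔ AddSubmonoid.closure {x | ∃ m' ∈ S, x = m' - m}

/-- The semigroups attached by `D` to the cones of the fan `Σ(S)` are, for `m` running through the
vertices, `Γ_m = Γ + ⟨m' - m : m' ∈ S⟩` for the maximal cone `σ_m` of linearity and `Γ_{m,τ}` for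
the faces `τ` of `σ_m`. -/
def ToricTriple.HasBlowupSemigroups (D : ToricTriple N) (σ : PointedCone ℝ (RealSpace N))
    (Γ : AddSubmonoid (CharLattice N)) (S : Set (CharLattice N)) : Prop :=
  ∀ m ∈ vertexExponents σ S, ∀ τ : D.cones,
    (τ.1 = linearityCone σ S m → D.semigroup τ = chartSemigroup Γ S m) ∧
    (IsFace τ.1 (linearityCone σ S m) →
      D.semigroup τ = faceSemigroup (chartSemigroup Γ S m) τ.1)

end BlowupCombinatorics

section Blowup

/-- An ideal sheaf is invertible if it is locally generated by one nonzerodivisor. -/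
def IsInvertibleIdeal {Z : Scheme.{u}} (J : Z.IdealSheafData) : Prop :=
  ∀ z : Z, ∃ U : Z.affineOpens, z ∈ U.1 ∧
    ∃ f ∈ nonZeroDivisors Γ(Z, U.1), J.ideal U = Ideal.span {f}

/-- `π : B ⟶ X` is the blowing up of the ideal sheaf `I`: the inverse image ideal sheaf of `I` on
`B` is invertible, and every `f : Z ⟶ X` such that the inverse image ideal sheaf of `I` on `Z` is
invertible factors uniquely through `π`. -/
structure IsBlowup {B X : Scheme.{u}} (π : B ⟶ X) (I : X.IdealSheafData) : Prop where
  invertible : IsInvertibleIdeal (I.comap π)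
  existsUnique_lift : ∀ {Z : Scheme.{u}} (f : Z ⟶ X), IsInvertibleIdeal (I.comap f) →
    ∃! g : Z ⟶ B, g ≫ π = f

/-- The ideal sheaf on `Spec R` defined by an ideal of `R`. -/
def specIdealSheaf {R : CommRingCat.{u}} (J : Ideal R) : (Spec R).IdealSheafData :=
  Scheme.IdealSheafData.ofIdealTop (J.map (Scheme.ΓSpecIso R).inv.hom)

variable {N : Type u} [AddCommGroup N]

/-- The ideal of `A[t^Γ]` generated by the monomials `t^m`, `m ∈ S`, for a subset `S` of `Γ`. -/
def monomialIdeal (A : Type u) [CommRing A] (Γ : AddSubmonoid (CharLattice N))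
    (S : Set (CharLattice N)) : Ideal (AddMonoidAlgebra A Γ) :=
  Ideal.span {x | ∃ γ : Γ, (γ : CharLattice N) ∈ S ∧ x = monomial A γ}

/-- The homomorphism `t^γ ↦ t^γ ⊗ t^γ` defining the action of the torus `Spec k[t^M]` on
`Spec k[t^Γ]`. -/
def coaction (k : Type u) [CommRing k] (Γ : AddSubmonoid (CharLattice N)) :
    AddMonoidAlgebra k Γ →ₐ[k]
      AddMonoidAlgebra k (CharLattice N) ⊗[k] AddMonoidAlgebra k Γ :=
  AddMonoidAlgebra.lift k _ Γ
    { toFun := fun γ =>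
        AddMonoidAlgebra.single (γ.toAdd : CharLattice N) 1 ⊗ₜ[k] monomial k γ.toAdd
      map_one' := rfl
      map_mul' := fun γ δ => by
        simp [monomial, AddMonoidAlgebra.single_mul_single] }

namespace ToricTriple

variable (D : ToricTriple N) (k : Type u) [CommRing k]

/-- The ideal of `k[t^{Γ_σ}]` given by the restriction of an ideal sheaf to the chart of `σ`. -/
def chartIdeal (I : (D.scheme k).IdealSheafData) (σ : D.cones) :
    Ideal (AddMonoidAlgebra k (D.semigroup σ)) :=
  ((I.comap (D.chart k σ)).ideal ⟨⊤, isAffineOpen_top _⟩).comap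
    (Scheme.ΓSpecIso (CommRingCat.of (AddMonoidAlgebra k (D.semigroup σ)))).inv.hom

/-- An ideal sheaf on a toric scheme is equivariant if, on each of the (torus-stable) charts, its
inverse images under the action and under the projection `Spec k[t^M] × Spec k[t^{Γ_σ}] ⟶
Spec k[t^{Γ_σ}]` coincide. -/
def IsEquivariant (I : (D.scheme k).IdealSheafData) : Prop :=
  ∀ σ : D.cones,
    (D.chartIdeal k I σ).map (coaction k (D.semigroup σ)) =
      (D.chartIdeal k I σ).map (Algebra.TensorProduct.includeRight :
        AddMonoidAlgebra k (D.semigroup σ) →ₐ[k]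
          AddMonoidAlgebra k (CharLattice N) ⊗[k] AddMonoidAlgebra k (D.semigroup σ))

end ToricTriple

end Blowup

end

end ToricBlowup

open ToricBlowup

/-! Write `σ_m` for the linearity cone of `m ∈ S` and `Γ_m = Γ + ⟨m' - m⟩` for its semigroup.

Combinatorics. The inequalities `γ ≥ 0` for `γ ∈ Γ_m` say exactly that `ν ∈ σ` and that `m` is
minimal at `ν`. By Farkas' lemma the cone of `Γ_m` is therefore dual to `σ_m`. Two cones `σ_m` and
`σ_m'` meet where `m' - m` vanishes, which is a face of both. Since faces of faces of a rational
cone are faces, all faces of the `σ_m` form a fan. If a cone `ρ` lies in both `σ_m` and `σ_m'`, then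
`m - m'` vanishes on `ρ`, so `Γ_m` and `Γ_m'` have the same localization at `ρ`, and the semigroup
of `ρ` is well defined (`IsBlowupChart.unique`). A linearity cone that is not maximal is a face of a
maximal one, so the arguments may use every `m ∈ S` and not only the vertices.

Two stability properties globalize this. The cones and semigroups depend only on `S + Γ`, that is,
on the monomial ideal (`IsBlowupChart.of_sameModulo`). The subdivision of a face of `σ` consists of
the cones of the subdivision of `σ` that lie in this face (`isBlowupChart_face_iff`). A
`BlowupAtlas` is a system of cones with exponents to which both apply, and its subdivisions fit
together to a toric triple. The proposition is the case of one chart; the corollary takes all cones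
of the given fan.

Universal property. The ring `A[t^{Γ_m}]` is `A[t^Γ]` with the fractions `t^{m'} / t^m` adjoined. A
homomorphism from `A[t^Γ]` extends to it, uniquely, as soon as the image of `t^m` is a
nonzerodivisor dividing the images of all `t^{m'}` (`exists_lift_chartSemigroup`,
`eq_of_comp_inclusionHom_eq`). If the inverse image of the ideal is invertible, then locally one of
the monomials generates it (`exists_local_generator`), so lifts exist locally. If both `t^m` and
`t^{m'}` generate it, then `t^{m' - m}` becomes a unit, and the two lifts pass through the chart of
`σ_m ∩ σ_m'`, where they agree (`glue_maxCone`). `AffineBlowupCharts` isolates the formal part, from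
such charts to a blowing up. No property of `A` is needed, because monomials are nonzerodivisors
over any ring.

Equivariance. The coaction puts `t^γ` in weight `γ`, so an equivariant ideal contains every term of
its elements. Over a field it is thus generated by monomials, finitely many since `k[t^Γ]` is
Noetherian.

Newton polyhedron. If `m` is extreme and `σ_m ⊆ σ_m'`, then a multiple of `m - m'` lies in `Γ_m`,
which exhibits `m` as a weighted mean of points of the polyhedron and forces `m = m'`. Conversely,
for a vertex exponent `m` and full-dimensional `σ`, some `ν ∈ σ` on which no nonzero element of `σ̌`
vanishes has `m` as its only minimizer in `S`, and it exposes `m`. -/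

namespace ToricBlowup

/-! ### Polyhedral cones: Fourier–Motzkin elimination and Farkas' lemma. -/

section Polyhedral

/-- One step of Fourier–Motzkin elimination. -/
theorem fourierMotzkin {α : Type*} (s : Finset α) (a b : α → ℝ) :
    (∃ c : ℝ, 0 ≤ c ∧ ∀ i ∈ s, c * a i ≤ b i) ↔
      (∀ i ∈ s, 0 ≤ a i → 0 ≤ b i) ∧
        ∀ i ∈ s, ∀ j ∈ s, 0 < a i → a j < 0 → 0 ≤ a i * b j - a j * b i := by
  classical
  constructor
  · rintro ⟨c, hc, h⟩
    refine ⟨fun i hi ha => (mul_nonneg hc ha).trans (h i hi), fun i hi j hj hai haj => ?_⟩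
    have h1 := mul_le_mul_of_nonneg_left (h j hj) hai.le
    have h2 := mul_le_mul_of_nonpos_left (h i hi) haj.le
    linarith
  · rintro ⟨h1, h2⟩
    -- Take for `c` the largest of `0` and the lower bounds `b i / a i` that come from the indices
    -- with `a i < 0`.
    obtain ⟨c, hc, hmax⟩ := Finset.exists_max_image
      (insert 0 ((s.filter fun i => a i < 0).image fun i => b i / a i)) id ⟨0, by simp⟩
    simp only [id] at hmax
    refine ⟨c, hmax 0 (by simp), fun i hi => ?_⟩
    rcases lt_or_ge (a i) 0 with ha | ha
    · have := hmax (b i / a i) (Finset.mem_insert_of_mem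
        (Finset.mem_image.2 ⟨i, Finset.mem_filter.2 ⟨hi, ha⟩, rfl⟩))
      exact (div_le_iff_of_neg ha).1 this
    · rcases Finset.mem_insert.1 hc with rfl | hc
      · simpa using h1 i hi ha
      · obtain ⟨j, hj, rfl⟩ := Finset.mem_image.1 hc
        obtain ⟨hj, haj⟩ := Finset.mem_filter.1 hj
        rcases ha.eq_or_lt with ha | ha
        · rw [← ha, mul_zero]; exact h1 i hi ha.le
        · have := h2 i hi j hj ha haj
          rw [div_mul_eq_mul_div, div_le_iff_of_neg haj]
          linarith

variable {E : Type*} [AddCommGroup E] [Module ℝ E]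

theorem nonneg_of_mem_hull {T : Set E} {u : Module.Dual ℝ E} (h : ∀ t ∈ T, 0 ≤ u t) {x : E}
    (hx : x ∈ PointedCone.hull ℝ T) : 0 ≤ u x := by
  induction hx using Submodule.span_induction with
  | mem x hx => exact h x hx
  | zero => rw [map_zero]
  | add x y _ _ hx hy => rw [map_add]; exact add_nonneg hx hy
  | smul c x _ hx =>
    have : c • x = (c : ℝ) • x := rfl
    rw [this, map_smul]; exact mul_nonneg c.2 hx

/-- A finitely generated cone is an intersection of finitely many half-spaces. -/
theorem exists_halfspaces [FiniteDimensional ℝ E] (T : Finset E) :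
    ∃ U : Finset (Module.Dual ℝ E), ∀ x, x ∈ PointedCone.hull ℝ (T : Set E) ↔ ∀ u ∈ U, 0 ≤ u x := by
  classical
  induction T using Finset.induction_on with
  | empty =>
    let b := Module.finBasis ℝ E
    refine ⟨Finset.univ.image b.coord ∪ Finset.univ.image fun i => -b.coord i, fun x => ?_⟩
    constructor
    · intro hx u _
      have : x = 0 := by simpa [PointedCone.hull] using hx
      simp [this]
    · intro h
      have : x = 0 := b.ext_elem_iff.2 fun i => by
        have h1 := h (b.coord i) (by simp)
        have h2 := h (-b.coord i) (by simp)
        rw [LinearMap.neg_apply] at h2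
        simpa using le_antisymm (neg_nonneg.1 h2) h1
      rw [this]; exact zero_mem _
  | insert v T _ ih =>
    obtain ⟨U, hU⟩ := ih
    -- Eliminating the coefficient of `v` leaves the forms that are nonnegative at `v` and, for each
    -- pair of opposite signs at `v`, the positive combination that vanishes at `v`.
    refine ⟨(U.filter fun u => 0 ≤ u v) ∪
      ((U ×ˢ U).filter fun p => 0 < p.1 v ∧ p.2 v < 0).image fun p => p.1 v • p.2 - p.2 v • p.1,
      fun x => ?_⟩
    have h1 : x ∈ PointedCone.hull ℝ ((insert v T : Finset E) : Set E) ↔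
        ∃ c : ℝ, 0 ≤ c ∧ ∀ u ∈ U, c * u v ≤ u x := by
      rw [Finset.coe_insert]
      refine (Submodule.mem_span_insert).trans ⟨?_, ?_⟩
      · rintro ⟨c, z, hz, rfl⟩
        refine ⟨c, c.2, fun u hu => ?_⟩
        have h2 : c • v = (c : ℝ) • v := rfl
        rw [map_add, h2, map_smul, smul_eq_mul]
        linarith [(hU z).1 hz u hu]
      · rintro ⟨c, hc, h⟩
        refine ⟨⟨c, hc⟩, x - c • v, (hU _).2 fun u hu => ?_, ?_⟩
        · rw [map_sub, map_smul, smul_eq_mul]; linarith [h u hu]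
        · change x = c • v + (x - c • v); abel
    rw [h1, fourierMotzkin]
    constructor
    · rintro ⟨h2, h3⟩ u hu
      rcases Finset.mem_union.1 hu with hu | hu
      · exact h2 u (Finset.mem_filter.1 hu).1 (Finset.mem_filter.1 hu).2
      · obtain ⟨⟨p, q⟩, hp, rfl⟩ := Finset.mem_image.1 hu
        obtain ⟨hp, hp1, hp2⟩ := Finset.mem_filter.1 hp
        obtain ⟨hp, hq⟩ := Finset.mem_product.1 hp
        exact h3 p hp q hq hp1 hp2
    · intro h
      refine ⟨fun u hu h0 => h u (Finset.mem_union_left _ (Finset.mem_filter.2 ⟨hu, h0⟩)),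
        fun p hp q hq hp1 hp2 => ?_⟩
      exact h (p v • q - q v • p) (Finset.mem_union_right _ (Finset.mem_image.2 ⟨(p, q),
        Finset.mem_filter.2 ⟨Finset.mk_mem_product hp hq, hp1, hp2⟩, rfl⟩))

/-- Farkas' lemma: a finitely generated cone is its own bidual. -/
theorem mem_hull_of_forall [FiniteDimensional ℝ E] {T : Set E} (hT : T.Finite) {x : E}
    (h : ∀ u : Module.Dual ℝ E, (∀ t ∈ T, 0 ≤ u t) → 0 ≤ u x) : x ∈ PointedCone.hull ℝ T := by
  lift T to Finset E using hT
  obtain ⟨U, hU⟩ := exists_halfspaces T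
  exact (hU x).2 fun u hu => h u fun t ht => (hU t).1 (Submodule.subset_span ht) u hu

theorem exists_eval_eq [FiniteDimensional ℝ E] (w : Module.Dual ℝ (Module.Dual ℝ E)) :
    ∃ x : E, ∀ u : Module.Dual ℝ E, w u = u x := by
  obtain ⟨x, rfl⟩ := (Module.bijective_dual_eval ℝ E).2 w
  exact ⟨x, fun _ => rfl⟩

end Polyhedral

/-! ### Faces of cones and rational polyhedral cones. -/

section RationalCones

variable {N : Type u} [AddCommGroup N]

/-- The half-space `{ν | 0 ≤ u ν}`. -/
def halfSpace (u : DualSpace N) : PointedCone ℝ (RealSpace N) where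
  carrier := {ν | 0 ≤ u ν}
  zero_mem' := by simp
  add_mem' {x y} hx hy := by
    rw [Set.mem_ofPred_eq, map_add]; exact add_nonneg hx hy
  smul_mem' c x hx := by
    have h : c • x = (c : ℝ) • x := rfl
    rw [Set.mem_ofPred_eq, h, map_smul]; exact mul_nonneg c.2 hx

theorem mem_halfSpace {u : DualSpace N} {ν : RealSpace N} : ν ∈ halfSpace u ↔ 0 ≤ u ν := Iff.rfl

theorem le_of_isFace {τ σ : PointedCone ℝ (RealSpace N)} (h : IsFace τ σ) : τ ≤ σ := by
  obtain ⟨u, _, hu⟩ := h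
  exact fun ν hν => ((hu ν).1 hν).1

theorem isFace_refl (σ : PointedCone ℝ (RealSpace N)) : IsFace σ σ :=
  ⟨0, zero_mem _, fun ν => by simp⟩

/-- The intersection of a cone with the hyperplane `u = 0`. -/
def cut (σ : PointedCone ℝ (RealSpace N)) (u : DualSpace N) : PointedCone ℝ (RealSpace N) where
  carrier := {ν | ν ∈ σ ∧ u ν = 0}
  zero_mem' := by simp
  add_mem' {x y} hx hy := ⟨add_mem hx.1 hy.1, by rw [map_add, hx.2, hy.2, add_zero]⟩
  smul_mem' c x hx := ⟨σ.smul_mem c.2 hx.1, by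
    have h : c • x = (c : ℝ) • x := rfl
    rw [h, map_smul, hx.2, smul_zero]⟩

theorem mem_cut {σ : PointedCone ℝ (RealSpace N)} {u : DualSpace N} {ν : RealSpace N} :
    ν ∈ cut σ u ↔ ν ∈ σ ∧ u ν = 0 := Iff.rfl

theorem isFace_iff_exists_cut {τ σ : PointedCone ℝ (RealSpace N)} :
    IsFace τ σ ↔ ∃ u ∈ dualCone σ, τ = cut σ u := by
  simp only [IsFace, SetLike.ext_iff, mem_cut]

/-- A face of `σ` that is contained in an intermediate cone `ρ ≤ σ` is a face of `ρ`. -/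
theorem isFace_of_le_of_le {τ ρ σ : PointedCone ℝ (RealSpace N)} (h : IsFace τ σ) (h1 : τ ≤ ρ)
    (h2 : ρ ≤ σ) : IsFace τ ρ := by
  obtain ⟨u, hu, hτ⟩ := h
  exact ⟨u, fun ν hν => hu (h2 hν), fun ν =>
    ⟨fun hν => ⟨h1 hν, ((hτ ν).1 hν).2⟩, fun hν => (hτ ν).2 ⟨h2 hν.1, hν.2⟩⟩⟩

theorem isFace_inf {τ τ' σ : PointedCone ℝ (RealSpace N)} (h : IsFace τ σ) (h' : IsFace τ' σ) :
    IsFace (τ ⊓ τ') σ := by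
  obtain ⟨u, hu, hτ⟩ := h
  obtain ⟨u', hu', hτ'⟩ := h'
  refine ⟨u + u', add_mem hu hu', fun ν => ?_⟩
  rw [Submodule.mem_inf, hτ, hτ', LinearMap.add_apply]
  constructor
  · rintro ⟨⟨h1, h2⟩, -, h3⟩
    exact ⟨h1, by rw [h2, h3, add_zero]⟩
  · rintro ⟨h1, h2⟩
    have h3 : 0 ≤ u ν := hu h1
    have h4 : 0 ≤ u' ν := hu' h1
    exact ⟨⟨h1, by linarith⟩, h1, by linarith⟩

/-- The intersection of a face of `σ` with a smaller cone is a face of the smaller cone. -/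
theorem isFace_inf_of_le {τ ρ σ : PointedCone ℝ (RealSpace N)} (h : IsFace τ σ) (h2 : ρ ≤ σ) :
    IsFace (ρ ⊓ τ) ρ := by
  obtain ⟨u, hu, hτ⟩ := h
  refine ⟨u, fun ν hν => hu (h2 hν), fun ν => ?_⟩
  rw [Submodule.mem_inf, hτ]
  exact ⟨fun h => ⟨h.1, h.2.2⟩, fun h => ⟨h.1, h2 h.1, h.2⟩⟩

/-- In a nonnegative combination of generators at which `u` vanishes, every term has `u`-value zero,
so only generators in the hyperplane contribute. This gives both the rationality of faces and their
finiteness. -/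
theorem cut_eq_hull {s : Set (RealSpace N)} {u : DualSpace N} (hu : ∀ v ∈ s, 0 ≤ u v) :
    cut (PointedCone.hull ℝ s) u = PointedCone.hull ℝ {v ∈ s | u v = 0} := by
  apply le_antisymm
  · rintro ν ⟨hν, h0⟩
    induction hν using Submodule.span_induction with
    | mem x hx => exact Submodule.subset_span ⟨hx, h0⟩
    | zero => exact zero_mem _
    | add x y hx hy ihx ihy =>
      have h1 := nonneg_of_mem_hull hu hx
      have h2 := nonneg_of_mem_hull hu hy
      rw [map_add] at h0
      exact add_mem (ihx (by linarith)) (ihy (by linarith))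
    | smul c x hx ih =>
      have h : c • x = (c : ℝ) • x := rfl
      rw [h, map_smul, smul_eq_mul] at h0
      rcases mul_eq_zero.1 h0 with hc | hx0
      · rw [h, hc, zero_smul]; exact zero_mem _
      · exact Submodule.smul_mem _ c (ih hx0)
  · refine Submodule.span_le.2 fun v hv => ?_
    exact ⟨Submodule.subset_span hv.1, hv.2⟩

theorem isFace_hull {s : Set (RealSpace N)} {τ : PointedCone ℝ (RealSpace N)}
    (h : IsFace τ (PointedCone.hull ℝ s)) : ∃ t ⊆ s, τ = PointedCone.hull ℝ t := by
  obtain ⟨u, hu, rfl⟩ := isFace_iff_exists_cut.1 h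
  exact ⟨_, Set.sep_subset _ _, cut_eq_hull fun v hv => hu (Submodule.subset_span hv)⟩

theorem IsRational.of_isFace {σ τ : PointedCone ℝ (RealSpace N)} (hσ : IsRational σ)
    (h : IsFace τ σ) : IsRational τ := by
  classical
  obtain ⟨s, rfl⟩ := hσ
  obtain ⟨t, ht, rfl⟩ := isFace_hull h
  obtain ⟨t', ht', rfl⟩ := Set.subset_image_iff.1 ht
  exact ⟨(s.finite_toSet.subset ht').toFinset, by simp⟩

theorem IsRational.finite_faces {σ : PointedCone ℝ (RealSpace N)} (hσ : IsRational σ) :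
    {τ | IsFace τ σ}.Finite := by
  obtain ⟨s, rfl⟩ := hσ
  refine (((s.finite_toSet.image fun n : N => (1 : ℝ) ⊗ₜ[ℤ] n).finite_subsets).image
    (PointedCone.hull ℝ)).subset fun τ hτ => ?_
  obtain ⟨t, ht, rfl⟩ := isFace_hull hτ
  exact ⟨t, ht, rfl⟩

/-- A linear form that is nonnegative on a face of a polyhedral cone becomes nonnegative on the
whole cone after adding a multiple of the form that cuts out the face. -/
theorem exists_add_smul_mem_dualCone {s : Set (RealSpace N)} (hs : s.Finite) {u w : DualSpace N}
    (hu : u ∈ dualCone (PointedCone.hull ℝ s))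
    (hw : w ∈ dualCone (cut (PointedCone.hull ℝ s) u)) :
    ∃ K : ℝ, w + K • u ∈ dualCone (PointedCone.hull ℝ s) := by
  classical
  lift s to Finset (RealSpace N) using hs
  have hu' : ∀ v ∈ s, 0 ≤ u v := fun v hv => hu (Submodule.subset_span hv)
  -- The first condition concerns only generators with `u = 0`, which lie in the face; the condition
  -- on pairs is vacuous because `-u ≤ 0` on the generators.
  obtain ⟨K, _, hK⟩ := (fourierMotzkin s (fun v => - u v) fun v => w v).2 ⟨fun v hv h =>
      hw ⟨Submodule.subset_span hv, by linarith [hu' v hv]⟩, fun v hv w' _ h => by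
      linarith [hu' v hv]⟩
  refine ⟨K, fun ν hν => ?_⟩
  refine nonneg_of_mem_hull (u := w + K • u) (fun v hv => ?_) hν
  have h1 := hK v hv
  rw [LinearMap.add_apply, LinearMap.smul_apply, smul_eq_mul]
  linarith

/-- If `u` cuts `τ` out of `σ` and `w` cuts `ρ` out of `τ`, then `w` plus a large multiple of `u`
cuts `ρ` out of `σ`. Such a multiple exists because `σ` is finitely generated. -/
theorem isFace_trans {ρ τ σ : PointedCone ℝ (RealSpace N)} (hσ : IsRational σ) (h : IsFace ρ τ)
    (h' : IsFace τ σ) : IsFace ρ σ := by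
  obtain ⟨s, rfl⟩ := hσ
  obtain ⟨u, hu, rfl⟩ := isFace_iff_exists_cut.1 h'
  obtain ⟨w, hw, rfl⟩ := isFace_iff_exists_cut.1 h
  obtain ⟨K, hK⟩ := exists_add_smul_mem_dualCone (s.finite_toSet.image _) hu hw
  -- The form `w + K • u` may vanish outside `τ`; the additional `u` prevents this.
  refine ⟨w + K • u + u, add_mem hK hu, fun ν => ?_⟩
  simp only [mem_cut, LinearMap.add_apply, LinearMap.smul_apply, smul_eq_mul]
  constructor
  · rintro ⟨⟨h1, h2⟩, h3⟩
    exact ⟨h1, by rw [h2, h3]; ring⟩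
  · rintro ⟨h1, h2⟩
    have h3 : 0 ≤ w ν + K * u ν := hK h1
    have h4 : 0 ≤ u ν := hu h1
    have h5 : u ν = 0 := by linarith
    rw [h5] at h2
    exact ⟨⟨h1, h5⟩, by linarith⟩

theorem IsStrictlyConvex.mono {σ τ : PointedCone ℝ (RealSpace N)} (hσ : IsStrictlyConvex σ)
    (h : τ ≤ σ) : IsStrictlyConvex τ := fun ν h1 h2 => hσ ν (h h1) (h h2)

theorem realify_one_tmul (m : CharLattice N) (n : N) :
    realify m ((1 : ℝ) ⊗ₜ[ℤ] n) = (m n : ℝ) := by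
  rw [realify_tmul, one_mul]

theorem realify_injective : Function.Injective (realify : CharLattice N → DualSpace N) := by
  intro m m' h
  ext n
  have := congrArg (fun u : DualSpace N => u ((1 : ℝ) ⊗ₜ[ℤ] n)) h
  simpa [realify_tmul] using this

theorem IsRational.mem_of_forall [Module.Finite ℤ N] {σ : PointedCone ℝ (RealSpace N)}
    (hσ : IsRational σ) {ν : RealSpace N} (h : ∀ u ∈ dualCone σ, 0 ≤ u ν) : ν ∈ σ := by
  obtain ⟨s, rfl⟩ := hσ
  exact mem_hull_of_forall (s.finite_toSet.image _) fun u hu =>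
    h u fun ν hν => nonneg_of_mem_hull hu hν

/-- Fourier–Motzkin elimination on generators: keep those on the nonnegative side and add, for each
pair on opposite sides, its positive integral combination in the hyperplane `m = 0`. All of these
are lattice vectors. -/
theorem IsRational.inf_halfSpace [Module.Finite ℤ N] {σ : PointedCone ℝ (RealSpace N)}
    (hσ : IsRational σ) (m : CharLattice N) : IsRational (σ ⊓ halfSpace (realify m)) := by
  classical
  obtain ⟨s, rfl⟩ := hσ
  set t : Finset N := (s.filter fun v => 0 ≤ m v) ∪
    ((s ×ˢ s).filter fun p => 0 < m p.1 ∧ m p.2 < 0).image fun p => m p.1 • p.2 - m p.2 • p.1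
    with ht
  have hpair : ∀ (p q : N), ((1 : ℝ) ⊗ₜ[ℤ] (m p • q - m q • p) : RealSpace N) =
      (m p : ℝ) • ((1 : ℝ) ⊗ₜ[ℤ] q) + (-(m q : ℝ)) • ((1 : ℝ) ⊗ₜ[ℤ] p) := by
    intro p q
    rw [TensorProduct.tmul_sub, TensorProduct.tmul_smul, TensorProduct.tmul_smul, neg_smul,
      sub_eq_add_neg, Int.cast_smul_eq_zsmul, Int.cast_smul_eq_zsmul]
  have hs : ∀ v ∈ s, ((1 : ℝ) ⊗ₜ[ℤ] v : RealSpace N) ∈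
      PointedCone.hull ℝ ((fun n : N => (1 : ℝ) ⊗ₜ[ℤ] n) '' (s : Set N)) := fun v hv =>
    Submodule.subset_span ⟨v, hv, rfl⟩
  refine ⟨t, le_antisymm ?_ (Submodule.span_le.2 ?_)⟩
  · rintro ν ⟨hν, hmν⟩
    -- By duality it is enough to test a form `u` that is nonnegative on the new generators. Some `c
    -- ≥ 0` makes `u - c • m` nonnegative on the old generators, and then `u ν ≥ c * m ν ≥ 0`.
    refine mem_hull_of_forall (t.finite_toSet.image _) fun u hu => ?_
    have hu1 : ∀ v ∈ s, (0 : ℝ) ≤ m v → 0 ≤ u ((1 : ℝ) ⊗ₜ[ℤ] v) := fun v hv h0 =>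
      hu _ ⟨v, Finset.mem_union_left _ (Finset.mem_filter.2 ⟨hv, by exact_mod_cast h0⟩), rfl⟩
    have hu2 : ∀ p ∈ s, ∀ q ∈ s, (0 : ℝ) < m p → (m q : ℝ) < 0 →
        0 ≤ m p * u ((1 : ℝ) ⊗ₜ[ℤ] q) - m q * u ((1 : ℝ) ⊗ₜ[ℤ] p) := fun p hp q hq h1 h2 => by
      have := hu _ ⟨m p • q - m q • p, Finset.mem_union_right _ (Finset.mem_image.2 ⟨(p, q),
        Finset.mem_filter.2 ⟨Finset.mk_mem_product hp hq, by exact_mod_cast h1,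
          by exact_mod_cast h2⟩, rfl⟩), rfl⟩
      simp only [hpair, map_add, map_smul, smul_eq_mul] at this
      linarith
    obtain ⟨c, hc, h⟩ := (fourierMotzkin s (fun v => (m v : ℝ))
        fun v => u ((1 : ℝ) ⊗ₜ[ℤ] v)).2 ⟨hu1, hu2⟩
    have h1 : 0 ≤ (u - c • realify m) ν := by
      refine nonneg_of_mem_hull ?_ hν
      rintro _ ⟨v, hv, rfl⟩
      have := h v hv
      rw [LinearMap.sub_apply, LinearMap.smul_apply, realify_one_tmul, smul_eq_mul]
      linarith
    rw [LinearMap.sub_apply, LinearMap.smul_apply, smul_eq_mul] at h1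
    have h2 := mul_nonneg hc (mem_halfSpace.1 hmν)
    linarith
  · rintro _ ⟨v, hv, rfl⟩
    rcases Finset.mem_union.1 hv with hv | hv
    · obtain ⟨hv, h0⟩ := Finset.mem_filter.1 hv
      refine ⟨hs v hv, mem_halfSpace.2 ?_⟩
      rw [realify_one_tmul]; exact_mod_cast h0
    · obtain ⟨⟨p, q⟩, hp, rfl⟩ := Finset.mem_image.1 hv
      obtain ⟨hp, hp1, hp2⟩ := Finset.mem_filter.1 hp
      obtain ⟨hp, hq⟩ := Finset.mem_product.1 hp
      have h1 : (0 : ℝ) ≤ m p := by exact_mod_cast hp1.le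
      have h2 : (0 : ℝ) ≤ -(m q : ℝ) := by
        have : (m q : ℝ) ≤ 0 := by exact_mod_cast hp2.le
        linarith
      constructor
      · simp only [hpair]
        exact add_mem (PointedCone.smul_mem _ h1 (hs q hq)) (PointedCone.smul_mem _ h2 (hs p hp))
      · refine mem_halfSpace.2 ?_
        simp only [hpair, map_add, map_smul, realify_one_tmul, smul_eq_mul]
        linarith

/-- The cone is cut out of `σ` by the half-spaces `0 ≤ a - m` for `a ∈ S`, one at a time. -/
theorem IsRational.linearityCone [Module.Finite ℤ N] {σ : PointedCone ℝ (RealSpace N)}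
    (hσ : IsRational σ) (S : Finset (CharLattice N)) (m : CharLattice N) :
    IsRational (linearityCone σ S m) := by
  classical
  induction S using Finset.induction_on with
  | empty =>
    convert hσ
    ext ν
    simp [ToricBlowup.linearityCone]
  | insert a S _ ih =>
    convert ih.inf_halfSpace (a - m) using 1
    ext ν
    simp only [ToricBlowup.linearityCone, Submodule.mem_mk, Submodule.mem_inf, mem_halfSpace]
    change (_ ∧ _) ↔ (_ ∧ _) ∧ _
    rw [map_sub, LinearMap.sub_apply, sub_nonneg]
    simp only [Finset.mem_coe, Finset.mem_insert, forall_eq_or_imp]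
    tauto

/-- The cone of a finitely generated semigroup is the dual of the cone that it defines. -/
theorem realCone_eq_dualCone [Module.Free ℤ N] [Module.Finite ℤ N] {Γ : AddSubmonoid (CharLattice N)}
    (hfg : Γ.FG) {σ : PointedCone ℝ (RealSpace N)}
    (h : ∀ ν, ν ∈ σ ↔ ∀ γ ∈ Γ, 0 ≤ realify γ ν) : realCone Γ = dualCone σ := by
  obtain ⟨s, rfl⟩ := hfg
  apply le_antisymm
  · refine Submodule.span_le.2 ?_
    rintro _ ⟨γ, hγ, rfl⟩ ν hν
    exact (h ν).1 hν γ hγ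
  · intro u hu
    suffices hs : u ∈ PointedCone.hull ℝ (realify '' (s : Set (CharLattice N))) from
      Submodule.span_mono (Set.image_mono AddSubmonoid.subset_closure) hs
    -- Farkas' lemma in `M_ℝ`: a functional there is evaluation at some `ν ∈ N_ℝ`, and nonnegativity
    -- on the generators of `Γ` puts `ν` in `σ`.
    refine mem_hull_of_forall (s.finite_toSet.image realify) fun w hw => ?_
    obtain ⟨ν, hν⟩ : ∃ ν : RealSpace N, ∀ x : DualSpace N, w x = x ν := by
      exact exists_eval_eq w
    rw [hν]
    have hw' : ∀ x ∈ s, 0 ≤ realify x ν := fun x hx => by rw [← hν]; exact hw _ ⟨x, hx, rfl⟩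
    refine mem_dualCone.1 hu ν ((h ν).2 fun γ hγ => ?_)
    induction hγ using AddSubmonoid.closure_induction with
    | mem x hx => exact hw' x hx
    | zero => simp
    | add x y _ _ hx hy => rw [map_add]; exact add_nonneg hx hy

/-- Biduality: `σ` is recovered from its dual cone, and `Γ` generates the dual cone. -/
theorem mem_iff_of_realCone_eq [Module.Finite ℤ N] {Γ : AddSubmonoid (CharLattice N)}
    {σ : PointedCone ℝ (RealSpace N)} (hσ : IsRational σ) (h : realCone Γ = dualCone σ)
    (ν : RealSpace N) : ν ∈ σ ↔ ∀ γ ∈ Γ, 0 ≤ realify γ ν := by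
  constructor
  · intro hν γ hγ
    have : realify γ ∈ dualCone σ := by
      rw [← h]; exact Submodule.subset_span ⟨γ, hγ, rfl⟩
    exact this hν
  · intro hν
    refine hσ.mem_of_forall fun u hu => ?_
    rw [← h] at hu
    let w : Module.Dual ℝ (DualSpace N) := Module.Dual.eval ℝ (RealSpace N) ν
    have hw : ∀ t ∈ realify '' (Γ : Set (CharLattice N)), 0 ≤ w t := by
      rintro _ ⟨γ, hγ, rfl⟩
      exact hν γ hγ
    exact nonneg_of_mem_hull hw hu

end RationalCones

end ToricBlowup

namespace ToricBlowup

/-! ### Semigroups of faces and of linearity cones. -/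

section Semigroups

variable {N : Type u} [AddCommGroup N] {Γ Γ' : AddSubmonoid (CharLattice N)}
  {σ τ ρ : PointedCone ℝ (RealSpace N)}

theorem perpLattice_vanish {m : CharLattice N} (hm : m ∈ perpLattice Γ τ) :
    ∀ ν ∈ τ, realify m ν = 0 := by
  intro ν hν
  unfold perpLattice at hm
  induction hm using AddSubgroup.closure_induction with
  | mem x hx => exact hx.2 ν hν
  | zero => simp
  | add x y _ _ hx hy => rw [map_add, LinearMap.add_apply, hx, hy, add_zero]
  | neg x _ hx => rw [map_neg, LinearMap.neg_apply, hx, neg_zero]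

theorem mem_perpLattice {m : CharLattice N} (hm : m ∈ Γ) (h : ∀ ν ∈ τ, realify m ν = 0) :
    m ∈ perpLattice Γ τ := AddSubgroup.subset_closure ⟨hm, h⟩

theorem le_faceSemigroup : Γ ≤ faceSemigroup Γ τ := le_sup_left

theorem perpLattice_le_faceSemigroup {m : CharLattice N} (hm : m ∈ perpLattice Γ τ) :
    m ∈ faceSemigroup Γ τ :=
  (le_sup_right : (perpLattice Γ τ).toAddSubmonoid ≤ faceSemigroup Γ τ) hm

theorem neg_mem_faceSemigroup {m : CharLattice N} (hm : m ∈ Γ) (h : ∀ ν ∈ τ, realify m ν = 0) :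
    -m ∈ faceSemigroup Γ τ :=
  perpLattice_le_faceSemigroup (neg_mem (mem_perpLattice hm h))

/-- An element of `Γ` that vanishes on `τ` is `y + z` with `y ∈ Γ'` and `z ∈ M(τ, Γ')`. Then `y`
vanishes on `τ` as well, so `M(τ, Γ) ⊆ M(τ, Γ')`. Localizations can therefore be compared on the
semigroups before localizing. -/
theorem faceSemigroup_le (h : Γ ≤ faceSemigroup Γ' τ) :
    faceSemigroup Γ τ ≤ faceSemigroup Γ' τ := by
  refine sup_le h ?_
  suffices perpLattice Γ τ ≤ perpLattice Γ' τ from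
    fun x hx => perpLattice_le_faceSemigroup (this hx)
  refine (AddSubgroup.closure_le _).2 ?_
  rintro m ⟨hm, h0⟩
  obtain ⟨y, hy, z, hz, rfl⟩ := AddSubmonoid.mem_sup.1 (h hm)
  refine add_mem (mem_perpLattice hy fun ν hν => ?_) hz
  have h1 := h0 ν hν
  rw [map_add, LinearMap.add_apply, perpLattice_vanish hz ν hν, add_zero] at h1
  exact h1

theorem faceSemigroup_eq (h : Γ ≤ faceSemigroup Γ' τ) (h' : Γ' ≤ faceSemigroup Γ τ) :
    faceSemigroup Γ τ = faceSemigroup Γ' τ :=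
  le_antisymm (faceSemigroup_le h) (faceSemigroup_le h')

theorem faceSemigroup_antitone (h : τ ≤ ρ) : faceSemigroup Γ ρ ≤ faceSemigroup Γ τ :=
  sup_le le_faceSemigroup fun _ hx => perpLattice_le_faceSemigroup
    ((AddSubgroup.closure_mono fun _ hm => ⟨hm.1, fun ν hν => hm.2 ν (h hν)⟩ :
      perpLattice Γ ρ ≤ perpLattice Γ τ) hx)

theorem faceSemigroup_mono (h : Γ ≤ Γ') : faceSemigroup Γ τ ≤ faceSemigroup Γ' τ :=
  faceSemigroup_le (h.trans le_faceSemigroup)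

theorem faceSemigroup_faceSemigroup (h : τ ≤ ρ) :
    faceSemigroup (faceSemigroup Γ ρ) τ = faceSemigroup Γ τ :=
  faceSemigroup_eq (faceSemigroup_antitone h) (le_faceSemigroup.trans le_faceSemigroup)

theorem le_chartSemigroup {S : Set (CharLattice N)} {m : CharLattice N} :
    Γ ≤ chartSemigroup Γ S m := le_sup_left

theorem sub_mem_chartSemigroup {S : Set (CharLattice N)} {m m' : CharLattice N} (h : m' ∈ S) :
    m' - m ∈ chartSemigroup Γ S m :=
  (le_sup_right : _ ≤ chartSemigroup Γ S m) (AddSubmonoid.subset_closure ⟨m', h, rfl⟩)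

theorem chartSemigroup_le {S : Set (CharLattice N)} {m : CharLattice N} (h : Γ ≤ Γ')
    (h' : ∀ m' ∈ S, m' - m ∈ Γ') : chartSemigroup Γ S m ≤ Γ' := by
  refine sup_le h ((AddSubmonoid.closure_le).2 ?_)
  rintro _ ⟨m', hm', rfl⟩
  exact h' m' hm'

/-- The conditions on a cone `σ` and a semigroup `Γ` under which `Spec A[t^Γ]` is an affine toric
scheme. -/
structure IsToricPair (σ : PointedCone ℝ (RealSpace N)) (Γ : AddSubmonoid (CharLattice N)) :
    Prop where
  rational : IsRational σ
  strictlyConvex : IsStrictlyConvex σ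
  fg : Γ.FG
  closure_eq_top : AddSubgroup.closure (Γ : Set (CharLattice N)) = ⊤
  realCone_eq : realCone Γ = dualCone σ

theorem closure_eq_top_of_le (h : AddSubgroup.closure (Γ : Set (CharLattice N)) = ⊤) (hle : Γ ≤ Γ') :
    AddSubgroup.closure (Γ' : Set (CharLattice N)) = ⊤ :=
  top_le_iff.1 (h ▸ AddSubgroup.closure_mono hle)

theorem linearityCone_le {S : Set (CharLattice N)} {m : CharLattice N} :
    linearityCone σ S m ≤ σ := fun _ h => h.1

/-- On the common part of two linearity cones, the two linear forms agree. -/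
theorem isFace_linearityCone_inf {S : Set (CharLattice N)} {m m' : CharLattice N} (hm : m ∈ S)
    (hm' : m' ∈ S) :
    IsFace (linearityCone σ S m ⊓ linearityCone σ S m') (linearityCone σ S m) := by
  refine ⟨realify m' - realify m, fun ν hν => ?_, fun ν => ?_⟩
  · have : realify m ν ≤ realify m' ν := hν.2 m' hm'
    exact sub_nonneg.2 this
  · rw [Submodule.mem_inf, LinearMap.sub_apply, sub_eq_zero]
    refine and_congr_right fun h1 => ⟨fun h2 => le_antisymm (h2.2 m hm) (h1.2 m' hm'),
      fun h2 => ⟨h1.1, fun t ht => ?_⟩⟩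
    rw [h2]; exact h1.2 t ht

theorem isFace_linearityCone_of_le {S : Set (CharLattice N)} {m m' : CharLattice N} (hm : m ∈ S)
    (hm' : m' ∈ S) (h : linearityCone σ S m ≤ linearityCone σ S m') :
    IsFace (linearityCone σ S m) (linearityCone σ S m') := by
  have := isFace_linearityCone_inf (σ := σ) hm' hm
  rwa [inf_eq_right.2 h] at this

/-- If `x ∈ Γ` vanishes on `σ`, then `-x` lies in the cone of `Γ`, so `(n + 1) • (-x) ∈ Γ` for some
`n`; adding `n • x` gives `-x ∈ Γ`. Thus localization at `σ` inverts only what is already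
invertible. -/
theorem IsToricPair.faceSemigroup_self (h : IsToricPair σ Γ) : faceSemigroup Γ σ = Γ := by
  refine le_antisymm (sup_le le_rfl ?_) le_faceSemigroup
  intro x hx
  have hx' : x ∈ perpLattice Γ σ := hx
  have h1 : realify x ∈ realCone Γ := by
    rw [h.realCone_eq]
    intro ν hν
    exact (perpLattice_vanish hx' ν hν).ge
  clear hx h1
  unfold perpLattice at hx'
  induction hx' using AddSubgroup.closure_induction'' with
  | mem x hx => exact hx.1
  | zero => exact zero_mem _
  | neg_mem x hx =>
    obtain ⟨n, hn, hmem⟩ := exists_nsmul_mem (Γ := Γ) (x := -x) (by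
      rw [h.realCone_eq]
      intro ν hν
      change 0 ≤ realify (-x) ν
      rw [map_neg, LinearMap.neg_apply, hx.2 ν hν, neg_zero])
    obtain ⟨n, rfl⟩ : ∃ l, n = l + 1 := ⟨n - 1, by omega⟩
    have h2 : -x = (n + 1) • (-x) + n • x := by rw [add_smul, one_smul, smul_neg]; abel
    rw [h2]
    exact add_mem hmem (Γ.nsmul_mem hx.1 n)
  | add x y _ _ hx hy => exact add_mem hx hy

theorem IsToricPair.exists_cutting (h : IsToricPair σ Γ) (hτ : IsFace τ σ) :
    ∃ m ∈ Γ, (∀ ν, ν ∈ τ ↔ ν ∈ σ ∧ realify m ν = 0) ∧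
      ∀ x, x ∈ faceSemigroup Γ τ ↔ ∃ k : ℕ, x + k • m ∈ Γ :=
  ToricBlowup.exists_cutting h.fg h.realCone_eq hτ

theorem fg_sup_closure {s : Set (CharLattice N)} (hs : s.Finite) (h : Γ.FG) :
    (Γ ⊔ AddSubmonoid.closure s).FG := by
  classical
  obtain ⟨t, rfl⟩ := h
  lift s to Finset (CharLattice N) using hs
  exact ⟨t ∪ s, by rw [Finset.coe_union, AddSubmonoid.closure_union]⟩

variable [Module.Finite ℤ N]

theorem IsToricPair.nonneg (h : IsToricPair σ Γ) {γ : CharLattice N} (hγ : γ ∈ Γ) {ν : RealSpace N}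
    (hν : ν ∈ σ) : 0 ≤ realify γ ν :=
  (mem_iff_of_realCone_eq h.rational h.realCone_eq ν).1 hν γ hγ

/-- Every element of `Γ` that cuts out the face `τ` generates the localization `Γ_τ` of `Γ`. -/
theorem IsToricPair.mem_faceSemigroup_iff (h : IsToricPair σ Γ) {m : CharLattice N} (hm : m ∈ Γ)
    (hτ : ∀ ν, ν ∈ τ ↔ ν ∈ σ ∧ realify m ν = 0) (x : CharLattice N) :
    x ∈ faceSemigroup Γ τ ↔ ∃ k : ℕ, x + k • m ∈ Γ := by
  have hmσ : realify m ∈ dualCone σ := fun ν hν => h.nonneg hm hν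
  have hτc : τ = cut σ (realify m) := SetLike.ext hτ
  constructor
  · intro hx
    obtain ⟨m₀, hm₀, h1, h2⟩ := h.exists_cutting ⟨_, hmσ, hτ⟩
    obtain ⟨k, hk⟩ := (h2 x).1 hx
    obtain ⟨s, hs⟩ := h.rational
    -- Since `m₀` vanishes on the face cut out by `m`, a multiple of `m` dominates it on `σ`. A
    -- positive multiple of `n • m - m₀` then lies in `Γ`, and multiples of `m` can replace those of
    -- `m₀` as denominators.
    obtain ⟨K, hK⟩ : ∃ K : ℝ, -realify m₀ + K • realify m ∈ dualCone σ := by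
      rw [hs] at hmσ ⊢
      refine exists_add_smul_mem_dualCone (s.finite_toSet.image _) hmσ fun ν hν => ?_
      rw [← hs, ← hτc] at hν
      change 0 ≤ -(realify m₀ ν)
      rw [((h1 ν).1 hν).2, neg_zero]
    obtain ⟨n, hn⟩ := exists_nat_ge K
    obtain ⟨l, hl, hmem⟩ := exists_nsmul_mem (Γ := Γ) (x := n • m - m₀) (by
      rw [h.realCone_eq]
      intro ν hν
      have h3 : 0 ≤ -(realify m₀ ν) + K * realify m ν := hK hν
      have h4 := mul_le_mul_of_nonneg_right hn (h.nonneg hm hν)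
      change 0 ≤ realify (n • m - m₀) ν
      rw [map_sub, map_nsmul, LinearMap.sub_apply, LinearMap.smul_apply, nsmul_eq_mul]
      linarith)
    obtain ⟨l, rfl⟩ : ∃ l', l = l' + 1 := ⟨l - 1, by omega⟩
    refine ⟨k * ((l + 1) * n), ?_⟩
    have h5 : x + (k * ((l + 1) * n)) • m =
        (x + k • m₀) + k • ((l + 1) • (n • m - m₀) + l • m₀) := by
      rw [mul_smul, mul_smul, smul_sub, add_smul l 1 m₀, one_smul, smul_add, smul_sub, smul_add]
      abel
    rw [h5]
    exact add_mem hk (Γ.nsmul_mem (add_mem hmem (Γ.nsmul_mem hm₀ l)) k)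
  · rintro ⟨k, hk⟩
    have h1 : x = (x + k • m) + k • (-m) := by rw [smul_neg]; abel
    rw [h1]
    exact add_mem (le_faceSemigroup hk) (nsmul_mem (neg_mem_faceSemigroup hm fun ν hν =>
      ((hτ ν).1 hν).2) k)

variable [Module.Free ℤ N]

/-- For an element `m` that cuts out `τ`, the semigroup is `Γ + ℕ(-m)`, hence finitely generated.
Nonnegativity of both `m` and `-m` means `m = 0`, so `τ` is the cone that this semigroup defines,
and `realCone_eq_dualCone` applies. -/
theorem IsToricPair.face (h : IsToricPair σ Γ) (hτ : IsFace τ σ) :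
    IsToricPair τ (faceSemigroup Γ τ) := by
  obtain ⟨m, hm, h1, h2⟩ := h.exists_cutting hτ
  have hfg : (faceSemigroup Γ τ).FG := by
    have : faceSemigroup Γ τ = Γ ⊔ AddSubmonoid.closure {-m} := by
      apply le_antisymm
      · intro x hx
        obtain ⟨k, hk⟩ := (h2 x).1 hx
        have h3 : x = (x + k • m) + k • (-m) := by rw [smul_neg]; abel
        rw [h3]
        exact AddSubmonoid.add_mem_sup hk
          (nsmul_mem (AddSubmonoid.subset_closure (Set.mem_singleton _)) k)
      · refine sup_le le_faceSemigroup (AddSubmonoid.closure_le.2 ?_)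
        rintro _ rfl
        exact neg_mem_faceSemigroup hm fun ν hν => ((h1 ν).1 hν).2
    rw [this]
    exact fg_sup_closure (Set.finite_singleton _) h.fg
  refine ⟨h.rational.of_isFace hτ, h.strictlyConvex.mono (le_of_isFace hτ), hfg,
    closure_eq_top_of_le h.closure_eq_top le_faceSemigroup, realCone_eq_dualCone hfg fun ν => ?_⟩
  constructor
  · intro hν γ hγ
    obtain ⟨k, hk⟩ := (h2 γ).1 hγ
    have h3 := h.nonneg hk (le_of_isFace hτ hν)
    rwa [map_add, map_nsmul, LinearMap.add_apply, LinearMap.smul_apply, ((h1 ν).1 hν).2, smul_zero,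
      add_zero] at h3
  · intro hν
    have hσ : ν ∈ σ := (mem_iff_of_realCone_eq h.rational h.realCone_eq ν).2
      fun γ hγ => hν γ (le_faceSemigroup hγ)
    refine (h1 ν).2 ⟨hσ, le_antisymm ?_ (h.nonneg hm hσ)⟩
    have := hν _ (neg_mem_faceSemigroup hm fun ν hν => ((h1 ν).1 hν).2)
    rwa [map_neg, LinearMap.neg_apply, neg_nonneg] at this

/-- Nonnegativity of `Γ` at `ν` means `ν ∈ σ`, and nonnegativity of the differences `m' - m` means
that `m` is minimal at `ν`; hence `realCone_eq_dualCone` applies. -/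
theorem IsToricPair.linearityCone (h : IsToricPair σ Γ) (S : Finset (CharLattice N))
    (m : CharLattice N) :
    IsToricPair (linearityCone σ S m) (chartSemigroup Γ S m) := by
  have hfg : (chartSemigroup Γ S m).FG := by
    refine fg_sup_closure ?_ h.fg
    convert S.finite_toSet.image fun m' => m' - m using 1
    ext x
    simp [eq_comm]
  refine ⟨h.rational.linearityCone S m, h.strictlyConvex.mono linearityCone_le, hfg,
    closure_eq_top_of_le h.closure_eq_top le_chartSemigroup, realCone_eq_dualCone hfg fun ν => ?_⟩
  constructor
  · intro hν γ hγ
    obtain ⟨y, hy, z, hz, rfl⟩ := AddSubmonoid.mem_sup.1 hγ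
    rw [map_add, LinearMap.add_apply]
    refine add_nonneg (h.nonneg hy hν.1) ?_
    clear hγ
    induction hz using AddSubmonoid.closure_induction with
    | mem x hx =>
      obtain ⟨m', hm', rfl⟩ := hx
      rw [map_sub, LinearMap.sub_apply]
      exact sub_nonneg.2 (hν.2 m' hm')
    | zero => simp
    | add x y _ _ hx hy => rw [map_add, LinearMap.add_apply]; exact add_nonneg hx hy
  · intro hν
    refine ⟨(mem_iff_of_realCone_eq h.rational h.realCone_eq ν).2
      fun γ hγ => hν γ (le_chartSemigroup hγ), fun m' hm' => ?_⟩
    have := hν _ (sub_mem_chartSemigroup hm')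
    rwa [map_sub, LinearMap.sub_apply, sub_nonneg] at this

end Semigroups

/-! ### The subdivision of one cone by a finite set of exponents. -/

section BlowupCharts

variable {N : Type u} [AddCommGroup N] {σ τ ρ ρ' : PointedCone ℝ (RealSpace N)}
  {Γ H H' : AddSubmonoid (CharLattice N)}

/-- `ρ` is a cone of the fan `Σ(S)`, and `H` is its semigroup. -/
def IsBlowupChart (σ : PointedCone ℝ (RealSpace N)) (Γ : AddSubmonoid (CharLattice N))
    (S : Finset (CharLattice N)) (ρ : PointedCone ℝ (RealSpace N))
    (H : AddSubmonoid (CharLattice N)) : Prop :=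
  ∃ m ∈ S, IsFace ρ (linearityCone σ S m) ∧ H = faceSemigroup (chartSemigroup Γ S m) ρ

/-- `S + Γ = S' + Γ`. -/
def SameModulo (Γ : AddSubmonoid (CharLattice N)) (S S' : Finset (CharLattice N)) : Prop :=
  (∀ m ∈ S, ∃ m' ∈ S', ∃ γ ∈ Γ, m = m' + γ) ∧ ∀ m' ∈ S', ∃ m ∈ S, ∃ γ ∈ Γ, m' = m + γ

theorem SameModulo.symm {S S' : Finset (CharLattice N)} (h : SameModulo Γ S S') :
    SameModulo Γ S' S := ⟨h.2, h.1⟩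

theorem SameModulo.refl (S : Finset (CharLattice N)) : SameModulo Γ S S :=
  ⟨fun m hm => ⟨m, hm, 0, zero_mem _, by simp⟩, fun m hm => ⟨m, hm, 0, zero_mem _, by simp⟩⟩

variable {S S' : Finset (CharLattice N)}

theorem IsBlowupChart.le (h : IsBlowupChart σ Γ S ρ H) : ρ ≤ σ := by
  obtain ⟨m, _, h, _⟩ := h
  exact (le_of_isFace h).trans linearityCone_le

theorem IsBlowupChart.semigroup_le (h : IsBlowupChart σ Γ S ρ H) : Γ ≤ H := by
  obtain ⟨m, _, _, rfl⟩ := h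
  exact le_chartSemigroup.trans le_faceSemigroup

/-- If `ρ` lies in the linearity cones of `m` and `m'`, both are minimal on it, so `m - m'` vanishes
on `ρ` and is invertible after localization at `ρ`. This carries the generators `t - m'` to `t - m`
and back. -/
theorem IsBlowupChart.unique (h : IsBlowupChart σ Γ S ρ H) (h' : IsBlowupChart σ Γ S ρ H') :
    H = H' := by
  obtain ⟨m, hm, hρ, rfl⟩ := h
  obtain ⟨m', hm', hρ', rfl⟩ := h'
  have key : ∀ m ∈ S, ∀ m' ∈ S, ρ ≤ linearityCone σ S m → ρ ≤ linearityCone σ S m' →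
      chartSemigroup Γ S m ≤ faceSemigroup (chartSemigroup Γ S m') ρ := by
    intro m hm m' hm' h h'
    refine chartSemigroup_le (le_chartSemigroup.trans le_faceSemigroup) fun t ht => ?_
    have h1 : t - m = (t - m') + -(m - m') := by abel
    rw [h1]
    refine add_mem (le_faceSemigroup (sub_mem_chartSemigroup ht))
      (neg_mem_faceSemigroup (sub_mem_chartSemigroup hm) fun ν hν => ?_)
    rw [map_sub, LinearMap.sub_apply, sub_eq_zero]
    exact le_antisymm ((h hν).2 m' hm') ((h' hν).2 m hm)
  exact faceSemigroup_eq (key m hm m' hm' (le_of_isFace hρ) (le_of_isFace hρ'))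
    (key m' hm' m hm (le_of_isFace hρ') (le_of_isFace hρ))

theorem exists_vertexExponents_le {m : CharLattice N} (hm : m ∈ S) :
    ∃ m' ∈ vertexExponents σ (S : Set (CharLattice N)),
      linearityCone σ S m ≤ linearityCone σ S m' := by
  classical
  obtain ⟨c, hc, hmax⟩ := Finset.exists_le_maximal (S.image fun m => linearityCone σ S m)
    (Finset.mem_image_of_mem _ hm)
  obtain ⟨m', hm', rfl⟩ := Finset.mem_image.1 hmax.1
  exact ⟨m', ⟨hm', fun t ht hle => le_antisymm (hmax.2 (Finset.mem_image_of_mem _ ht) hle) hle⟩, hc⟩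

variable [Module.Finite ℤ N]

theorem IsBlowupChart.face (hσ : IsRational σ) (h : IsBlowupChart σ Γ S ρ H)
    (hρ' : IsFace ρ' ρ) : IsBlowupChart σ Γ S ρ' (faceSemigroup H ρ') := by
  obtain ⟨m, hm, hρ, rfl⟩ := h
  exact ⟨m, hm, isFace_trans (hσ.linearityCone S m) hρ' hρ,
    faceSemigroup_faceSemigroup (le_of_isFace hρ')⟩

/-- The intersection `μ` of the two linearity cones is a face of the first. The cone `ρ'` cuts a
face out of `μ`, hence out of the first linearity cone, and intersecting this face with `ρ` gives `ρ
⊓ ρ'`. -/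
theorem IsBlowupChart.isFace_inf (hσ : IsRational σ) (h : IsBlowupChart σ Γ S ρ H)
    (h' : IsBlowupChart σ Γ S ρ' H') : IsFace (ρ ⊓ ρ') ρ := by
  obtain ⟨m, hm, hρ, rfl⟩ := h
  obtain ⟨m', hm', hρ', rfl⟩ := h'
  set μ := linearityCone σ S m ⊓ linearityCone σ S m'
  have h1 : IsFace μ (linearityCone σ S m) := isFace_linearityCone_inf hm hm'
  have h2 : IsFace (μ ⊓ ρ') μ := isFace_inf_of_le hρ' inf_le_right
  have h3 := ToricBlowup.isFace_inf hρ (isFace_trans (hσ.linearityCone S m) h2 h1)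
  have h4 : ρ ⊓ (μ ⊓ ρ') = ρ ⊓ ρ' := le_antisymm (inf_le_inf_left _ inf_le_right)
    (le_inf inf_le_left (le_inf (inf_le_inf (le_of_isFace hρ) (le_of_isFace hρ')) inf_le_right))
  rw [h4] at h3
  exact isFace_of_le_of_le h3 inf_le_left (le_of_isFace hρ)

/-- Write `m = s' + γ` and `s' = s + γ'`. On the linearity cone of `m`, minimality against `s`
forces `γ = 0`. So this cone is the face cut out by `γ` in the cone of `s'` for `S'`, and `γ` is
invertible in the localized semigroups. -/
theorem IsBlowupChart.of_sameModulo (hΓ : IsToricPair σ Γ) (hS : SameModulo Γ S S')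
    (h : IsBlowupChart σ Γ S ρ H) : IsBlowupChart σ Γ S' ρ H := by
  obtain ⟨m, hm, hρ, rfl⟩ := h
  obtain ⟨s', hs', γ, hγ, hmγ⟩ := hS.1 m hm
  obtain ⟨s, hs, γ', hγ', hsγ⟩ := hS.2 s' hs'
  have e : ∀ a b : CharLattice N, ∀ ν, realify (a + b) ν = realify a ν + realify b ν := by
    intro a b ν; rw [map_add, LinearMap.add_apply]
  have h0 : ∀ ν ∈ linearityCone σ S m, realify γ ν = 0 := by
    intro ν hν
    have h1 := hν.2 s hs
    rw [hmγ, e, hsγ, e] at h1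
    have h2 := hΓ.nonneg hγ hν.1
    have h3 := hΓ.nonneg hγ' hν.1
    linarith
  have h1 : IsFace (linearityCone σ S m) (linearityCone σ S' s') := by
    refine ⟨realify γ, fun ν hν => hΓ.nonneg hγ hν.1, fun ν => ⟨fun hν => ⟨⟨hν.1, ?_⟩, h0 ν hν⟩, ?_⟩⟩
    · intro m'' hm''
      obtain ⟨t, ht, δ, hδ, rfl⟩ := hS.2 m'' hm''
      have h1 := hν.2 t ht
      rw [hmγ, e, h0 ν hν] at h1
      rw [e]
      linarith [hΓ.nonneg hδ hν.1]
    · rintro ⟨hν, h2⟩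
      refine ⟨hν.1, fun t ht => ?_⟩
      obtain ⟨t', ht', δ, hδ, rfl⟩ := hS.1 t ht
      have h1 := hν.2 t' ht'
      rw [hmγ, e, e, h2]
      linarith [hΓ.nonneg hδ hν.1]
  refine ⟨s', hs', isFace_trans (hΓ.rational.linearityCone S' s') hρ h1, faceSemigroup_eq ?_ ?_⟩
  · refine chartSemigroup_le (le_chartSemigroup.trans le_faceSemigroup) fun t ht => ?_
    obtain ⟨t', ht', δ, hδ, rfl⟩ := hS.1 t ht
    have h2 : t' + δ - m = (t' - s') + δ + -γ := by rw [hmγ]; abel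
    rw [h2]
    exact add_mem (le_faceSemigroup (add_mem (sub_mem_chartSemigroup ht') (le_chartSemigroup hδ)))
      (neg_mem_faceSemigroup (le_chartSemigroup hγ) fun ν hν => h0 ν (le_of_isFace hρ hν))
  · refine chartSemigroup_le (le_chartSemigroup.trans le_faceSemigroup) fun t' ht' => ?_
    obtain ⟨t, ht, δ, hδ, rfl⟩ := hS.2 t' ht'
    have h2 : t + δ - s' = (t - m) + δ + γ := by rw [hmγ]; abel
    rw [h2]
    exact le_faceSemigroup (add_mem (add_mem (sub_mem_chartSemigroup ht) (le_chartSemigroup hδ))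
      (le_chartSemigroup hγ))

/-- The linearity cones of `τ` are the faces that `τ` cuts out of those of `σ`, and localization at
a cone inside `τ` absorbs the localization at `τ`. -/
theorem isBlowupChart_face_iff (hΓ : IsToricPair σ Γ) (hτ : IsFace τ σ) :
    IsBlowupChart τ (faceSemigroup Γ τ) S ρ H ↔ IsBlowupChart σ Γ S ρ H ∧ ρ ≤ τ := by
  have hlin : ∀ m, linearityCone τ S m = linearityCone σ S m ⊓ τ := by
    intro m
    ext ν
    exact ⟨fun h => ⟨⟨le_of_isFace hτ h.1, h.2⟩, h.1⟩, fun h => ⟨h.2, h.1.2⟩⟩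
  have hsemi : ∀ m, ρ ≤ τ → faceSemigroup (chartSemigroup (faceSemigroup Γ τ) S m) ρ =
      faceSemigroup (chartSemigroup Γ S m) ρ := by
    intro m hle
    refine faceSemigroup_eq (chartSemigroup_le ?_ fun t ht =>
      le_faceSemigroup (sub_mem_chartSemigroup ht)) ?_
    · exact (faceSemigroup_antitone hle).trans (faceSemigroup_mono le_chartSemigroup)
    · exact (chartSemigroup_le (le_faceSemigroup.trans le_chartSemigroup) fun t ht =>
        sub_mem_chartSemigroup ht).trans le_faceSemigroup
  constructor
  · intro h
    have hle := h.le
    obtain ⟨m, hm, hρ, rfl⟩ := h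
    refine ⟨⟨m, hm, ?_, hsemi m hle⟩, hle⟩
    rw [hlin] at hρ
    exact isFace_trans (hΓ.rational.linearityCone S m) hρ (isFace_inf_of_le hτ linearityCone_le)
  · rintro ⟨⟨m, hm, hρ, rfl⟩, hle⟩
    refine ⟨m, hm, ?_, (hsemi m hle).symm⟩
    rw [hlin]
    exact isFace_of_le_of_le hρ (le_inf (le_of_isFace hρ) hle) inf_le_left

/-- Every linearity cone is a face of a maximal one, so the vertices give the same fan as all of
`S`. -/
theorem mem_blowupFan (hσ : IsRational σ) (Γ : AddSubmonoid (CharLattice N)) :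
    ρ ∈ blowupFan σ (S : Set (CharLattice N)) ↔ ∃ H, IsBlowupChart σ Γ S ρ H := by
  constructor
  · rintro ⟨m, hm, h⟩
    exact ⟨_, m, hm.1, h, rfl⟩
  · rintro ⟨_, m, hm, h, -⟩
    obtain ⟨m', hm', hle⟩ := exists_vertexExponents_le (σ := σ) hm
    exact ⟨m', hm', isFace_trans (hσ.linearityCone S m') h (isFace_linearityCone_of_le hm hm'.1 hle)⟩

theorem finite_isBlowupChart (hσ : IsRational σ) :
    {ρ | ∃ H, IsBlowupChart σ Γ S ρ H}.Finite := by
  refine (S.finite_toSet.biUnion fun m _ => (hσ.linearityCone S m).finite_faces).subset ?_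
  rintro ρ ⟨_, m, hm, h, -⟩
  exact Set.mem_biUnion hm h

variable [Module.Free ℤ N]

theorem IsBlowupChart.isToricPair (hΓ : IsToricPair σ Γ) (h : IsBlowupChart σ Γ S ρ H) :
    IsToricPair ρ H := by
  obtain ⟨m, _, hρ, rfl⟩ := h
  exact (hΓ.linearityCone S m).face hρ

theorem isBlowupChart_linearityCone (hΓ : IsToricPair σ Γ) {m : CharLattice N} (hm : m ∈ S) :
    IsBlowupChart σ Γ S (linearityCone σ S m) (chartSemigroup Γ S m) :=
  ⟨m, hm, isFace_refl _, (hΓ.linearityCone S m).faceSemigroup_self.symm⟩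

end BlowupCharts

end ToricBlowup

/-! ### Gluing of subdivisions to a toric triple. -/

namespace ToricBlowup

/-- Affine toric data `(σ_i, Γ_i)` with finite sets of exponents `S_i`, such that the cones meet
along common faces, to which the semigroups and the monomial ideals restrict. -/
structure BlowupAtlas (N : Type u) [AddCommGroup N] (ι : Type u) where
  cone : ι → PointedCone ℝ (RealSpace N)
  semigroup : ι → AddSubmonoid (CharLattice N)
  exps : ι → Finset (CharLattice N)
  isToricPair : ∀ i, IsToricPair (cone i) (semigroup i)
  exps_nonempty : ∀ i, (exps i).Nonempty
  exps_mem : ∀ i, ∀ m ∈ exps i, m ∈ semigroup i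
  meet : ι → ι → ι
  meet_comm : ∀ i j, meet i j = meet j i
  cone_meet : ∀ i j, cone (meet i j) = cone i ⊓ cone j
  isFace_meet : ∀ i j, IsFace (cone (meet i j)) (cone i)
  semigroup_meet : ∀ i j, semigroup (meet i j) = faceSemigroup (semigroup i) (cone (meet i j))
  exps_meet : ∀ i j, SameModulo (semigroup (meet i j)) (exps i) (exps (meet i j))

namespace BlowupAtlas

variable {N : Type u} [AddCommGroup N] {ι : Type u} (𝒜 : BlowupAtlas N ι)
  {ρ ρ' : PointedCone ℝ (RealSpace N)} {H H' : AddSubmonoid (CharLattice N)}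

/-- `ρ` is a cone of the subdivision of the cone `σ_i`, with semigroup `H`. -/
def IsChart (i : ι) (ρ : PointedCone ℝ (RealSpace N)) (H : AddSubmonoid (CharLattice N)) : Prop :=
  IsBlowupChart (𝒜.cone i) (𝒜.semigroup i) (𝒜.exps i) ρ H

variable {𝒜}

theorem IsChart.le {i : ι} (h : 𝒜.IsChart i ρ H) : ρ ≤ 𝒜.cone i := IsBlowupChart.le h

theorem IsChart.semigroup_le {i : ι} (h : 𝒜.IsChart i ρ H) : 𝒜.semigroup i ≤ H :=
  IsBlowupChart.semigroup_le h

theorem IsChart.isFace_inf_cone {i : ι} (h : 𝒜.IsChart i ρ H) (j : ι) :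
    IsFace (ρ ⊓ 𝒜.cone j) ρ := by
  have h1 := isFace_inf_of_le (𝒜.isFace_meet i j) h.le
  have h2 : ρ ⊓ 𝒜.cone (𝒜.meet i j) = ρ ⊓ 𝒜.cone j := by
    rw [𝒜.cone_meet, ← inf_assoc, inf_eq_left.2 h.le]
  rwa [h2] at h1

variable [Module.Finite ℤ N]

theorem IsChart.face {i : ι} (h : 𝒜.IsChart i ρ H) (hρ' : IsFace ρ' ρ) :
    𝒜.IsChart i ρ' (faceSemigroup H ρ') :=
  IsBlowupChart.face (𝒜.isToricPair i).rational h hρ'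

theorem isChart_meet_iff {i j : ι} :
    𝒜.IsChart (𝒜.meet i j) ρ H ↔ 𝒜.IsChart i ρ H ∧ ρ ≤ 𝒜.cone j := by
  have h1 : IsBlowupChart (𝒜.cone (𝒜.meet i j)) (𝒜.semigroup (𝒜.meet i j)) (𝒜.exps i) ρ H ↔
      𝒜.IsChart i ρ H ∧ ρ ≤ 𝒜.cone (𝒜.meet i j) := by
    rw [𝒜.semigroup_meet]
    exact isBlowupChart_face_iff (𝒜.isToricPair i) (𝒜.isFace_meet i j)
  have h2 : 𝒜.IsChart (𝒜.meet i j) ρ H ↔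
      IsBlowupChart (𝒜.cone (𝒜.meet i j)) (𝒜.semigroup (𝒜.meet i j)) (𝒜.exps i) ρ H :=
    ⟨fun h => h.of_sameModulo (𝒜.isToricPair _) (𝒜.exps_meet i j).symm,
      fun h => h.of_sameModulo (𝒜.isToricPair _) (𝒜.exps_meet i j)⟩
  rw [h2, h1, 𝒜.cone_meet, le_inf_iff]
  exact ⟨fun h => ⟨h.1, h.2.2⟩, fun h => ⟨h.1, h.1.le, h.2⟩⟩

/-- Restriction to `σ_i ∩ σ_j` is symmetric in `i` and `j`, so the subdivisions of `σ_i` and `σ_j`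
coincide on the common face. The gluing of the fan and of its semigroups rests on this. -/
theorem IsChart.of_le {i j : ι} (h : 𝒜.IsChart i ρ H) (hle : ρ ≤ 𝒜.cone j) : 𝒜.IsChart j ρ H := by
  have h1 := isChart_meet_iff.2 ⟨h, hle⟩
  rw [𝒜.meet_comm] at h1
  exact (isChart_meet_iff.1 h1).1

theorem IsChart.unique {i j : ι} (h : 𝒜.IsChart i ρ H) (h' : 𝒜.IsChart j ρ H') : H = H' :=
  IsBlowupChart.unique (h.of_le h'.le) h'

variable [Module.Free ℤ N]

theorem IsChart.isToricPair {i : ι} (h : 𝒜.IsChart i ρ H) : IsToricPair ρ H :=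
  IsBlowupChart.isToricPair (𝒜.isToricPair i) h

/-- The face `ρ ⊓ σ_j` of `ρ` belongs to the subdivision of `σ_j`, which reduces the claim to a
single subdivided cone. -/
theorem IsChart.isFace_inf {i j : ι} (h : 𝒜.IsChart i ρ H) (h' : 𝒜.IsChart j ρ' H') :
    IsFace (ρ ⊓ ρ') ρ := by
  have h1 := (h.face (h.isFace_inf_cone j)).of_le inf_le_right
  have h2 := IsBlowupChart.isFace_inf (𝒜.isToricPair j).rational h1 h'
  rw [inf_assoc, inf_eq_right.2 h'.le] at h2
  exact isFace_trans h.isToricPair.rational h2 (h.isFace_inf_cone j)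

variable (𝒜) [Finite ι] [Nonempty ι]

/-- The toric triple obtained by gluing the subdivisions of the cones `σ_i`. -/
noncomputable def triple : ToricTriple N where
  cones := {ρ | ∃ i H, 𝒜.IsChart i ρ H}
  isFan :=
    { finite := by
        have : {ρ | ∃ i H, 𝒜.IsChart i ρ H} = ⋃ i, {ρ | ∃ H, 𝒜.IsChart i ρ H} := by
          ext; simp
        rw [this]
        exact Set.finite_iUnion fun i => finite_isBlowupChart (𝒜.isToricPair i).rational
      nonempty := by
        obtain ⟨i⟩ := ‹Nonempty ι›
        obtain ⟨m, hm⟩ := 𝒜.exps_nonempty i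
        exact ⟨_, i, _, isBlowupChart_linearityCone (𝒜.isToricPair i) hm⟩
      rational := by
        rintro ρ ⟨i, H, h⟩
        exact h.isToricPair.rational
      strictlyConvex := by
        rintro ρ ⟨i, H, h⟩
        exact h.isToricPair.strictlyConvex
      face_mem := by
        rintro ρ ⟨i, H, h⟩ τ hτ
        exact ⟨i, _, h.face hτ⟩
      inf_face := by
        rintro ρ ⟨i, H, h⟩ ρ' ⟨i', H', h'⟩
        refine ⟨h.isFace_inf h', ?_⟩
        rw [inf_comm]
        exact h'.isFace_inf h }
  -- The semigroup is read off from an arbitrary chart that contains `ρ`; `IsChart.unique` makes the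
  -- choice immaterial.
  semigroup ρ := ρ.2.choose_spec.choose
  fg ρ := ρ.2.choose_spec.choose_spec.isToricPair.fg
  closure_eq_top ρ := ρ.2.choose_spec.choose_spec.isToricPair.closure_eq_top
  realCone_eq ρ := ρ.2.choose_spec.choose_spec.isToricPair.realCone_eq
  compatible ρ τ h := τ.2.choose_spec.choose_spec.unique (ρ.2.choose_spec.choose_spec.face h)

theorem exists_isChart_triple (ρ : 𝒜.triple.cones) :
    ∃ i, 𝒜.IsChart i ρ.1 (𝒜.triple.semigroup ρ) :=
  ⟨_, ρ.2.choose_spec.choose_spec⟩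

theorem isChart_of_le (ρ : 𝒜.triple.cones) {i : ι} (h : ρ.1 ≤ 𝒜.cone i) :
    𝒜.IsChart i ρ.1 (𝒜.triple.semigroup ρ) := by
  obtain ⟨j, hj⟩ := 𝒜.exists_isChart_triple ρ
  exact hj.of_le h

theorem triple_semigroup_eq {i : ι} {ρ : 𝒜.triple.cones} (h : 𝒜.IsChart i ρ.1 H) :
    𝒜.triple.semigroup ρ = H :=
  (𝒜.isChart_of_le ρ h.le).unique h

/-- The cones of the triple in `σ_i` form the fan `Σ(S)` for every set `S` of exponents that defines
the same ideal as `S_i`. -/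
theorem triple_cones_le (i : ι) {S : Finset (CharLattice N)}
    (hS : SameModulo (𝒜.semigroup i) (𝒜.exps i) S) :
    {ρ | ρ ∈ 𝒜.triple.cones ∧ ρ ≤ 𝒜.cone i} = blowupFan (𝒜.cone i) S := by
  ext ρ
  rw [mem_blowupFan (𝒜.isToricPair i).rational (𝒜.semigroup i)]
  constructor
  · rintro ⟨⟨j, H, h⟩, hle⟩
    exact ⟨H, IsBlowupChart.of_sameModulo (𝒜.isToricPair i) hS (h.of_le hle)⟩
  · rintro ⟨H, h⟩
    have h1 : 𝒜.IsChart i ρ H := h.of_sameModulo (𝒜.isToricPair i) hS.symm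
    exact ⟨⟨i, H, h1⟩, h1.le⟩

theorem triple_hasBlowupSemigroups (i : ι) {S : Finset (CharLattice N)}
    (hS : SameModulo (𝒜.semigroup i) (𝒜.exps i) S) :
    𝒜.triple.HasBlowupSemigroups (𝒜.cone i) (𝒜.semigroup i) S := by
  intro m hm τ
  have key : ∀ H, IsBlowupChart (𝒜.cone i) (𝒜.semigroup i) S τ.1 H →
      𝒜.triple.semigroup τ = H := fun H h =>
    𝒜.triple_semigroup_eq (i := i) (h.of_sameModulo (𝒜.isToricPair i) hS.symm)
  refine ⟨fun h => key _ ?_, fun h => key _ ⟨m, hm.1, h, rfl⟩⟩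
  rw [h]
  exact isBlowupChart_linearityCone (𝒜.isToricPair i) hm.1

end BlowupAtlas

end ToricBlowup

namespace ToricBlowup

/-! ### Ideal sheaves on affine charts. -/

section IdealSheaves

theorem comap_inv_eq_map_hom {R S : CommRingCat.{u}} (e : R ≅ S) (I : Ideal R) :
    I.comap e.inv.hom = I.map e.hom.hom := by
  apply le_antisymm
  · intro x hx
    have := Ideal.mem_map_of_mem e.hom.hom (Ideal.mem_comap.1 hx)
    rwa [Iso.inv_hom_id_apply] at this
  · rw [Ideal.map_le_iff_le_comap]
    intro x hx
    rw [Ideal.mem_comap, Ideal.mem_comap, Iso.hom_inv_id_apply]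
    exact hx

theorem map_inv_comap_inv {R S : CommRingCat.{u}} (e : R ≅ S) (I : Ideal R) :
    (I.comap e.inv.hom).map e.inv.hom = I := by
  rw [comap_inv_eq_map_hom, Ideal.map_map, ← CommRingCat.hom_comp, e.hom_inv_id, CommRingCat.hom_id,
    Ideal.map_id]

theorem comap_inv_map_inv {R S : CommRingCat.{u}} (e : R ≅ S) (J : Ideal S) :
    (J.map e.inv.hom).comap e.inv.hom = J := by
  rw [comap_inv_eq_map_hom, Ideal.map_map, ← CommRingCat.hom_comp, e.inv_hom_id, CommRingCat.hom_id,
    Ideal.map_id]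

theorem hom_mem_nonZeroDivisors {R S : CommRingCat.{u}} (e : R ≅ S) {a : R}
    (h : a ∈ nonZeroDivisors R) : e.hom.hom a ∈ nonZeroDivisors S := by
  refine comap_nonZeroDivisors_le_of_injective (f := e.inv.hom)
    (e.symm.commRingCatIsoToRingEquiv.injective) ?_
  rw [Submonoid.mem_comap, Iso.hom_inv_id_apply]
  exact h

/-- The ideal of `R` that corresponds to an ideal sheaf on `Spec R`. -/
noncomputable def specIdeal {R : CommRingCat.{u}} (I : (Spec R).IdealSheafData) : Ideal R :=
  (I.ideal ⟨⊤, isAffineOpen_top _⟩).comap (Scheme.ΓSpecIso R).inv.hom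

theorem specIdealSheaf_ideal_top {R : CommRingCat.{u}} (J : Ideal R) :
    (specIdealSheaf J).ideal ⟨⊤, isAffineOpen_top _⟩ = J.map (Scheme.ΓSpecIso R).inv.hom := by
  rw [specIdealSheaf, Scheme.IdealSheafData.ofIdealTop_ideal]
  have : (homOfLE (le_top : (⊤ : (Spec R).Opens) ≤ ⊤)).op = 𝟙 _ := rfl
  rw [this, CategoryTheory.Functor.map_id, CommRingCat.hom_id, Ideal.map_id]

theorem specIdeal_specIdealSheaf {R : CommRingCat.{u}} (J : Ideal R) :
    specIdeal (specIdealSheaf J) = J := by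
  rw [specIdeal, specIdealSheaf_ideal_top, comap_inv_map_inv]

theorem specIdealSheaf_specIdeal {R : CommRingCat.{u}} (I : (Spec R).IdealSheafData) :
    specIdealSheaf (specIdeal I) = I := by
  apply Scheme.IdealSheafData.ext_of_isAffine
  rw [specIdealSheaf_ideal_top, specIdeal, map_inv_comap_inv]

theorem specIdeal_le_iff {R : CommRingCat.{u}} {I J : (Spec R).IdealSheafData} :
    specIdeal I ≤ specIdeal J ↔ I ≤ J := by
  constructor
  · intro h
    apply Scheme.IdealSheafData.le_of_isAffine
    have := Ideal.map_mono (f := (Scheme.ΓSpecIso R).inv.hom) h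
    rwa [specIdeal, specIdeal, map_inv_comap_inv, map_inv_comap_inv] at this
  · intro h
    exact Ideal.comap_mono (h _)

theorem specIdealSheaf_le_iff {R : CommRingCat.{u}} {J : Ideal R} {I : (Spec R).IdealSheafData} :
    specIdealSheaf J ≤ I ↔ J ≤ specIdeal I := by
  rw [← specIdeal_le_iff, specIdeal_specIdealSheaf]

theorem specIdeal_map {R S : CommRingCat.{u}} (φ : R ⟶ S) (I : (Spec S).IdealSheafData) :
    specIdeal (I.map (Spec.map φ)) = (specIdeal I).comap φ.hom := by
  have h : (I.map (Spec.map φ)).ideal ⟨⊤, isAffineOpen_top _⟩ =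
      (I.ideal ⟨⊤, isAffineOpen_top _⟩).comap (Spec.map φ).appTop.hom :=
    Scheme.IdealSheafData.ideal_map_of_isAffineHom I (Spec.map φ) ⟨⊤, isAffineOpen_top _⟩
  rw [specIdeal, h, specIdeal, Ideal.comap_comap, Ideal.comap_comap, ← CommRingCat.hom_comp,
    ← CommRingCat.hom_comp, Scheme.ΓSpecIso_inv_naturality]

/-- Inverse image is left adjoint to direct image, and direct image between affine schemes is the
preimage of ideals, whose left adjoint is extension. -/
theorem specIdealSheaf_comap {R S : CommRingCat.{u}} (φ : R ⟶ S) (J : Ideal R) :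
    (specIdealSheaf J).comap (Spec.map φ) = specIdealSheaf (J.map φ.hom) := by
  refine eq_of_forall_ge_iff fun K => ?_
  rw [← Scheme.IdealSheafData.le_map_iff_comap_le, specIdealSheaf_le_iff, specIdealSheaf_le_iff,
    specIdeal_map, Ideal.map_le_iff_le_comap]

theorem specIdeal_comap {R S : CommRingCat.{u}} (φ : R ⟶ S) (I : (Spec R).IdealSheafData) :
    specIdeal (I.comap (Spec.map φ)) = (specIdeal I).map φ.hom := by
  rw [← specIdealSheaf_specIdeal I, specIdealSheaf_comap, specIdeal_specIdealSheaf,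
    specIdeal_specIdealSheaf]

theorem specIdealSheaf_injective {R : CommRingCat.{u}} :
    Function.Injective (specIdealSheaf : Ideal R → (Spec R).IdealSheafData) :=
  Function.LeftInverse.injective specIdeal_specIdealSheaf

theorem specIdeal_bot {R : CommRingCat.{u}} : specIdeal (⊥ : (Spec R).IdealSheafData) = ⊥ := by
  rw [eq_bot_iff, ← specIdeal_specIdealSheaf (⊥ : Ideal R), specIdeal_le_iff]
  exact bot_le

/-- The affine open subset that is the range of an affine chart. -/
noncomputable def affineRange {Z : Scheme.{u}} {R : CommRingCat.{u}} (e : Spec R ⟶ Z) [IsOpenImmersion e] :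
    Z.affineOpens :=
  ⟨e ''ᵁ ⊤, (isAffineOpen_top _).image_of_isOpenImmersion e⟩

/-- The ring of sections on the range of an affine chart. -/
noncomputable def chartIso {Z : Scheme.{u}} {R : CommRingCat.{u}} (e : Spec R ⟶ Z)
    [IsOpenImmersion e] : Γ(Z, (affineRange e).1) ≅ R :=
  e.appIso ⊤ ≪≫ Scheme.ΓSpecIso R

theorem specIdeal_comap_chart {Z : Scheme.{u}} {R : CommRingCat.{u}} (e : Spec R ⟶ Z)
    [IsOpenImmersion e] (J : Z.IdealSheafData) :
    specIdeal (J.comap e) = (J.ideal (affineRange e)).map (chartIso e).hom.hom := by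
  rw [← comap_inv_eq_map_hom, specIdeal, Scheme.IdealSheafData.ideal_comap_of_isOpenImmersion]
  rfl

theorem ideal_affineRange {Z : Scheme.{u}} {R : CommRingCat.{u}} (e : Spec R ⟶ Z)
    [IsOpenImmersion e] (J : Z.IdealSheafData) :
    J.ideal (affineRange e) = (specIdeal (J.comap e)).map (chartIso e).inv.hom := by
  rw [specIdeal_comap_chart, ← comap_inv_eq_map_hom, map_inv_comap_inv]

/-- An ideal sheaf is determined by its inverse images on an open cover by affine schemes. -/
theorem idealSheaf_ext {X : Scheme.{u}} {I I' : X.IdealSheafData} {ι : Type*} {R : ι → CommRingCat.{u}}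
    (j : ∀ i, Spec (R i) ⟶ X) [∀ i, IsOpenImmersion (j i)] (hj : ∀ x, ∃ i y, j i y = x)
    (h : ∀ i, I.comap (j i) = I'.comap (j i)) : I = I' := by
  refine Scheme.IdealSheafData.ext_of_iSup_eq_top
    (fun i => affineRange (j i)) ?_ fun i => ?_
  · rw [eq_top_iff]
    intro x _
    obtain ⟨i, y, rfl⟩ := hj x
    exact TopologicalSpace.Opens.mem_iSup.2 ⟨i, y, trivial, rfl⟩
  · rw [ideal_affineRange, ideal_affineRange, h]

/-- Charts `Spec R ⟶ Z` in place of affine open subsets turn invertibility into a statement about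
ideals of rings that is easy to pull back. -/
theorem isInvertibleIdeal_iff {Z : Scheme.{u}} {J : Z.IdealSheafData} :
    IsInvertibleIdeal J ↔ ∀ z : Z, ∃ (R : CommRingCat.{u}) (e : Spec R ⟶ Z) (_ : IsOpenImmersion e)
      (f : R), (∃ y, e y = z) ∧ f ∈ nonZeroDivisors R ∧
        J.comap e = specIdealSheaf (Ideal.span {f}) := by
  refine forall_congr' fun z => ⟨?_, ?_⟩
  · rintro ⟨U, hz, hU⟩
    let e := U.2.fromSpec
    have : IsOpenImmersion e := U.2.isOpenImmersion_fromSpec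
    have hV : affineRange e = U := by
      refine Subtype.ext (TopologicalSpace.Opens.ext ?_)
      have : Set.range e = (U.1 : Set Z) := U.2.range_fromSpec
      rw [← this]
      exact Set.image_univ
    rw [← hV] at hU
    obtain ⟨f, hf, hJ⟩ := hU
    refine ⟨_, e, this, (chartIso e).hom.hom f, ?_, ?_, ?_⟩
    · have : z ∈ Set.range e := by rw [U.2.range_fromSpec]; exact hz
      exact this
    · exact hom_mem_nonZeroDivisors _ hf
    · rw [← specIdealSheaf_specIdeal (J.comap e), specIdeal_comap_chart, hJ, Ideal.map_span,
        Set.image_singleton]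
  · rintro ⟨R, e, _, f, ⟨y, rfl⟩, hf, hJ⟩
    refine ⟨affineRange e, ⟨y, trivial, rfl⟩, (chartIso e).inv.hom f,
      hom_mem_nonZeroDivisors (chartIso e).symm hf, ?_⟩
    rw [ideal_affineRange, hJ, specIdeal_specIdealSheaf, Ideal.map_span, Set.image_singleton]

end IdealSheaves

/-! ### Shrinking charts and local generators. -/

section Localization

/-- A neighbourhood of a point of an affine chart contains a basic open subset of the chart. -/
theorem exists_away {Z : Scheme.{u}} {R : CommRingCat.{u}} (e : Spec R ⟶ Z) (y : Spec R)
    (V : Z.Opens) (hV : e y ∈ V) : ∃ h : R, h ∉ (y : PrimeSpectrum R).asIdeal ∧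
      ∀ y' : Spec R, h ∉ (y' : PrimeSpectrum R).asIdeal → e y' ∈ V := by
  obtain ⟨_, ⟨_, ⟨h, rfl⟩, rfl⟩, h1, h2⟩ := PrimeSpectrum.isBasis_basic_opens.exists_subset_of_mem_open
    (show y ∈ ((e ⁻¹ᵁ V : (Spec R).Opens) : Set (Spec R)) from hV) (e ⁻¹ᵁ V).2
  exact ⟨h, h1, fun y' hy' => h2 hy'⟩

/-- The open subscheme `h ≠ 0` of `Spec R`. -/
noncomputable abbrev awayMap {R : CommRingCat.{u}} (h : R) : R ⟶ CommRingCat.of (Localization.Away h) :=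
  CommRingCat.ofHom (algebraMap R (Localization.Away h))

instance {R : CommRingCat.{u}} (h : R) : IsOpenImmersion (Spec.map (awayMap h)) :=
  IsOpenImmersion.of_isLocalization h

theorem mem_range_awayMap {R : CommRingCat.{u}} (h : R) (y : Spec R) :
    (∃ y', Spec.map (awayMap h) y' = y) ↔ h ∉ (y : PrimeSpectrum R).asIdeal :=
  Set.ext_iff.1 (PrimeSpectrum.localization_away_comap_range (Localization.Away h) h) y

theorem awayMap_mem_nonZeroDivisors {R : CommRingCat.{u}} (h : R) {a : R}
    (ha : a ∈ nonZeroDivisors R) :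
    (awayMap h).hom a ∈ nonZeroDivisors (CommRingCat.of (Localization.Away h)) :=
  IsLocalization.map_nonZeroDivisors_le (Submonoid.powers h) (Localization.Away h) ⟨a, ha, rfl⟩

theorem IsInvertibleIdeal.exists_chart {Z : Scheme.{u}} {J : Z.IdealSheafData}
    (hJ : IsInvertibleIdeal J) (z : Z) (V : Z.Opens) (hz : z ∈ V) :
    ∃ (R : CommRingCat.{u}) (e : Spec R ⟶ Z) (_ : IsOpenImmersion e) (f : R),
      (∃ y, e y = z) ∧ (∀ y, e y ∈ V) ∧ f ∈ nonZeroDivisors R ∧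
        J.comap e = specIdealSheaf (Ideal.span {f}) := by
  obtain ⟨R, e, _, f, ⟨y, rfl⟩, hf, hJe⟩ := isInvertibleIdeal_iff.1 hJ z
  obtain ⟨h, hy, hV⟩ := exists_away e y V hz
  obtain ⟨y', hy'⟩ := (mem_range_awayMap h y).2 hy
  refine ⟨_, Spec.map (awayMap h) ≫ e, inferInstance, (awayMap h).hom f, ⟨y', ?_⟩, fun y => ?_,
    awayMap_mem_nonZeroDivisors h hf, ?_⟩
  · rw [Scheme.Hom.comp_apply, hy']
  · rw [Scheme.Hom.comp_apply]
    exact hV _ ((mem_range_awayMap h _).1 ⟨y, rfl⟩)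
  · rw [Scheme.IdealSheafData.comap_comp, hJe, specIdealSheaf_comap, Ideal.map_span,
      Set.image_singleton]

theorem IsInvertibleIdeal.comap {Z Z' : Scheme.{u}} {J : Z.IdealSheafData}
    (hJ : IsInvertibleIdeal J) (e : Z' ⟶ Z) [IsOpenImmersion e] :
    IsInvertibleIdeal (J.comap e) := by
  refine isInvertibleIdeal_iff.2 fun z => ?_
  obtain ⟨R, e', _, f, ⟨y, hy⟩, hV, hf, hJ'⟩ := hJ.exists_chart (e z) e.opensRange ⟨z, rfl⟩
  have hr : Set.range e' ⊆ Set.range e := by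
    rintro _ ⟨y, rfl⟩
    exact hV y
  have hl : IsOpenImmersion.lift e e' hr ≫ e = e' := IsOpenImmersion.lift_fac e e' hr
  have : IsOpenImmersion (IsOpenImmersion.lift e e' hr ≫ e) := by rw [hl]; infer_instance
  refine ⟨R, IsOpenImmersion.lift e e' hr, IsOpenImmersion.of_comp _ e, f, ⟨y, ?_⟩, hf, ?_⟩
  · apply e.isOpenEmbedding.injective
    rw [← Scheme.Hom.comp_apply, hl, hy]
  · rw [← Scheme.IdealSheafData.comap_comp, hl, hJ']

/-- If finitely many elements generate an invertible principal ideal, then locally one of them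
generates it. -/
theorem exists_local_generator {R : CommRingCat.{u}} {κ : Type*} [Finite κ] (a : κ → R) {f : R}
    (hf : f ∈ nonZeroDivisors R) (ha : Ideal.span (Set.range a) = Ideal.span {f}) (y : Spec R) :
    ∃ (s : κ) (h : R), h ∉ (y : PrimeSpectrum R).asIdeal ∧
      (awayMap h).hom (a s) ∈ nonZeroDivisors (CommRingCat.of (Localization.Away h)) ∧
        ∀ s', (awayMap h).hom (a s) ∣ (awayMap h).hom (a s') := by
  have hdvd : ∀ s, f ∣ a s := fun s => by
    rw [← Ideal.mem_span_singleton, ← ha]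
    exact Ideal.subset_span ⟨s, rfl⟩
  choose c hc using hdvd
  -- With `a s = f * c s`, cancelling the nonzerodivisor `f` shows that the `c s` generate the unit
  -- ideal. Some `c s` is then nonzero at `y`, and inverting it makes `a s` a unit multiple of `f`.
  have htop : Ideal.span (Set.range c) = ⊤ := by
    have h1 : f ∈ Ideal.span (Set.range a) := by
      rw [ha]; exact Ideal.mem_span_singleton_self f
    have h2 : Set.range a = (fun x => f * x) '' Set.range c := by
      rw [← Set.range_comp]
      congr 1
      funext s
      exact hc s
    have h3 : Ideal.span (Set.range a) = Ideal.span {f} * Ideal.span (Set.range c) := by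
      rw [Ideal.span_mul_span', Set.singleton_mul, h2]
    rw [h3, Ideal.mem_span_singleton_mul] at h1
    obtain ⟨z, hz, hfz⟩ := h1
    have h4 : z = 1 := by
      have : (z - 1) * f = 0 := by rw [sub_mul, mul_comm z f, hfz, one_mul, sub_self]
      exact sub_eq_zero.1 ((mem_nonZeroDivisors_iff_right.1 hf) _ this)
    rw [Ideal.eq_top_iff_one, ← h4]
    exact hz
  obtain ⟨s, hs⟩ : ∃ s, c s ∉ (y : PrimeSpectrum R).asIdeal := by
    by_contra! hall
    refine (y : PrimeSpectrum R).isPrime.ne_top (top_le_iff.1 ?_)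
    rw [← htop, Ideal.span_le]
    rintro _ ⟨s, rfl⟩
    exact hall s
  have hu : IsUnit ((awayMap (c s)).hom (c s)) :=
    IsLocalization.Away.algebraMap_isUnit (S := Localization.Away (c s)) (c s)
  refine ⟨s, c s, hs, ?_, fun s' => ?_⟩
  · rw [hc s, map_mul]
    exact mul_mem (awayMap_mem_nonZeroDivisors _ hf) hu.mem_nonZeroDivisors
  · rw [hc s, hc s', map_mul, map_mul]
    exact mul_dvd_mul_left _ hu.dvd

end Localization

end ToricBlowup

/-! ### The universal property of blowing up from affine charts. -/

namespace ToricBlowup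

/-- Affine charts of a morphism `π : B ⟶ X` that exhibit it as the blowing up of `I`: over the chart
`Spec R_i` of `X`, on which `I` is generated by the elements `a_s`, the charts `Spec R'_s` of `B`
have the universal property of the rings `R_i[a_t / a_s]`. -/
structure AffineBlowupCharts {B X : Scheme.{u}} (π : B ⟶ X) (I : X.IdealSheafData) where
  ι : Type u
  κ : ι → Type u
  finite : ∀ i, Finite (κ i)
  R : ι → CommRingCat.{u}
  j : ∀ i, Spec (R i) ⟶ X
  isOpenImmersion_j : ∀ i, IsOpenImmersion (j i)
  j_cover : ∀ x, ∃ i y, j i y = x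
  a : ∀ i, κ i → R i
  comap_j : ∀ i, I.comap (j i) = specIdealSheaf (Ideal.span (Set.range (a i)))
  R' : ∀ i, κ i → CommRingCat.{u}
  ρ : ∀ i s, R i ⟶ R' i s
  c : ∀ i s, Spec (R' i s) ⟶ B
  isOpenImmersion_c : ∀ i s, IsOpenImmersion (c i s)
  c_comp : ∀ i s, c i s ≫ π = Spec.map (ρ i s) ≫ j i
  c_cover : ∀ i (b : B), (∃ y, j i y = π b) → ∃ s y, c i s y = b
  mem_nonZeroDivisors : ∀ i s, (ρ i s).hom (a i s) ∈ nonZeroDivisors (R' i s)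
  dvd : ∀ i s s', (ρ i s).hom (a i s) ∣ (ρ i s).hom (a i s')
  exists_lift : ∀ i s {T : CommRingCat.{u}} (φ : R i ⟶ T), φ.hom (a i s) ∈ nonZeroDivisors T →
    (∀ s', φ.hom (a i s) ∣ φ.hom (a i s')) → ∃ ψ : R' i s ⟶ T, ρ i s ≫ ψ = φ
  glue : ∀ i s s' {T : CommRingCat.{u}} (φ : R i ⟶ T) (ψ : R' i s ⟶ T) (ψ' : R' i s' ⟶ T),
    ρ i s ≫ ψ = φ → ρ i s' ≫ ψ' = φ →
    φ.hom (a i s) ∈ nonZeroDivisors T → φ.hom (a i s') ∈ nonZeroDivisors T →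
    φ.hom (a i s) ∣ φ.hom (a i s') → φ.hom (a i s') ∣ φ.hom (a i s) →
      Spec.map ψ ≫ c i s = Spec.map ψ' ≫ c i s'

namespace AffineBlowupCharts

attribute [instance] finite isOpenImmersion_j isOpenImmersion_c

variable {B X : Scheme.{u}} {π : B ⟶ X} {I : X.IdealSheafData}

theorem isInvertibleIdeal_comap (C : AffineBlowupCharts π I) : IsInvertibleIdeal (I.comap π) := by
  refine isInvertibleIdeal_iff.2 fun b => ?_
  obtain ⟨i, x, hx⟩ := C.j_cover (π b)
  obtain ⟨s, y, rfl⟩ := C.c_cover i b ⟨x, hx⟩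
  refine ⟨_, C.c i s, inferInstance, (C.ρ i s).hom (C.a i s), ⟨y, rfl⟩, C.mem_nonZeroDivisors i s, ?_⟩
  rw [← Scheme.IdealSheafData.comap_comp, C.c_comp, Scheme.IdealSheafData.comap_comp, C.comap_j,
    specIdealSheaf_comap, Ideal.map_span]
  congr 1
  refine le_antisymm (Ideal.span_le.2 ?_) (Ideal.span_mono ?_)
  · rintro _ ⟨_, ⟨s', rfl⟩, rfl⟩
    exact Ideal.mem_span_singleton.2 (C.dvd i s s')
  · rintro _ rfl
    exact ⟨_, ⟨s, rfl⟩, rfl⟩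

/-- Locally on `Z`, a morphism `f : Z ⟶ X` for which the inverse image of `I` is invertible maps to a
chart of `X`, and one of the generators of `I` on this chart generates the inverse image. -/
theorem exists_generator (C : AffineBlowupCharts π I) {Z : Scheme.{u}} (f : Z ⟶ X)
    (hf : IsInvertibleIdeal (I.comap f)) (z : Z) (i : C.ι) (V : Z.Opens) (hz : z ∈ V) (hV : ∀ z' ∈ V, ∃ y, C.j i y = f z') :
    ∃ (T : CommRingCat.{u}) (e : Spec T ⟶ Z) (_ : IsOpenImmersion e) (φ : C.R i ⟶ T) (s : C.κ i),
      (∃ y, e y = z) ∧ (∀ y, e y ∈ V) ∧ e ≫ f = Spec.map φ ≫ C.j i ∧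
        φ.hom (C.a i s) ∈ nonZeroDivisors T ∧ ∀ s', φ.hom (C.a i s) ∣ φ.hom (C.a i s') := by
  obtain ⟨T, e, _, t, ⟨y, rfl⟩, heV, ht, he⟩ := hf.exists_chart z V hz
  have hr : Set.range (e ≫ f) ⊆ Set.range (C.j i) := by
    rintro _ ⟨y, rfl⟩
    obtain ⟨x, hx⟩ := hV _ (heV y)
    exact ⟨x, by rw [hx, Scheme.Hom.comp_apply]⟩
  obtain ⟨φ, hφ⟩ : ∃ φ, Spec.map φ = IsOpenImmersion.lift (C.j i) (e ≫ f) hr :=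
    ⟨_, Spec.map_preimage _⟩
  have hef : e ≫ f = Spec.map φ ≫ C.j i := by rw [hφ, IsOpenImmersion.lift_fac]
  have hspan : Ideal.span (Set.range fun s => φ.hom (C.a i s)) = Ideal.span {t} := by
    apply specIdealSheaf_injective
    rw [← he, ← Scheme.IdealSheafData.comap_comp, hef, Scheme.IdealSheafData.comap_comp, C.comap_j,
      specIdealSheaf_comap, Ideal.map_span, ← Set.range_comp]
    rfl
  obtain ⟨s, h, hy, h1, h2⟩ := exists_local_generator _ ht hspan y
  obtain ⟨y', rfl⟩ := (mem_range_awayMap h y).2 hy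
  refine ⟨_, Spec.map (awayMap h) ≫ e, inferInstance, φ ≫ awayMap h, s, ⟨y', ?_⟩, fun y => ?_, ?_,
    h1, h2⟩
  · rw [Scheme.Hom.comp_apply]
  · rw [Scheme.Hom.comp_apply]; exact heV _
  · rw [Category.assoc, hef, Spec.map_comp, Category.assoc]

/-- Locally the two morphisms land in charts of `B` over one chart of `X`, with indices `s₁` and
`s₂`. Each of the two generators divides all the others there, so they divide each other and divide
a nonzerodivisor; `glue` then applies. -/
theorem hom_ext (C : AffineBlowupCharts π I) {Z : Scheme.{u}} (g g' : Z ⟶ B) (h : g ≫ π = g' ≫ π)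
    (hf : IsInvertibleIdeal (I.comap (g ≫ π))) : g = g' := by
  have key : ∀ z : Z, ∃ (T : CommRingCat.{u}) (e : Spec T ⟶ Z) (_ : IsOpenImmersion e),
      (∃ y, e y = z) ∧ e ≫ g = e ≫ g' := by
    intro z
    obtain ⟨i, x, hx⟩ := C.j_cover (π (g z))
    have hgg : ∀ z, π (g' z) = π (g z) := fun z => by
      rw [← Scheme.Hom.comp_apply, ← h, Scheme.Hom.comp_apply]
    obtain ⟨s₁, y₁, h₁⟩ := C.c_cover i (g z) ⟨x, hx⟩
    obtain ⟨s₂, y₂, h₂⟩ := C.c_cover i (g' z) ⟨x, by rw [hx, hgg]⟩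
    obtain ⟨T, e, he, φ, s, hez, hV, hφ, hnz, hdvd⟩ := C.exists_generator (g ≫ π) hf z i
      (g ⁻¹ᵁ (C.c i s₁).opensRange ⊓ g' ⁻¹ᵁ (C.c i s₂).opensRange) ⟨⟨y₁, h₁⟩, ⟨y₂, h₂⟩⟩ (by
        rintro z' ⟨⟨y, hy⟩, -⟩
        refine ⟨Spec.map (C.ρ i s₁) y, ?_⟩
        rw [Scheme.Hom.comp_apply, ← hy, ← Scheme.Hom.comp_apply, ← Scheme.Hom.comp_apply, C.c_comp])
    have hr₁ : Set.range (e ≫ g) ⊆ Set.range (C.c i s₁) := by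
      rintro _ ⟨y, rfl⟩
      rw [Scheme.Hom.comp_apply]
      exact (hV y).1
    have hr₂ : Set.range (e ≫ g') ⊆ Set.range (C.c i s₂) := by
      rintro _ ⟨y, rfl⟩
      rw [Scheme.Hom.comp_apply]
      exact (hV y).2
    obtain ⟨ψ₁, hψ₁⟩ : ∃ ψ, Spec.map ψ = IsOpenImmersion.lift (C.c i s₁) (e ≫ g) hr₁ :=
      ⟨_, Spec.map_preimage _⟩
    obtain ⟨ψ₂, hψ₂⟩ : ∃ ψ, Spec.map ψ = IsOpenImmersion.lift (C.c i s₂) (e ≫ g') hr₂ :=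
      ⟨_, Spec.map_preimage _⟩
    have e₁ : e ≫ g = Spec.map ψ₁ ≫ C.c i s₁ := by rw [hψ₁, IsOpenImmersion.lift_fac]
    have e₂ : e ≫ g' = Spec.map ψ₂ ≫ C.c i s₂ := by rw [hψ₂, IsOpenImmersion.lift_fac]
    have f₁ : C.ρ i s₁ ≫ ψ₁ = φ := by
      apply Spec.map_injective
      rw [← cancel_mono (C.j i), ← hφ, Spec.map_comp, Category.assoc, ← C.c_comp, ← Category.assoc,
        ← e₁, Category.assoc]
    have f₂ : C.ρ i s₂ ≫ ψ₂ = φ := by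
      apply Spec.map_injective
      rw [← cancel_mono (C.j i), ← hφ, Spec.map_comp, Category.assoc, ← C.c_comp, ← Category.assoc,
        ← e₂, Category.assoc, h]
    have d₁ : ∀ s', φ.hom (C.a i s₁) ∣ φ.hom (C.a i s') := fun s' => by
      rw [← f₁]
      simp only [CommRingCat.hom_comp, RingHom.comp_apply]
      exact map_dvd ψ₁.hom (C.dvd i s₁ s')
    have d₂ : ∀ s', φ.hom (C.a i s₂) ∣ φ.hom (C.a i s') := fun s' => by
      rw [← f₂]
      simp only [CommRingCat.hom_comp, RingHom.comp_apply]
      exact map_dvd ψ₂.hom (C.dvd i s₂ s')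
    have hn : ∀ s', φ.hom (C.a i s') ∣ φ.hom (C.a i s) → φ.hom (C.a i s') ∈ nonZeroDivisors T := by
      rintro s' ⟨w, hw⟩
      rw [hw] at hnz
      exact (mul_mem_nonZeroDivisors.1 hnz).1
    refine ⟨T, e, he, hez, ?_⟩
    rw [e₁, e₂]
    exact C.glue i s₁ s₂ φ ψ₁ ψ₂ f₁ f₂ (hn _ (d₁ _)) (hn _ (d₂ _)) (d₁ _) (d₂ _)
  choose T e he hez heq using key
  exact Scheme.Cover.hom_ext (Scheme.Cover.mkOfCovers Z (fun z => Spec (T z)) e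
    (fun z => ⟨z, hez z⟩) he) g g' heq

/-- Lifts exist on an affine cover by the universal property of the chart rings. On overlaps the
inverse image ideal is still invertible, so `hom_ext` makes the lifts agree. -/
theorem exists_lift_hom (C : AffineBlowupCharts π I) {Z : Scheme.{u}} (f : Z ⟶ X) (hf : IsInvertibleIdeal (I.comap f)) :
    ∃ g : Z ⟶ B, g ≫ π = f := by
  have key : ∀ z : Z, ∃ (T : CommRingCat.{u}) (e : Spec T ⟶ Z) (_ : IsOpenImmersion e)
      (g : Spec T ⟶ B), (∃ y, e y = z) ∧ g ≫ π = e ≫ f := by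
    intro z
    obtain ⟨i, x, hx⟩ := C.j_cover (f z)
    obtain ⟨T, e, he, φ, s, hez, -, hφ, hnz, hdvd⟩ := C.exists_generator f hf z i
      (f ⁻¹ᵁ (C.j i).opensRange) ⟨x, hx⟩ (fun z' hz' => hz')
    obtain ⟨ψ, hψ⟩ := C.exists_lift i s φ hnz hdvd
    refine ⟨T, e, he, Spec.map ψ ≫ C.c i s, hez, ?_⟩
    rw [Category.assoc, C.c_comp, ← Category.assoc, ← Spec.map_comp, hψ, hφ]
  choose T e he g hez heq using key
  let 𝒰 : Z.OpenCover := Scheme.Cover.mkOfCovers Z (fun z => Spec (T z)) e (fun z => ⟨z, hez z⟩) he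
  have hcompat : ∀ z z' : Z, pullback.fst (e z) (e z') ≫ g z = pullback.snd (e z) (e z') ≫ g z' := by
    intro z z'
    apply C.hom_ext
    · rw [Category.assoc, Category.assoc, heq, heq, pullback.condition_assoc]
    · rw [Category.assoc, heq, ← Category.assoc, Scheme.IdealSheafData.comap_comp]
      exact hf.comap _
  refine ⟨𝒰.glueMorphisms g hcompat, ?_⟩
  refine Scheme.Cover.hom_ext 𝒰 _ _ fun z => ?_
  have h := 𝒰.ι_glueMorphisms g hcompat z
  exact (Category.assoc _ _ _).symm.trans ((congrArg (· ≫ π) h).trans (heq z))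

theorem isBlowup (C : AffineBlowupCharts π I) : IsBlowup π I where
  invertible := C.isInvertibleIdeal_comap
  existsUnique_lift f hf := by
    obtain ⟨g, hg⟩ := C.exists_lift_hom f hf
    refine ⟨g, hg, fun g' hg' => C.hom_ext g' g (hg'.trans hg.symm) ?_⟩
    rwa [hg']

end AffineBlowupCharts

end ToricBlowup

namespace ToricBlowup

/-! ### Semigroup algebras as affine blowup algebras. -/

section SemigroupAlgebras

variable {N : Type u} [AddCommGroup N] {A : Type u} [CommRing A]
  {Γ H : AddSubmonoid (CharLattice N)}

theorem monomial_mul {x y : CharLattice N} (hx : x ∈ Γ) (hy : y ∈ Γ) :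
    monomial A (⟨x, hx⟩ : Γ) * monomial A ⟨y, hy⟩ = monomial A ⟨x + y, add_mem hx hy⟩ := by
  simp only [monomial, AddMonoidAlgebra.single_mul_single, mul_one]
  rfl

theorem monomial_pow {x : CharLattice N} (hx : x ∈ Γ) (n : ℕ) :
    monomial A (⟨x, hx⟩ : Γ) ^ n = monomial A ⟨n • x, Γ.nsmul_mem hx n⟩ := by
  simp only [monomial, AddMonoidAlgebra.single_pow, one_pow]
  rfl

theorem inclusionHom_monomial (h : Γ ≤ H) {x : CharLattice N} (hx : x ∈ Γ) :
    inclusionHom A h (monomial A ⟨x, hx⟩) = monomial A ⟨x, h hx⟩ :=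
  inclusionHom_single A h _ _

/-- Exponents can be cancelled, so the coefficient of `f * t^γ` at `x + γ` is that of `f` at `x`. -/
theorem monomial_mem_nonZeroDivisors (γ : Γ) :
    monomial A γ ∈ nonZeroDivisors (AddMonoidAlgebra A Γ) := by
  refine mem_nonZeroDivisors_iff_right.2 fun f hf => ?_
  ext x
  have h := congrArg (fun g : AddMonoidAlgebra A Γ => g.coeff (x + γ)) hf
  have h1 := AddMonoidAlgebra.coeff_mul_single_eq_coeff_mul (x := f) (r := (1 : A)) (m := γ)
    (m₁ := x + γ) x fun a _ => add_left_inj γ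
  rw [mul_one] at h1
  exact h1.symm.trans h

theorem ringHom_ext_monomial {T : Type*} [Semiring T] {f g : AddMonoidAlgebra A Γ →+* T}
    (h₁ : ∀ a : A, f (algebraMap A _ a) = g (algebraMap A _ a))
    (h₂ : ∀ γ : Γ, f (monomial A γ) = g (monomial A γ)) : f = g :=
  AddMonoidAlgebra.ringHom_ext h₁ h₂

/-- A homomorphism on `A[t^Γ]` has at most one extension to a larger semigroup algebra whose exponents
are differences of elements of `Γ` and multiples of a regular monomial. -/
theorem eq_of_comp_inclusionHom_eq {T : Type u} [CommRing T] (h : Γ ≤ H) {s : CharLattice N}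
    (hs : s ∈ Γ) (hH : ∀ x ∈ H, ∃ n : ℕ, x + n • s ∈ Γ) {ψ ψ' : AddMonoidAlgebra A H →+* T}
    (hψ : ψ.comp (inclusionHom A h).toRingHom = ψ'.comp (inclusionHom A h).toRingHom)
    (hu : ψ (monomial A ⟨s, h hs⟩) ∈ nonZeroDivisors T) : ψ = ψ' := by
  have e : ∀ y, ψ (inclusionHom A h y) = ψ' (inclusionHom A h y) := fun y => congrArg (· y) hψ
  refine ringHom_ext_monomial (fun a => ?_) fun ⟨x, hx⟩ => ?_
  · have := e (algebraMap A _ a)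
    rwa [AlgHom.commutes] at this
  · obtain ⟨n, hn⟩ := hH x hx
    have h1 : monomial A (⟨x, hx⟩ : H) * monomial A ⟨s, h hs⟩ ^ n =
        inclusionHom A h (monomial A ⟨x + n • s, hn⟩) := by
      rw [monomial_pow, monomial_mul, inclusionHom_monomial]
    have h2 : ψ (monomial A ⟨s, h hs⟩) = ψ' (monomial A ⟨s, h hs⟩) := by
      rw [← inclusionHom_monomial h hs, e]
    have h3 : ψ (monomial A ⟨x, hx⟩) * ψ (monomial A ⟨s, h hs⟩) ^ n =
        ψ' (monomial A ⟨x, hx⟩) * ψ (monomial A ⟨s, h hs⟩) ^ n := by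
      conv_rhs => rw [h2]
      rw [← map_pow, ← map_mul, ← map_pow, ← map_mul, h1, e]
    exact (mul_cancel_right_mem_nonZeroDivisors (pow_mem hu n)).1 h3

theorem exists_nsmul_add_mem_of_mem_chartSemigroup {S : Finset (CharLattice N)}
    (hS : ∀ m ∈ S, m ∈ Γ) {s x : CharLattice N}
    (hx : x ∈ chartSemigroup Γ S s) : ∃ n : ℕ, x + n • s ∈ Γ := by
  obtain ⟨y, hy, z, hz, rfl⟩ := AddSubmonoid.mem_sup.1 hx
  clear hx
  induction hz using AddSubmonoid.closure_induction generalizing y with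
  | mem z hz =>
    obtain ⟨m', hm', rfl⟩ := hz
    refine ⟨1, ?_⟩
    have : y + (m' - s) + 1 • s = y + m' := by rw [one_smul]; abel
    rw [this]
    exact add_mem hy (hS _ hm')
  | zero => exact ⟨0, by simpa using hy⟩
  | add a b _ _ iha ihb =>
    obtain ⟨n, hn⟩ := iha y hy
    obtain ⟨l, hl⟩ := ihb 0 (zero_mem _)
    refine ⟨n + l, ?_⟩
    have : y + (a + b) + (n + l) • s = (y + a + n • s) + (0 + b + l • s) := by rw [add_smul]; abel
    rw [this]
    exact add_mem hn hl

/-- The universal property of `A[t^{Γ_s}]`: it is the affine blowup algebra of `A[t^Γ]` with respect to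
the monomials `t^m`, `m ∈ S`, and `t^s`. -/
theorem exists_lift_chartSemigroup {T : Type u} [CommRing T] {S : Finset (CharLattice N)}
    (hS : ∀ m ∈ S, m ∈ Γ) {s : CharLattice N} (hs : s ∈ S) (φ : AddMonoidAlgebra A Γ →+* T)
    (hu : φ (monomial A ⟨s, hS s hs⟩) ∈ nonZeroDivisors T)
    (hdvd : ∀ (m : CharLattice N) (hm : m ∈ S),
      φ (monomial A ⟨s, hS s hs⟩) ∣ φ (monomial A ⟨m, hS m hm⟩)) :
    ∃ ψ : AddMonoidAlgebra A (chartSemigroup Γ S s) →+* T,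
      ψ.comp (inclusionHom A le_chartSemigroup).toRingHom = φ := by
  set t := φ (monomial A ⟨s, hS s hs⟩) with ht
  -- The relation says that `w` is the fraction `φ(t^(x + n s)) / φ(t^s)^n`. As `φ(t^s)` is a
  -- nonzerodivisor, `x` determines `w`, and multiplicativity in `x` follows from this uniqueness.
  let Rel : CharLattice N → T → Prop := fun x w =>
    ∃ (n : ℕ) (h : x + n • s ∈ Γ), φ (monomial A ⟨x + n • s, h⟩) = t ^ n * w
  have hpow : ∀ (n : ℕ), t ^ n = φ (monomial A ⟨n • s, Γ.nsmul_mem (hS s hs) n⟩) := fun n => by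
    rw [ht, ← map_pow, monomial_pow]
  have hmon : ∀ {x y : CharLattice N} (hx : x ∈ Γ) (hy : y ∈ Γ), x = y →
      φ (monomial A ⟨x, hx⟩) = φ (monomial A ⟨y, hy⟩) := by
    rintro x y hx hy rfl
    rfl
  have huniq : ∀ x w w', Rel x w → Rel x w' → w = w' := by
    rintro x w w' ⟨n, hn, h⟩ ⟨n', hn', h'⟩
    have h1 : t ^ n' * φ (monomial A ⟨x + n • s, hn⟩) = t ^ n * φ (monomial A ⟨x + n' • s, hn'⟩) := by
      rw [hpow, hpow, ← map_mul, ← map_mul, monomial_mul, monomial_mul]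
      exact hmon _ _ (by abel)
    rw [h, h', ← mul_assoc, ← mul_assoc, mul_comm (t ^ n')] at h1
    exact (mul_cancel_left_mem_nonZeroDivisors (mul_mem (pow_mem hu _) (pow_mem hu _))).1 h1
  have hmul : ∀ x y w v, Rel x w → Rel y v → Rel (x + y) (w * v) := by
    rintro x y w v ⟨n, hn, h⟩ ⟨l, hl, h'⟩
    have e : x + y + (n + l) • s = (x + n • s) + (y + l • s) := by rw [add_smul]; abel
    refine ⟨n + l, e ▸ add_mem hn hl, ?_⟩
    rw [hmon _ (add_mem hn hl) e, ← monomial_mul hn hl, map_mul, h, h', pow_add]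
    ring
  have hΓ : ∀ (x : CharLattice N) (hx : x ∈ Γ), Rel x (φ (monomial A ⟨x, hx⟩)) := fun x hx =>
    ⟨0, by simpa using hx, by rw [pow_zero, one_mul]; exact hmon _ _ (by simp)⟩
  have hone : φ (monomial A ⟨0, zero_mem Γ⟩) = 1 := map_one φ
  have hex : ∀ x ∈ chartSemigroup Γ S s, ∃ w, Rel x w := by
    intro x hx
    obtain ⟨y, hy, z, hz, rfl⟩ := AddSubmonoid.mem_sup.1 hx
    suffices ∃ w, Rel z w by
      obtain ⟨w, hw⟩ := this
      exact ⟨_, hmul _ _ _ _ (hΓ y hy) hw⟩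
    clear hx
    induction hz using AddSubmonoid.closure_induction with
    | mem z hz =>
      obtain ⟨m, hm, rfl⟩ := hz
      obtain ⟨w, hw⟩ := hdvd m hm
      have e : m - s + 1 • s = m := by rw [one_smul, sub_add_cancel]
      refine ⟨w, 1, e.symm ▸ hS m hm, ?_⟩
      rw [hmon _ (hS m hm) e, hw, pow_one]
    | zero => exact ⟨_, hΓ 0 (zero_mem _)⟩
    | add a b _ _ ha hb =>
      obtain ⟨w, hw⟩ := ha
      obtain ⟨v, hv⟩ := hb
      exact ⟨_, hmul _ _ _ _ hw hv⟩
  choose! w hw using hex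
  let f : Multiplicative (chartSemigroup Γ S s) →* T :=
    { toFun := fun x => w x.toAdd
      map_one' := by
        rw [← hone]
        exact huniq _ _ _ (hw _ (zero_mem _)) (hΓ 0 (zero_mem _))
      map_mul' := fun x y => huniq _ _ _ (hw _ (add_mem x.toAdd.2 y.toAdd.2))
        (hmul _ _ _ _ (hw _ x.toAdd.2) (hw _ y.toAdd.2)) }
  refine ⟨AddMonoidAlgebra.liftNCRingHom (φ.comp (algebraMap A _)) f fun _ _ => Commute.all _ _,
    ringHom_ext_monomial (fun a => ?_) fun ⟨x, hx⟩ => ?_⟩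
  · have h1 : inclusionHom A (le_chartSemigroup (S := (S : Set (CharLattice N))) (m := s))
      (algebraMap A (AddMonoidAlgebra A Γ) a) = AddMonoidAlgebra.single 0 a := AlgHom.commutes _ _
    change AddMonoidAlgebra.liftNC _ _ (inclusionHom A le_chartSemigroup (algebraMap A _ a)) = _
    rw [h1, AddMonoidAlgebra.liftNC_single]
    have h2 : f (Multiplicative.ofAdd 0) = 1 := map_one f
    rw [h2, mul_one]
    rfl
  · change AddMonoidAlgebra.liftNC _ _ (inclusionHom A le_chartSemigroup (monomial A ⟨x, hx⟩)) = _
    rw [inclusionHom_monomial, monomial, AddMonoidAlgebra.liftNC_single]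
    have h2 : f (Multiplicative.ofAdd ⟨x, le_chartSemigroup hx⟩) = φ (monomial A ⟨x, hx⟩) :=
      huniq _ _ _ (hw x (le_chartSemigroup hx)) (hΓ x hx)
    rw [h2]
    exact (congrArg (· * _) (map_one φ)).trans (one_mul _)

end SemigroupAlgebras

end ToricBlowup

/-! ### The morphism from the subdivided toric scheme and its universal property. -/

namespace ToricBlowup

namespace ToricTriple

variable {N : Type u} [AddCommGroup N] (D : ToricTriple N) (A : Type u) [CommRing A]

theorem map_chart {ρ τ : D.cones} (h : τ ≤ ρ) :
    affineToricMap A (D.semigroup_le h) ≫ D.chart A ρ = D.chart A τ :=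
  colimit.w (D.diagram A) (homOfLE h)

theorem chart_structureMorphism (ρ : D.cones) :
    D.chart A ρ ≫ D.structureMorphism A = affineToricStructure A (D.semigroup ρ) :=
  colimit.ι_desc _ _

theorem exists_chart_eq (x : D.scheme A) : ∃ (ρ : D.cones) (y : _), D.chart A ρ y = x :=
  Scheme.IsLocallyDirected.ι_jointly_surjective (D.diagram A) x

theorem exists_of_chart_eq {ρ ρ' : D.cones} {y : affineToric A (D.semigroup ρ)}
    {y' : affineToric A (D.semigroup ρ')} (h : D.chart A ρ y = D.chart A ρ' y') :
    ∃ τ : D.cones, τ ≤ ρ ∧ τ ≤ ρ' ∧ ∃ z, D.chart A τ z = D.chart A ρ y := by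
  obtain ⟨τ, f, g, z, hz, -⟩ := (Scheme.IsLocallyDirected.ι_eq_ι_iff (D.diagram A)).1 h
  let z' : affineToric A (D.semigroup τ) := z
  have h1 : D.chart A τ z' = D.chart A ρ (affineToricMap A (D.semigroup_le (leOfHom f)) z') := by
    rw [← Scheme.Hom.comp_apply, D.map_chart A (leOfHom f)]
  exact ⟨τ, leOfHom f, leOfHom g, z', h1.trans (congrArg (D.chart A ρ) hz)⟩

theorem hom_ext {X : Scheme.{u}} {f g : D.scheme A ⟶ X}
    (h : ∀ ρ, D.chart A ρ ≫ f = D.chart A ρ ≫ g) : f = g :=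
  colimit.hom_ext h

end ToricTriple

namespace BlowupAtlas

variable {N : Type u} [AddCommGroup N] {ι : Type u} (𝒜 : BlowupAtlas N ι)

theorem semigroup_le_meet (i k : ι) : 𝒜.semigroup i ≤ 𝒜.semigroup (𝒜.meet i k) := by
  rw [𝒜.semigroup_meet]
  exact le_faceSemigroup

/-- A scheme glued from the charts `Spec A[t^{Γ_i}]` along the charts of the common faces. -/
structure Gluing (A : Type u) [CommRing A] (X : Scheme.{u}) where
  j : ∀ i, affineToric A (𝒜.semigroup i) ⟶ X
  isOpenImmersion_j : ∀ i, IsOpenImmersion (j i)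
  exists_eq : ∀ x, ∃ i y, j i y = x
  j_meet : ∀ i k, affineToricMap A (𝒜.semigroup_le_meet i k) ≫ j i = j (𝒜.meet i k)
  exists_of_eq : ∀ i k x y, j i x = j k y → ∃ z, j (𝒜.meet i k) z = j i x

namespace Gluing

attribute [instance] isOpenImmersion_j

variable {𝒜} {A : Type u} [CommRing A] {X : Scheme.{u}} (G : 𝒜.Gluing A X)

theorem j_meet' (i k : ι) (h : 𝒜.semigroup k ≤ 𝒜.semigroup (𝒜.meet i k)) :
    affineToricMap A h ≫ G.j k = G.j (𝒜.meet i k) := by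
  -- The equality of `meet i k` and `meet k i` is only propositional; a free index avoids transport.
  have key : ∀ l, l = 𝒜.meet k i → ∀ h : 𝒜.semigroup k ≤ 𝒜.semigroup l,
      affineToricMap A h ≫ G.j k = G.j l := by
    rintro _ rfl h
    exact G.j_meet k i
  exact key _ (𝒜.meet_comm i k) h

variable [Module.Finite ℤ N] {ρ ρ' : PointedCone ℝ (RealSpace N)}
  {H H' : AddSubmonoid (CharLattice N)}

/-- Both composites factor through the chart of `meet i k`, to whose subdivision `ρ` belongs. -/
theorem map_j_eq {i k : ι} (h : 𝒜.IsChart i ρ H) (h' : 𝒜.IsChart k ρ H) :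
    affineToricMap A h.semigroup_le ≫ G.j i = affineToricMap A h'.semigroup_le ≫ G.j k := by
  have h1 : 𝒜.IsChart (𝒜.meet i k) ρ H := isChart_meet_iff.2 ⟨h, h'.le⟩
  have h2 : 𝒜.semigroup k ≤ 𝒜.semigroup (𝒜.meet i k) := by
    rw [𝒜.meet_comm]; exact 𝒜.semigroup_le_meet k i
  have e₁ : affineToricMap A h.semigroup_le =
      affineToricMap A h1.semigroup_le ≫ affineToricMap A (𝒜.semigroup_le_meet i k) :=
    affineToricMap_trans A _ _
  have e₂ : affineToricMap A h'.semigroup_le = affineToricMap A h1.semigroup_le ≫ affineToricMap A h2 :=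
    affineToricMap_trans A _ _
  rw [e₁, e₂, Category.assoc, Category.assoc, G.j_meet, G.j_meet']

variable [Module.Free ℤ N] [Finite ι] [Nonempty ι]

/-- The morphism from the scheme of the subdivided fan to `X`. -/
noncomputable def morphism : 𝒜.triple.scheme A ⟶ X :=
  colimit.desc (𝒜.triple.diagram A)
    { pt := X
      ι :=
        { app := fun ρ => affineToricMap A (𝒜.exists_isChart_triple ρ).choose_spec.semigroup_le ≫
            G.j (𝒜.exists_isChart_triple ρ).choose
          naturality := fun ρ' ρ f => by
            have hρ := (𝒜.exists_isChart_triple ρ).choose_spec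
            have hρ' := (𝒜.exists_isChart_triple ρ').choose_spec
            have hle : ρ'.1 ≤ ρ.1 := leOfHom f
            refine Eq.trans (Eq.trans ?_ (G.map_j_eq (𝒜.isChart_of_le ρ' (hle.trans hρ.le)) hρ'))
              (Category.comp_id _).symm
            exact (Category.assoc _ _ _).symm.trans
              (congrArg (· ≫ _) (affineToricMap_trans A _ _).symm) } }

theorem chart_morphism {i : ι} {ρ : 𝒜.triple.cones} (h : 𝒜.IsChart i ρ.1 (𝒜.triple.semigroup ρ)) :
    𝒜.triple.chart A ρ ≫ G.morphism = affineToricMap A h.semigroup_le ≫ G.j i :=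
  (colimit.ι_desc _ _).trans (G.map_j_eq (𝒜.exists_isChart_triple ρ).choose_spec h)

theorem morphism_structure (p : X ⟶ Spec (CommRingCat.of A))
    (hp : ∀ i, G.j i ≫ p = affineToricStructure A (𝒜.semigroup i)) :
    G.morphism ≫ p = 𝒜.triple.structureMorphism A := by
  refine 𝒜.triple.hom_ext A fun ρ => ?_
  obtain ⟨i, hi⟩ := 𝒜.exists_isChart_triple ρ
  rw [← Category.assoc, G.chart_morphism hi, Category.assoc, hp, affineToricMap_structure,
    𝒜.triple.chart_structureMorphism]

/-- The inverse image of the chart of `σ_i` is covered by the charts of the cones in `σ_i`. -/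
theorem exists_isChart_of_morphism_eq {i : ι} {b : 𝒜.triple.scheme A}
    {x : affineToric A (𝒜.semigroup i)} (hx : G.j i x = G.morphism b) :
    ∃ ρ : 𝒜.triple.cones, 𝒜.IsChart i ρ.1 (𝒜.triple.semigroup ρ) ∧
      ∃ y, 𝒜.triple.chart A ρ y = b := by
  obtain ⟨ρ, y, rfl⟩ := 𝒜.triple.exists_chart_eq A b
  obtain ⟨k, hk⟩ := 𝒜.exists_isChart_triple ρ
  have h1 : G.morphism (𝒜.triple.chart A ρ y) = G.j k (affineToricMap A hk.semigroup_le y) := by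
    rw [← Scheme.Hom.comp_apply, ← Scheme.Hom.comp_apply, G.chart_morphism hk]
  -- The image of `b` lies in the chart of `σ_k ∩ σ_i`, where the monomial `t^m` cutting out this
  -- face of `σ_k` does not vanish. On the chart of `ρ` the same `t^m` cuts out `ρ ∩ σ_i`, so `b`
  -- lies in the chart of `ρ ∩ σ_i`.
  obtain ⟨z, hz⟩ := G.exists_of_eq k i _ _ (hx.trans h1).symm
  obtain ⟨m, hm, hm1, hm2⟩ := (𝒜.isToricPair k).exists_cutting (𝒜.isFace_meet k i)
  rw [← 𝒜.semigroup_meet] at hm2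
  have h2 : affineToricMap A (𝒜.semigroup_le_meet k i) z = affineToricMap A hk.semigroup_le y := by
    apply (G.j k).isOpenEmbedding.injective
    rw [← hz, ← G.j_meet, Scheme.Hom.comp_apply]
  have h3 := (range_affineToricMap A (𝒜.semigroup_le_meet k i) ⟨m, hm⟩ hm2 _).1 ⟨z, h2⟩
  have h4 : monomial A (⟨m, hk.semigroup_le hm⟩ : 𝒜.triple.semigroup ρ) ∉
      (y : PrimeSpectrum _).asIdeal := by
    rw [← inclusionHom_monomial hk.semigroup_le hm]
    exact h3
  have hface := hk.isFace_inf_cone i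
  let τ : 𝒜.triple.cones := ⟨ρ.1 ⊓ 𝒜.cone i, k, _, hk.face hface⟩
  have hτρ : τ ≤ ρ := show ρ.1 ⊓ 𝒜.cone i ≤ ρ.1 from inf_le_left
  have hcut : ∀ ν, ν ∈ τ.1 ↔ ν ∈ ρ.1 ∧ realify m ν = 0 := by
    intro ν
    have h5 := hm1 ν
    rw [𝒜.cone_meet, Submodule.mem_inf] at h5
    change (ν ∈ ρ.1 ∧ ν ∈ 𝒜.cone i) ↔ _
    exact and_congr_right fun hν => ⟨fun h => (h5.1 ⟨hk.le hν, h⟩).2, fun h =>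
      (h5.2 ⟨hk.le hν, h⟩).2⟩
  have hsemi : ∀ x, x ∈ 𝒜.triple.semigroup τ ↔ ∃ n : ℕ, x + n • m ∈ 𝒜.triple.semigroup ρ := by
    intro x
    rw [𝒜.triple_semigroup_eq (ρ := τ) (hk.face hface)]
    exact hk.isToricPair.mem_faceSemigroup_iff (hk.semigroup_le hm) hcut x
  obtain ⟨y', hy'⟩ := (range_affineToricMap A (𝒜.triple.semigroup_le hτρ)
    ⟨m, hk.semigroup_le hm⟩ hsemi y).2 h4
  refine ⟨τ, 𝒜.isChart_of_le τ inf_le_right, y', ?_⟩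
  rw [← 𝒜.triple.map_chart A hτρ, Scheme.Hom.comp_apply, hy']

theorem preimage_opensRange (i : ι) : G.morphism ⁻¹ᵁ (G.j i).opensRange =
    ⨆ ρ : {ρ : 𝒜.triple.cones // ρ.1 ≤ 𝒜.cone i}, (𝒜.triple.chart A ρ.1).opensRange := by
  ext b
  rw [SetLike.mem_coe, SetLike.mem_coe, TopologicalSpace.Opens.mem_iSup]
  constructor
  · rintro ⟨x, hx⟩
    obtain ⟨ρ, hρ, y, rfl⟩ := G.exists_isChart_of_morphism_eq hx
    exact ⟨⟨ρ, hρ.le⟩, y, rfl⟩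
  · rintro ⟨⟨ρ, hρ⟩, y, rfl⟩
    have h := 𝒜.isChart_of_le ρ hρ
    refine ⟨affineToricMap A h.semigroup_le y, ?_⟩
    rw [← Scheme.Hom.comp_apply, ← Scheme.Hom.comp_apply, G.chart_morphism h]

/-- The cone of linearity on which `s` is minimal among the exponents of `σ_i`. -/
noncomputable def maxCone (i : ι) (s : 𝒜.exps i) : 𝒜.triple.cones :=
  ⟨linearityCone (𝒜.cone i) (𝒜.exps i) s, i, _, isBlowupChart_linearityCone (𝒜.isToricPair i) s.2⟩

theorem semigroup_maxCone (i : ι) (s : 𝒜.exps i) : 𝒜.triple.semigroup (maxCone i s) =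
    chartSemigroup (𝒜.semigroup i) (𝒜.exps i) s :=
  𝒜.triple_semigroup_eq (i := i) (isBlowupChart_linearityCone (𝒜.isToricPair i) s.2)

theorem isChart_maxCone (i : ι) (s : 𝒜.exps i) :
    𝒜.IsChart i (maxCone i s).1 (𝒜.triple.semigroup (maxCone i s)) :=
  𝒜.isChart_of_le _ linearityCone_le

theorem le_semigroup_maxCone (i : ι) (s : 𝒜.exps i) :
    𝒜.semigroup i ≤ 𝒜.triple.semigroup (maxCone i s) := (isChart_maxCone i s).semigroup_le

theorem exists_maxCone_of_morphism_eq {i : ι} {b : 𝒜.triple.scheme A}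
    {x : affineToric A (𝒜.semigroup i)} (hx : G.j i x = G.morphism b) :
    ∃ (s : 𝒜.exps i) (y : _), 𝒜.triple.chart A (maxCone i s) y = b := by
  obtain ⟨ρ, hρ, y, rfl⟩ := G.exists_isChart_of_morphism_eq hx
  obtain ⟨s, hs, hface, -⟩ := hρ
  have hle : ρ ≤ maxCone i ⟨s, hs⟩ := le_of_isFace hface
  exact ⟨⟨s, hs⟩, affineToricMap A (𝒜.triple.semigroup_le hle) y, by
    rw [← Scheme.Hom.comp_apply, 𝒜.triple.map_chart A hle]⟩

/-- The monomials `t^m` for the exponents `m` of `σ_i`. -/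
noncomputable def generator (A : Type u) [CommRing A] (i : ι) (s : 𝒜.exps i) :
    AddMonoidAlgebra A (𝒜.semigroup i) :=
  monomial A ⟨s, 𝒜.exps_mem i s s.2⟩

/-- Two morphisms from an affine scheme to charts of the subdivision that agree over `X` factor through
the common face when the corresponding monomials generate the same ideal. -/
theorem glue_maxCone {i : ι} (s s' : 𝒜.exps i) {T : Type u} [CommRing T]
    (ψ : AddMonoidAlgebra A (𝒜.triple.semigroup (maxCone i s)) →+* T)
    (ψ' : AddMonoidAlgebra A (𝒜.triple.semigroup (maxCone i s')) →+* T)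
    (h : ψ.comp (inclusionHom A (le_semigroup_maxCone i s)).toRingHom =
      ψ'.comp (inclusionHom A (le_semigroup_maxCone i s')).toRingHom)
    (hs : ψ (inclusionHom A (le_semigroup_maxCone i s) (generator A i s)) ∈ nonZeroDivisors T)
    (hdvd : ψ (inclusionHom A (le_semigroup_maxCone i s) (generator A i s')) ∣
      ψ (inclusionHom A (le_semigroup_maxCone i s) (generator A i s))) :
    Spec.map (CommRingCat.ofHom ψ) ≫ 𝒜.triple.chart A (maxCone i s) =
      Spec.map (CommRingCat.ofHom ψ') ≫ 𝒜.triple.chart A (maxCone i s') := by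
  have hsub : (s' : CharLattice N) - s ∈ 𝒜.triple.semigroup (maxCone i s) := by
    rw [semigroup_maxCone]; exact sub_mem_chartSemigroup s'.2
  have hmul : monomial A (⟨_, hsub⟩ : 𝒜.triple.semigroup (maxCone i s)) *
      inclusionHom A (le_semigroup_maxCone i s) (generator A i s) =
        inclusionHom A (le_semigroup_maxCone i s) (generator A i s') := by
    rw [generator, generator, inclusionHom_monomial, inclusionHom_monomial, monomial_mul]
    congr 2
    exact sub_add_cancel _ _
  -- The image of `t^(s' - s) * t^s = t^s'` divides that of `t^s`, a nonzerodivisor; cancelling it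
  -- leaves a unit.
  have hunit : IsUnit (ψ (monomial A ⟨_, hsub⟩)) := by
    obtain ⟨w, hw⟩ := hdvd
    rw [← hmul, map_mul] at hw
    refine IsUnit.of_mul_eq_one w ?_
    refine (mul_cancel_right_mem_nonZeroDivisors hs).1 ?_
    linear_combination -hw
  have hface := isFace_linearityCone_inf (σ := 𝒜.cone i) (S := (𝒜.exps i : Set (CharLattice N)))
    (m := s) (m' := s') s.2 s'.2
  let τ : 𝒜.triple.cones := ⟨(maxCone i s).1 ⊓ (maxCone i s').1, i, _, (isChart_maxCone i s).face hface⟩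
  have hτ : τ ≤ maxCone i s := show (maxCone i s).1 ⊓ (maxCone i s').1 ≤ _ from inf_le_left
  have hτ' : τ ≤ maxCone i s' := show (maxCone i s).1 ⊓ (maxCone i s').1 ≤ _ from inf_le_right
  have hcut : ∀ ν, ν ∈ τ.1 ↔ ν ∈ (maxCone i s).1 ∧ realify ((s' : CharLattice N) - (s : CharLattice N)) ν = 0 := by
    intro ν
    change (ν ∈ (maxCone i s).1 ∧ ν ∈ (maxCone i s').1) ↔ _
    refine and_congr_right fun h1 => ?_
    rw [map_sub, LinearMap.sub_apply, sub_eq_zero]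
    exact ⟨fun h2 => le_antisymm (h2.2 _ s.2) (h1.2 _ s'.2),
      fun h2 => ⟨h1.1, fun t ht => by rw [h2]; exact h1.2 t ht⟩⟩
  have hsemi : ∀ x, x ∈ 𝒜.triple.semigroup τ ↔ ∃ n : ℕ,
      x + n • ((s' : CharLattice N) - (s : CharLattice N)) ∈ 𝒜.triple.semigroup (maxCone i s) := by
    intro x
    rw [𝒜.triple_semigroup_eq (ρ := τ) ((isChart_maxCone i s).face hface)]
    exact (isChart_maxCone i s).isToricPair.mem_faceSemigroup_iff hsub hcut x
  -- The chart of the common face is the localization at `t^(s' - s)`, so `ψ` extends to it.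
  -- Uniqueness of extensions from `A[t^Γ]` then shows that the extension restricts to `ψ'` on the
  -- other chart.
  obtain ⟨χ, hχ⟩ : ∃ χ : AddMonoidAlgebra A (𝒜.triple.semigroup τ) →+* T,
      χ.comp (inclusionHom A (𝒜.triple.semigroup_le hτ)).toRingHom = ψ := by
    let _ := (inclusionHom A (𝒜.triple.semigroup_le hτ)).toRingHom.toAlgebra
    have := isLocalization_inclusionHom A (𝒜.triple.semigroup_le hτ) ⟨_, hsub⟩ hsemi
    exact ⟨IsLocalization.Away.lift _ hunit, IsLocalization.Away.lift_comp _ hunit⟩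
  have hχ' : χ.comp (inclusionHom A (𝒜.triple.semigroup_le hτ')).toRingHom = ψ' := by
    have hcomp : ∀ {Γ₁ Γ₂ : AddSubmonoid (CharLattice N)} (h₁ : 𝒜.semigroup i ≤ Γ₁) (h₂ : Γ₁ ≤ Γ₂),
        (inclusionHom A h₂).toRingHom.comp (inclusionHom A h₁).toRingHom =
          (inclusionHom A (h₁.trans h₂)).toRingHom := fun h₁ h₂ => by
      rw [inclusionHom_trans A h₁ h₂]; rfl
    have hagree : (χ.comp (inclusionHom A (𝒜.triple.semigroup_le hτ')).toRingHom).comp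
        (inclusionHom A (le_semigroup_maxCone i s')).toRingHom =
          ψ'.comp (inclusionHom A (le_semigroup_maxCone i s')).toRingHom := by
      rw [← h, ← hχ, RingHom.comp_assoc, RingHom.comp_assoc, hcomp, hcomp]
    refine eq_of_comp_inclusionHom_eq (le_semigroup_maxCone i s') (𝒜.exps_mem i s' s'.2)
      (fun x hx => ?_) hagree ?_
    · rw [semigroup_maxCone] at hx
      exact exists_nsmul_add_mem_of_mem_chartSemigroup (𝒜.exps_mem i) hx
    · rw [← inclusionHom_monomial (le_semigroup_maxCone i s') (𝒜.exps_mem i s' s'.2)]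
      have e := congrArg (· (generator A i s')) (hagree.trans h.symm)
      have e' : (χ.comp (inclusionHom A (𝒜.triple.semigroup_le hτ')).toRingHom)
          (inclusionHom A (le_semigroup_maxCone i s') (generator A i s')) =
            ψ (inclusionHom A (le_semigroup_maxCone i s) (generator A i s')) := e
      rw [generator] at e'
      rw [e', ← generator, ← hmul, map_mul]
      exact mul_mem hunit.mem_nonZeroDivisors hs
  have key : ∀ {ρ : 𝒜.triple.cones} (hρ : τ ≤ ρ),
      Spec.map (CommRingCat.ofHom (χ.comp (inclusionHom A (𝒜.triple.semigroup_le hρ)).toRingHom)) ≫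
        𝒜.triple.chart A ρ = Spec.map (CommRingCat.ofHom χ) ≫ 𝒜.triple.chart A τ := by
    intro ρ hρ
    rw [← 𝒜.triple.map_chart A hρ, ← Category.assoc, affineToricMap, ← Spec.map_comp]
    rfl
  rw [← hχ, ← hχ', key hτ, key hτ']

theorem exists_lift_maxCone {i : ι} (s : 𝒜.exps i) {T : Type u} [CommRing T]
    (φ : AddMonoidAlgebra A (𝒜.semigroup i) →+* T)
    (hs : φ (generator A i s) ∈ nonZeroDivisors T)
    (hdvd : ∀ s', φ (generator A i s) ∣ φ (generator A i s')) :
    ∃ ψ : AddMonoidAlgebra A (𝒜.triple.semigroup (maxCone i s)) →+* T,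
      ψ.comp (inclusionHom A (le_semigroup_maxCone i s)).toRingHom = φ := by
  have key : ∀ (H : AddSubmonoid (CharLattice N)) (h : 𝒜.semigroup i ≤ H),
      H = chartSemigroup (𝒜.semigroup i) (𝒜.exps i) s →
        ∃ ψ : AddMonoidAlgebra A H →+* T, ψ.comp (inclusionHom A h).toRingHom = φ := by
    rintro _ h rfl
    exact exists_lift_chartSemigroup (𝒜.exps_mem i) s.2 φ hs fun m hm => hdvd ⟨m, hm⟩
  exact key _ _ (semigroup_maxCone i s)

/-- The charts are indexed by all exponents and not only by the vertices, so that they correspond to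
the generators of the ideal; the additional charts are harmless. -/
theorem isBlowup {I : X.IdealSheafData} (hI : ∀ i, I.comap (G.j i) =
    specIdealSheaf (monomialIdeal A (𝒜.semigroup i) (𝒜.exps i))) : IsBlowup G.morphism I :=
  AffineBlowupCharts.isBlowup
    { ι := ι
      κ := fun i => 𝒜.exps i
      finite := inferInstance
      R := fun i => CommRingCat.of (AddMonoidAlgebra A (𝒜.semigroup i))
      j := G.j
      isOpenImmersion_j := inferInstance
      j_cover := G.exists_eq
      a := generator A
      comap_j := fun i => by
        rw [hI, monomialIdeal]
        congr 2
        ext x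
        constructor
        · rintro ⟨γ, hγ, rfl⟩
          exact ⟨⟨γ, hγ⟩, rfl⟩
        · rintro ⟨s, rfl⟩
          exact ⟨⟨s, 𝒜.exps_mem i s s.2⟩, s.2, rfl⟩
      R' := fun i s => CommRingCat.of (AddMonoidAlgebra A (𝒜.triple.semigroup (maxCone i s)))
      ρ := fun i s => CommRingCat.ofHom (inclusionHom A (le_semigroup_maxCone i s)).toRingHom
      c := fun i s => 𝒜.triple.chart A (maxCone i s)
      isOpenImmersion_c := inferInstance
      c_comp := fun i s => G.chart_morphism (isChart_maxCone i s)
      c_cover := fun i b ⟨x, hx⟩ => G.exists_maxCone_of_morphism_eq hx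
      mem_nonZeroDivisors := fun i s => by
        change inclusionHom A _ (generator A i s) ∈ _
        rw [generator, inclusionHom_monomial]
        exact monomial_mem_nonZeroDivisors _
      dvd := fun i s s' => by
        have hsub : (s' : CharLattice N) - s ∈ 𝒜.triple.semigroup (maxCone i s) := by
          rw [semigroup_maxCone]; exact sub_mem_chartSemigroup s'.2
        refine ⟨monomial A ⟨_, hsub⟩, ?_⟩
        change inclusionHom A _ (generator A i s') = inclusionHom A _ (generator A i s) * _
        rw [generator, generator, inclusionHom_monomial, inclusionHom_monomial, monomial_mul]
        congr 2
        exact (add_sub_cancel _ _).symm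
      exists_lift := fun i s T φ hs hdvd => by
        obtain ⟨ψ, hψ⟩ := exists_lift_maxCone s φ.hom hs hdvd
        exact ⟨CommRingCat.ofHom ψ, CommRingCat.hom_ext hψ⟩
      glue := fun i s s' T φ ψ ψ' hψ hψ' hs _ _ hdvd => by
        refine glue_maxCone s s' ψ.hom ψ'.hom ?_ ?_ ?_
        · exact congrArg CommRingCat.Hom.hom (hψ.trans hψ'.symm)
        · rw [← hψ] at hs
          exact hs
        · rw [← hψ] at hdvd
          exact hdvd }

end Gluing

end BlowupAtlas

end ToricBlowup

namespace ToricBlowup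

/-! ### Extreme points of convex hulls. -/

section ExtremePoints

variable {E : Type*} [AddCommGroup E] [Module ℝ E]

/-- The set consisting of `x` and the open half-space `l > l x` is convex, so it contains the hull:
a strict minimum on `G` stays strict on the hull. -/
theorem mem_extremePoints_convexHull {G : Set E} {x : E} (hx : x ∈ G) (l : Module.Dual ℝ E)
    (h : ∀ g ∈ G, g ≠ x → l x < l g) : x ∈ (convexHull ℝ G).extremePoints ℝ := by
  have hC : Convex ℝ {y | y = x ∨ l x < l y} := by
    intro y hy z hz a b ha hb hab
    have hle : ∀ {y}, (y = x ∨ l x < l y) → l x ≤ l y := by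
      rintro y (rfl | h)
      exacts [le_rfl, h.le]
    have hlin : l (a • y + b • z) - l x = a * (l y - l x) + b * (l z - l x) := by
      rw [map_add, map_smul, map_smul, smul_eq_mul, smul_eq_mul]
      linear_combination l x * hab
    have hy' := mul_nonneg ha (sub_nonneg.2 (hle hy))
    have hz' := mul_nonneg hb (sub_nonneg.2 (hle hz))
    rcases (add_nonneg hy' hz').eq_or_lt with h0 | h0
    · left
      have key : ∀ {c : ℝ} {y : E}, (y = x ∨ l x < l y) → 0 ≤ c → c * (l y - l x) = 0 →
          c • y = c • x := by
        rintro c y (rfl | h) hc h0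
        · rfl
        · rw [(mul_eq_zero.1 h0).resolve_right (sub_pos.2 h).ne', zero_smul, zero_smul]
      rw [key hy ha (by linarith), key hz hb (by linarith), ← add_smul, hab, one_smul]
    · right
      linarith
  have hsub : convexHull ℝ G ⊆ {y | y = x ∨ l x < l y} :=
    convexHull_min (fun g hg => or_iff_not_imp_left.2 (h g hg)) hC
  refine mem_extremePoints.2 ⟨subset_convexHull ℝ G hx, ?_⟩
  rintro y hy z hz ⟨a, b, ha, hb, hab, rfl⟩
  have hlin : a * (l y - l (a • y + b • z)) + b * (l z - l (a • y + b • z)) = 0 := by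
    simp only [map_add, map_smul, smul_eq_mul]
    linear_combination (-(a * l y + b * l z)) * hab
  have hy' := hsub hy
  have hz' := hsub hz
  rcases hy' with hy' | hy' <;> rcases hz' with hz' | hz'
  · exact ⟨hy', hz'⟩
  · have := mul_pos hb (sub_pos.2 hz')
    rw [← hy', sub_self] at hlin
    rw [← hy'] at this
    linarith
  · have := mul_pos ha (sub_pos.2 hy')
    rw [← hz', sub_self] at hlin
    rw [← hz'] at this
    linarith
  · have h1 := mul_pos ha (sub_pos.2 hy')
    have h2 := mul_pos hb (sub_pos.2 hz')
    linarith

theorem eq_of_mem_extremePoints {P : Set E} {x p q : E} (hx : x ∈ P.extremePoints ℝ)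
    (hp : p ∈ P) (hq : q ∈ P) {a b : ℝ} (ha : 0 < a) (hb : 0 < b)
    (h : (a + b) • x = a • p + b • q) : p = x := by
  have hab : 0 < a + b := add_pos ha hb
  refine ((mem_extremePoints.1 hx).2 p hp q hq
    ⟨a / (a + b), b / (a + b), by positivity, by positivity, by field_simp, ?_⟩).1
  have := congrArg (fun y => (a + b)⁻¹ • y) h
  simp only [smul_smul, smul_add, inv_mul_cancel₀ hab.ne', one_smul] at this
  rw [this, div_eq_inv_mul, div_eq_inv_mul]

end ExtremePoints

theorem exists_forall_lt_mul {α : Type*} (s : Finset α) (a b : α → ℝ) (ha : ∀ i ∈ s, 0 < a i) :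
    ∃ K : ℝ, 0 ≤ K ∧ ∀ i ∈ s, b i < K * a i := by
  classical
  induction s using Finset.induction_on with
  | empty => exact ⟨0, le_rfl, by simp⟩
  | insert i s _ ih =>
    obtain ⟨K, hK, h⟩ := ih fun j hj => ha j (Finset.mem_insert_of_mem hj)
    refine ⟨max K (b i / a i + 1), hK.trans (le_max_left _ _), fun j hj => ?_⟩
    have hj0 := ha j hj
    rcases Finset.mem_insert.1 hj with rfl | hj
    · calc b j < (b j / a j + 1) * a j := by rw [add_mul, div_mul_cancel₀ _ hj0.ne']; linarith
        _ ≤ _ := mul_le_mul_of_nonneg_right (le_max_right _ _) hj0.le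
    · exact (h j hj).trans_le (mul_le_mul_of_nonneg_right (le_max_left _ _) hj0.le)

/-! ### Vertices of the Newton polyhedron. -/

section Newton

variable {N : Type u} [AddCommGroup N] {σ : PointedCone ℝ (RealSpace N)}
  {Γ : AddSubmonoid (CharLattice N)} {S : Finset (CharLattice N)}

theorem realify_add_mem_newtonPolyhedron {S : Set (CharLattice N)} {m : CharLattice N} (hm : m ∈ S)
    {w : DualSpace N} (hw : w ∈ dualCone σ) : realify m + w ∈ newtonPolyhedron σ S :=
  subset_convexHull ℝ _ ⟨m, hm, w, hw, rfl⟩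

theorem realify_mem_newtonPolyhedron {S : Set (CharLattice N)} {m : CharLattice N} (hm : m ∈ S) :
    realify m ∈ newtonPolyhedron σ S := by
  simpa using realify_add_mem_newtonPolyhedron hm (zero_mem (dualCone σ))

/-- The point `m + w` is the midpoint of `m` and `m + 2w`. -/
theorem eq_zero_of_mem_extremePoints {S : Set (CharLattice N)} {m : CharLattice N} (hm : m ∈ S)
    {w : DualSpace N} (hw : w ∈ dualCone σ)
    (h : realify m + w ∈ (newtonPolyhedron σ S).extremePoints ℝ) : w = 0 := by
  have := eq_of_mem_extremePoints h (realify_mem_newtonPolyhedron hm)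
    (realify_add_mem_newtonPolyhedron hm (add_mem hw hw)) one_pos one_pos
    (by module)
  simpa using this

/-- Linear forms of `S` that agree on a linearity cone `σ_m` are compared by elements of the
semigroup of `σ_m`, and these are nonnegative combinations of `Γ` and of `p - m`, for points `p` of
the Newton polyhedron. -/
theorem exists_of_mem_chartSemigroup {S : Set (CharLattice N)} {m x : CharLattice N} (hm : m ∈ S)
    (hx : x ∈ chartSemigroup Γ S m) :
    ∃ γ ∈ Γ, ∃ l : ℝ, 0 ≤ l ∧ ∃ p ∈ newtonPolyhedron σ S,
      realify x = realify γ + l • (p - realify m) := by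
  obtain ⟨γ, hγ, y, hy, rfl⟩ := AddSubmonoid.mem_sup.1 hx
  clear hx
  suffices h : ∃ l : ℝ, 0 ≤ l ∧ ∃ p ∈ newtonPolyhedron σ S, realify y = l • (p - realify m) by
    obtain ⟨l, hl, p, hp, e⟩ := h
    exact ⟨γ, hγ, l, hl, p, hp, by rw [map_add, e]⟩
  induction hy using AddSubmonoid.closure_induction with
  | mem y h =>
    obtain ⟨m', hm', rfl⟩ := h
    exact ⟨1, zero_le_one, realify m', realify_mem_newtonPolyhedron hm', by rw [one_smul, map_sub]⟩
  | zero => exact ⟨0, le_rfl, realify m, realify_mem_newtonPolyhedron hm, by simp⟩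
  | add y z _ _ ihy ihz =>
    obtain ⟨l, hl, p, hp, e⟩ := ihy
    obtain ⟨l', hl', p', hp', e'⟩ := ihz
    rcases hl.eq_or_lt with rfl | h0
    · exact ⟨l', hl', p', hp', by rw [map_add, e, e', zero_smul, zero_add]⟩
    · have h1 : 0 < l + l' := add_pos_of_pos_of_nonneg h0 hl'
      refine ⟨l + l', h1.le, (l / (l + l')) • p + (l' / (l + l')) • p',
        convex_convexHull ℝ _ hp hp' (by positivity) (by positivity) (by field_simp), ?_⟩
      rw [map_add, e, e']
      match_scalars <;> field_simp
      ring

/-- If the cone of `m` lies in that of `m'`, then `m - m'` is nonnegative on it, so `n (m - m') = γ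
+ l (p - m)` with `γ ∈ Γ`, `n > 0`, `l ≥ 0` and `p` in the polyhedron. Thus `m` is a weighted mean
of `m' + γ / n` and `p`. Extremality gives `m = m' + γ / n`, then `γ = 0`. -/
theorem mem_vertexExponents_of_mem_extremePoints [Module.Free ℤ N] [Module.Finite ℤ N]
    (hΓ : IsToricPair σ Γ) {m : CharLattice N} (hm : m ∈ S)
    (h : realify m ∈ (newtonPolyhedron σ S).extremePoints ℝ) :
    m ∈ vertexExponents σ (S : Set (CharLattice N)) := by
  refine ⟨hm, fun m' hm' hle => ?_⟩
  suffices m = m' by rw [this]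
  have hx : realify (m - m') ∈ realCone (chartSemigroup Γ (S : Set (CharLattice N)) m) := by
    rw [(hΓ.linearityCone S m).realCone_eq]
    intro ν hν
    have := (hle hν).2 m hm
    change 0 ≤ realify (m - m') ν
    rw [map_sub, LinearMap.sub_apply]
    linarith
  obtain ⟨n, hn, hmem⟩ := exists_nsmul_mem hx
  obtain ⟨γ, hγ, l, hl, p, hp, e⟩ := exists_of_mem_chartSemigroup (σ := σ) hm hmem
  have hn0 : (0 : ℝ) < n := by exact_mod_cast hn
  have hw : (n : ℝ)⁻¹ • realify γ ∈ dualCone σ :=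
    (dualCone σ).smul_mem (by positivity) (fun ν hν => hΓ.nonneg hγ hν)
  have e' : (n + l) • realify m = (n : ℝ) • (realify m' + (n : ℝ)⁻¹ • realify γ) + l • p := by
    rw [map_nsmul, map_sub, ← Nat.cast_smul_eq_nsmul ℝ, smul_sub, smul_sub] at e
    rw [smul_add, smul_smul, mul_inv_cancel₀ hn0.ne', one_smul, add_smul, sub_eq_iff_eq_add.1 e]
    abel
  have hq : realify m' + (n : ℝ)⁻¹ • realify γ = realify m := by
    rcases hl.eq_or_lt with rfl | hl
    · rw [add_zero, zero_smul, add_zero] at e'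
      exact (smul_right_injective _ hn0.ne' e').symm
    · exact eq_of_mem_extremePoints h (realify_add_mem_newtonPolyhedron hm' hw) hp hn0 hl e'
  have h0 := eq_zero_of_mem_extremePoints hm' hw (hq ▸ h)
  rw [h0, add_zero] at hq
  exact (realify_injective hq).symm

/-- A vertex exponent is the unique minimum on the Newton polyhedron of some `ν ∈ σ`. -/
theorem exists_forall_lt_of_mem_vertexExponents (hσ : IsRational σ)
    (hspan : Submodule.span ℝ (σ : Set (RealSpace N)) = ⊤) {m : CharLattice N}
    (hm : m ∈ vertexExponents σ (S : Set (CharLattice N))) :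
    ∃ ν ∈ σ, (∀ m' ∈ S, m' ≠ m → realify m ν < realify m' ν) ∧
      ∀ w ∈ dualCone σ, w ν = 0 → w = 0 := by
  classical
  set L := linearityCone σ (S : Set (CharLattice N)) with hL
  -- If `m' ≤ m` on all of `L m`, then `L m ⊆ L m'`, and maximality gives equality. The sum `ν₀` of
  -- these witnesses serves all `m'` at once.
  have hw : ∀ m' ∈ S, ∃ ν ∈ L m, L m' ≠ L m → realify m ν < realify m' ν := by
    intro m' hm'
    by_contra! hcon
    refine (hcon 0 (zero_mem _)).1 (hm.2 m' hm' fun ν hν => ⟨hν.1, fun m'' hm'' => ?_⟩)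
    exact (hcon ν hν).2.trans (hν.2 m'' hm'')
  choose! f hf hlt using hw
  set ν₀ := ∑ m' ∈ S, f m' with hν₀
  have hν₀m : ν₀ ∈ L m := sum_mem hf
  have hlt₀ : ∀ m' ∈ S, L m' ≠ L m → realify m ν₀ < realify m' ν₀ := by
    intro m' hm' hne
    rw [hν₀, map_sum, map_sum]
    exact Finset.sum_lt_sum (fun i hi => (hf i hi).2 m' hm') ⟨m', hm', hlt m' hm' hne⟩
  -- Full dimension enters here: for any `ν₁ ∈ σ` and large `K`, both `K • ν₀` and `K • ν₀ + ν₁` lie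
  -- in `L m`, where `m` and `m'` agree. They therefore agree on `σ`, which spans.
  have huniq : ∀ m' ∈ S, L m' = L m → m' = m := by
    intro m' hm' he
    have hagree : ∀ ν ∈ L m, realify m' ν = realify m ν := fun ν hν =>
      le_antisymm (((he ▸ hν : ν ∈ L m')).2 m hm.1) (hν.2 m' hm')
    refine realify_injective (LinearMap.ext_on hspan fun ν₁ hν₁ => ?_)
    obtain ⟨K, hK, hKlt⟩ := exists_forall_lt_mul (S.filter fun m' => L m' ≠ L m)
      (fun m' => realify m' ν₀ - realify m ν₀) (fun m' => realify m ν₁ - realify m' ν₁)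
      (fun m' h => sub_pos.2 (hlt₀ m' (Finset.mem_filter.1 h).1 (Finset.mem_filter.1 h).2))
    have hKν₀ : K • ν₀ ∈ L m := (L m).smul_mem hK hν₀m
    obtain ⟨m₁, hm₁, hmin⟩ := S.exists_min_image (fun m' => realify m' (K • ν₀ + ν₁)) ⟨m, hm.1⟩
    have hmem : K • ν₀ + ν₁ ∈ L m₁ := ⟨add_mem hKν₀.1 hν₁, hmin⟩
    have he₁ : L m₁ = L m := by
      by_contra hne
      have h1 := hKlt m₁ (Finset.mem_filter.2 ⟨hm₁, hne⟩)
      have h2 := hmin m hm.1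
      simp only [map_add, map_smul, smul_eq_mul] at h2
      linarith
    have h3 := hagree _ (he₁ ▸ hmem)
    have h4 := hagree _ hKν₀
    rw [map_add, map_add, h4] at h3
    exact add_left_cancel h3
  obtain ⟨s, hs⟩ := hσ
  -- An element of the dual cone that vanishes at the sum of the generators vanishes at each of
  -- them, hence everywhere, since `σ` spans.
  set ν₁ : RealSpace N := ∑ v ∈ s, (1 : ℝ) ⊗ₜ[ℤ] v with hν₁
  have hsσ : ∀ v ∈ s, (1 : ℝ) ⊗ₜ[ℤ] v ∈ σ := fun v hv => by
    rw [hs]; exact Submodule.subset_span ⟨v, hv, rfl⟩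
  obtain ⟨K, hK, hKlt⟩ := exists_forall_lt_mul (S.filter fun m' => m' ≠ m)
    (fun m' => realify m' ν₀ - realify m ν₀) (fun m' => realify m ν₁ - realify m' ν₁)
    (fun m' h => sub_pos.2 (hlt₀ m' (Finset.mem_filter.1 h).1
      (mt (huniq m' (Finset.mem_filter.1 h).1) (Finset.mem_filter.1 h).2)))
  refine ⟨K • ν₀ + ν₁, add_mem (σ.smul_mem hK hν₀m.1) (sum_mem hsσ),
    fun m' hm' hne => ?_, fun w hw h0 => ?_⟩
  · have := hKlt m' (Finset.mem_filter.2 ⟨hm', hne⟩)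
    simp only [map_add, map_smul, smul_eq_mul]
    linarith
  · have hwσ : ∀ ν ∈ σ, 0 ≤ w ν := fun ν hν => hw hν
    have hsum : ∑ v ∈ s, w ((1 : ℝ) ⊗ₜ[ℤ] v) = 0 := by
      rw [map_add, map_smul, smul_eq_mul, hν₁, map_sum _ _ s] at h0
      have h1 := mul_nonneg hK (hwσ _ hν₀m.1)
      have h2 := Finset.sum_nonneg fun v hv => hwσ _ (hsσ v hv)
      linarith
    refine LinearMap.ext_on hspan fun ν hν => ?_
    have hneg : ∀ t ∈ (fun v : N => (1 : ℝ) ⊗ₜ[ℤ] v) '' (s : Set N), 0 ≤ (-w) t := by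
      rintro _ ⟨v, hv, rfl⟩
      have := (Finset.sum_eq_zero_iff_of_nonneg fun v hv => hwσ _ (hsσ v hv)).1 hsum v hv
      rw [LinearMap.neg_apply, this, neg_zero]
    have h1 := nonneg_of_mem_hull hneg (hs ▸ hν : ν ∈ PointedCone.hull ℝ _)
    have h2 := hwσ ν hν
    rw [LinearMap.neg_apply] at h1
    change w ν = 0
    linarith

theorem image_vertexExponents_eq_extremePoints [Module.Free ℤ N] [Module.Finite ℤ N]
    (hΓ : IsToricPair σ Γ) (S : Finset (CharLattice N))
    (hspan : Submodule.span ℝ (σ : Set (RealSpace N)) = ⊤) :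
    realify '' vertexExponents σ (S : Set (CharLattice N)) =
      (newtonPolyhedron σ (S : Set (CharLattice N))).extremePoints ℝ := by
  ext u
  constructor
  · rintro ⟨m, hm, rfl⟩
    obtain ⟨ν, hν, hlt, hzero⟩ := exists_forall_lt_of_mem_vertexExponents hΓ.rational hspan hm
    refine mem_extremePoints_convexHull ⟨m, hm.1, 0, zero_mem _, by simp⟩
      (Module.Dual.eval ℝ (RealSpace N) ν) ?_
    rintro _ ⟨m', hm', w, hw, rfl⟩ hne
    have hw0 : 0 ≤ w ν := hw hν
    simp only [Module.Dual.eval_apply, LinearMap.add_apply]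
    by_cases h : m' = m
    · subst h
      have : w ν ≠ 0 := fun h0 => hne (by rw [hzero w hw h0, add_zero])
      linarith [lt_of_le_of_ne hw0 this.symm]
    · linarith [hlt m' hm' h]
  · intro hu
    obtain ⟨m, hm, w, hw, rfl⟩ := extremePoints_convexHull_subset hu
    have h0 := eq_zero_of_mem_extremePoints hm hw hu
    rw [h0, add_zero] at hu ⊢
    exact ⟨m, mem_vertexExponents_of_mem_extremePoints hΓ hm hu, rfl⟩

end Newton

end ToricBlowup

namespace ToricBlowup

/-! ### Monomial ideals. -/

section MonomialIdeals

variable {N : Type u} [AddCommGroup N] {A : Type u} [CommRing A]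
  {Γ H : AddSubmonoid (CharLattice N)}

theorem monomialIdeal_eq_span_of' (S : Set (CharLattice N)) :
    monomialIdeal A Γ S =
      Ideal.span (AddMonoidAlgebra.of' A Γ '' {γ | (γ : CharLattice N) ∈ S}) := by
  refine congrArg Ideal.span (Set.ext fun x => ?_)
  constructor
  · rintro ⟨γ, hγ, rfl⟩
    exact ⟨γ, hγ, rfl⟩
  · rintro ⟨γ, hγ, rfl⟩
    exact ⟨γ, hγ, rfl⟩

theorem monomial_mem_monomialIdeal {S : Set (CharLattice N)} {m : CharLattice N} (hm : m ∈ S)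
    (h : m ∈ Γ) : monomial A (⟨m, h⟩ : Γ) ∈ monomialIdeal A Γ S :=
  Ideal.subset_span ⟨⟨m, h⟩, hm, rfl⟩

theorem exists_add_of_monomial_mem [Nontrivial A] {S : Set (CharLattice N)} {γ : Γ}
    (h : monomial A γ ∈ monomialIdeal A Γ S) :
    ∃ m ∈ S, ∃ δ ∈ Γ, (γ : CharLattice N) = m + δ := by
  rw [monomialIdeal_eq_span_of', AddMonoidAlgebra.mem_ideal_span_of'_image] at h
  obtain ⟨m, hm, d, e⟩ := h γ (by
    rw [Finsupp.mem_support_iff]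
    change (Finsupp.single γ (1 : A)) γ ≠ 0
    rw [Finsupp.single_eq_same]
    exact one_ne_zero)
  exact ⟨m, hm, d, d.2, by rw [e, add_comm]; rfl⟩

/-- A monomial in a monomial ideal is a multiple of one of the generating monomials, so the ideal
determines `S + Γ`. -/
theorem sameModulo_of_monomialIdeal_eq [Nontrivial A] {S S' : Finset (CharLattice N)}
    (hS : ∀ m ∈ S, m ∈ Γ) (hS' : ∀ m ∈ S', m ∈ Γ)
    (h : monomialIdeal A Γ (S : Set (CharLattice N)) = monomialIdeal A Γ S') :
    SameModulo Γ S S' :=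
  ⟨fun m hm => exists_add_of_monomial_mem (A := A)
      (h ▸ monomial_mem_monomialIdeal hm (hS m hm)),
    fun m hm => exists_add_of_monomial_mem (A := A)
      (h ▸ monomial_mem_monomialIdeal hm (hS' m hm))⟩

theorem map_monomialIdeal (h : Γ ≤ H) {S : Finset (CharLattice N)} (hS : ∀ m ∈ S, m ∈ Γ) :
    (monomialIdeal A Γ (S : Set (CharLattice N))).map (inclusionHom A h).toRingHom =
      monomialIdeal A H S := by
  rw [monomialIdeal, Ideal.map_span]
  refine congrArg Ideal.span (Set.ext fun x => ?_)
  constructor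
  · rintro ⟨_, ⟨γ, hγ, rfl⟩, rfl⟩
    exact ⟨⟨γ, h γ.2⟩, hγ, inclusionHom_monomial h γ.2⟩
  · rintro ⟨γ, hγ, rfl⟩
    exact ⟨_, ⟨⟨γ, hS γ hγ⟩, hγ, rfl⟩, inclusionHom_monomial h (hS γ hγ)⟩

/-- An ideal of a Noetherian semigroup algebra that contains the monomials of its elements is
generated by finitely many monomials. -/
theorem exists_eq_monomialIdeal [IsNoetherianRing (AddMonoidAlgebra A Γ)]
    {J : Ideal (AddMonoidAlgebra A Γ)}
    (hJ : ∀ f ∈ J, ∀ γ : Γ, f.coeff γ ≠ 0 → monomial A γ ∈ J) :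
    ∃ S : Finset (CharLattice N), (∀ m ∈ S, m ∈ Γ) ∧ J = monomialIdeal A Γ S := by
  classical
  have hspan : J = Ideal.span (AddMonoidAlgebra.of' A Γ '' {γ | monomial A γ ∈ J}) := by
    refine le_antisymm (fun f hf => ?_) (Ideal.span_le.2 ?_)
    · rw [AddMonoidAlgebra.mem_ideal_span_of'_image]
      exact fun γ hγ => ⟨γ, hJ f hf γ (Finsupp.mem_support_iff.1 hγ), 0, (zero_add γ).symm⟩
    · rintro _ ⟨γ, hγ, rfl⟩
      exact hγ
  obtain ⟨s, hs, e⟩ := (Submodule.fg_span_iff_fg_span_finset_subset _).1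
    (hspan ▸ IsNoetherian.noetherian J)
  obtain ⟨t, ht, rfl⟩ := Finset.subset_set_image_iff.1 hs
  refine ⟨t.image Subtype.val, fun m hm => ?_, ?_⟩
  · obtain ⟨γ, -, rfl⟩ := Finset.mem_image.1 hm
    exact γ.2
  · rw [hspan, monomialIdeal_eq_span_of']
    refine e.trans (congrArg Ideal.span ?_)
    rw [Finset.coe_image]
    congr 1
    ext γ
    simp

end MonomialIdeals

/-! ### Weight components and equivariant ideals. -/

section Equivariance

variable {N : Type u} [AddCommGroup N] {k : Type u} [CommRing k]
  {Γ : AddSubmonoid (CharLattice N)}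

/-- The coefficient of `t^x`, as a linear form on `k[t^M]`. -/
noncomputable def coeffForm (k : Type u) [CommRing k] (x : CharLattice N) :
    AddMonoidAlgebra k (CharLattice N) →ₗ[k] k where
  toFun f := f.coeff x
  map_add' _ _ := rfl
  map_smul' _ _ := rfl

/-- The component of weight `x` of an element of `k[t^M] ⊗ k[t^Γ]`. -/
noncomputable def weightComponent (k : Type u) [CommRing k] (Γ : AddSubmonoid (CharLattice N))
    (x : CharLattice N) :
    AddMonoidAlgebra k (CharLattice N) ⊗[k] AddMonoidAlgebra k Γ →ₗ[k] AddMonoidAlgebra k Γ :=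
  (TensorProduct.lid k (AddMonoidAlgebra k Γ)).toLinearMap ∘ₗ
    (coeffForm k x).rTensor (AddMonoidAlgebra k Γ)

theorem weightComponent_tmul (x : CharLattice N) (f : AddMonoidAlgebra k (CharLattice N))
    (g : AddMonoidAlgebra k Γ) : weightComponent k Γ x (f ⊗ₜ g) = f.coeff x • g := rfl

/-- Taking a coefficient in the torus factor is linear over `k[t^Γ]`, so it maps the extension of
`J` back into `J`. -/
theorem weightComponent_mem {J : Ideal (AddMonoidAlgebra k Γ)} (x : CharLattice N)
    {y : AddMonoidAlgebra k (CharLattice N) ⊗[k] AddMonoidAlgebra k Γ}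
    (hy : y ∈ J.map (Algebra.TensorProduct.includeRight :
      AddMonoidAlgebra k Γ →ₐ[k] AddMonoidAlgebra k (CharLattice N) ⊗[k] AddMonoidAlgebra k Γ)) :
    weightComponent k Γ x y ∈ J := by
  -- The component map is not linear over the whole tensor product; quantifying over multiples lets
  -- the induction absorb scalars.
  suffices h : ∀ t, weightComponent k Γ x (t * y) ∈ J by simpa using h 1
  unfold Ideal.map at hy
  induction hy using Submodule.span_induction with
  | mem y h =>
    obtain ⟨g, hg, rfl⟩ := h
    intro t
    induction t with
    | zero => rw [zero_mul, map_zero]; exact zero_mem J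
    | tmul a b =>
      change weightComponent k Γ x ((a ⊗ₜ b) * (1 ⊗ₜ g)) ∈ J
      rw [Algebra.TensorProduct.tmul_mul_tmul, weightComponent_tmul]
      exact Submodule.smul_of_tower_mem J _ (J.mul_mem_left b hg)
    | add s t hs ht => rw [add_mul, map_add]; exact add_mem hs ht
  | zero => intro t; rw [mul_zero, map_zero]; exact zero_mem J
  | add y z _ _ hy hz => intro t; rw [mul_add, map_add]; exact add_mem (hy t) (hz t)
  | smul a y _ hy => intro t; rw [smul_eq_mul, ← mul_assoc]; exact hy (t * a)

theorem weightComponent_coaction (γ : Γ) (f : AddMonoidAlgebra k Γ) :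
    weightComponent k Γ γ (coaction k Γ f) = AddMonoidAlgebra.single γ (f.coeff γ) := by
  classical
  induction f using AddMonoidAlgebra.induction_linear with
  | zero => simp
  | add f g hf hg =>
    rw [map_add, map_add, hf, hg, AddMonoidAlgebra.coeff_add, Finsupp.add_apply,
      AddMonoidAlgebra.single_add]
  | single δ r =>
    have h : coaction k Γ (AddMonoidAlgebra.single δ r) =
        r • (AddMonoidAlgebra.single (δ : CharLattice N) (1 : k) ⊗ₜ[k] monomial k δ) :=
      AddMonoidAlgebra.lift_single _ _ _
    rw [h, map_smul, weightComponent_tmul, AddMonoidAlgebra.coeff_single,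
      AddMonoidAlgebra.coeff_single, Finsupp.single_apply, Finsupp.single_apply]
    by_cases e : δ = γ
    · subst e
      rw [if_pos rfl, if_pos rfl, one_smul, monomial, AddMonoidAlgebra.smul_single, smul_eq_mul,
        mul_one]
    · rw [if_neg (fun h => e (Subtype.ext h)), if_neg e, zero_smul, smul_zero,
        AddMonoidAlgebra.single_zero]

/-- By equivariance the coaction sends `f` into the extension of `J`, and the component of weight
`γ` of its image is the term of `f` at `γ`. -/
theorem single_mem_of_map_coaction_eq {J : Ideal (AddMonoidAlgebra k Γ)}
    (hJ : J.map (coaction k Γ) = J.map (Algebra.TensorProduct.includeRight :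
      AddMonoidAlgebra k Γ →ₐ[k] AddMonoidAlgebra k (CharLattice N) ⊗[k] AddMonoidAlgebra k Γ))
    {f : AddMonoidAlgebra k Γ} (hf : f ∈ J) (γ : Γ) :
    AddMonoidAlgebra.single γ (f.coeff γ) ∈ J := by
  rw [← weightComponent_coaction]
  exact weightComponent_mem _ (hJ ▸ Ideal.mem_map_of_mem _ hf)

end Equivariance

/-! ### Equivariant ideal sheaves on toric schemes. -/

namespace ToricTriple

variable {N : Type u} [AddCommGroup N] (D : ToricTriple N) (k : Type u)

theorem chartIdeal_eq [CommRing k] (I : (D.scheme k).IdealSheafData) (σ : D.cones) :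
    D.chartIdeal k I σ = specIdeal (I.comap (D.chart k σ)) := rfl

theorem chartIdeal_of_le [CommRing k] (I : (D.scheme k).IdealSheafData) {σ τ : D.cones}
    (h : τ ≤ σ) :
    D.chartIdeal k I τ =
      (D.chartIdeal k I σ).map (inclusionHom k (D.semigroup_le h)).toRingHom := by
  rw [chartIdeal_eq, ← D.map_chart k h, Scheme.IdealSheafData.comap_comp]
  exact specIdeal_comap _ _

/-- The intersection of two cones of the fan. -/
def meet (σ τ : D.cones) : D.cones :=
  ⟨σ.1 ⊓ τ.1, D.isFan.face_mem _ σ.2 _ (D.isFan.inf_face _ σ.2 _ τ.2).1⟩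

theorem meet_le_left (σ τ : D.cones) : D.meet σ τ ≤ σ :=
  show σ.1 ⊓ τ.1 ≤ σ.1 from inf_le_left

theorem meet_le_right (σ τ : D.cones) : D.meet σ τ ≤ τ :=
  show σ.1 ⊓ τ.1 ≤ τ.1 from inf_le_right

theorem le_meet {ρ σ τ : D.cones} (h : ρ ≤ σ) (h' : ρ ≤ τ) : ρ ≤ D.meet σ τ :=
  show ρ.1 ≤ σ.1 ⊓ τ.1 from le_inf h h'

theorem isToricPair (σ : D.cones) : IsToricPair σ.1 (D.semigroup σ) where
  rational := D.isFan.rational _ σ.2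
  strictlyConvex := D.isFan.strictlyConvex _ σ.2
  fg := D.fg σ
  closure_eq_top := D.closure_eq_top σ
  realCone_eq := D.realCone_eq σ

/-- If the ideal vanishes on the chart of `σ`, it vanishes on that of `σ ∩ τ`. The algebra of `τ`
embeds in the algebra of `σ ∩ τ`, so the ideal vanishes on the chart of every `τ`. -/
theorem chartIdeal_ne_bot [CommRing k] {I : (D.scheme k).IdealSheafData} (hI : I ≠ ⊥)
    (σ : D.cones) : D.chartIdeal k I σ ≠ ⊥ := by
  intro h
  refine hI (idealSheaf_ext (D.chart k) (D.exists_chart_eq k) fun τ => ?_)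
  have h1 : D.chartIdeal k I (D.meet σ τ) = ⊥ := by
    rw [D.chartIdeal_of_le k I (D.meet_le_left σ τ), h, Ideal.map_bot]
  rw [D.chartIdeal_of_le k I (D.meet_le_right σ τ),
    Ideal.map_eq_bot_iff_of_injective
      (f := (inclusionHom k (D.semigroup_le (D.meet_le_right σ τ))).toRingHom)
      (inclusionHom_injective k _)] at h1
  rw [Scheme.IdealSheafData.comap_bot, ← specIdealSheaf_specIdeal (I.comap _),
    ← specIdealSheaf_specIdeal ⊥, specIdeal_bot]
  exact congrArg specIdealSheaf h1

/-- Nonzero coefficients are units in a field, so the terms of elements of the ideal yield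
monomials; finiteness comes from Noetherianity, and `S` is nonempty because the ideal is nonzero. -/
theorem exists_chartIdeal_eq_monomialIdeal [Field k] {I : (D.scheme k).IdealSheafData}
    (hI : D.IsEquivariant k I) (hI0 : I ≠ ⊥) (σ : D.cones) :
    ∃ S : Finset (CharLattice N), S.Nonempty ∧ (∀ m ∈ S, m ∈ D.semigroup σ) ∧
      D.chartIdeal k I σ = monomialIdeal k (D.semigroup σ) S := by
  have : AddMonoid.FG (D.semigroup σ) := (AddMonoid.fg_iff_addSubmonoid_fg _).2 (D.fg σ)
  have := AddMonoidAlgebra.finiteType_of_fg k (D.semigroup σ)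
  have := Algebra.FiniteType.isNoetherianRing k (AddMonoidAlgebra k (D.semigroup σ))
  obtain ⟨S, hS, e⟩ := exists_eq_monomialIdeal (J := D.chartIdeal k I σ) fun f hf γ hγ => by
    have h := Submodule.smul_of_tower_mem _ (f.coeff γ)⁻¹
      (single_mem_of_map_coaction_eq (hI σ) hf γ)
    rwa [AddMonoidAlgebra.smul_single, smul_eq_mul, inv_mul_cancel₀ hγ] at h
  refine ⟨S, Finset.nonempty_iff_ne_empty.2 ?_, hS, e⟩
  rintro rfl
  refine D.chartIdeal_ne_bot k hI0 σ (e.trans ?_)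
  simp [monomialIdeal]

end ToricTriple

end ToricBlowup

/-! ### The two atlases and the main theorem. -/

namespace ToricBlowup

variable {N : Type u} [AddCommGroup N]

/-- The atlas with one chart, for the blowing up of a monomial ideal of `A[t^Γ]`. -/
def affineAtlas {σ : PointedCone ℝ (RealSpace N)} {Γ : AddSubmonoid (CharLattice N)}
    (h : IsToricPair σ Γ) (S : Finset (CharLattice N)) (hS : S.Nonempty) (hSΓ : ∀ m ∈ S, m ∈ Γ) :
    BlowupAtlas N PUnit.{u + 1} where
  cone _ := σ
  semigroup _ := Γ
  exps _ := S
  isToricPair _ := h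
  exps_nonempty _ := hS
  exps_mem _ := hSΓ
  meet _ _ := PUnit.unit
  meet_comm _ _ := rfl
  cone_meet _ _ := (inf_idem σ).symm
  isFace_meet _ _ := isFace_refl σ
  semigroup_meet _ _ := h.faceSemigroup_self.symm
  exps_meet _ _ := SameModulo.refl S

/-- The charts of a toric scheme, as an atlas for the blowing up of an ideal sheaf given by
monomials on every chart. -/
def ToricTriple.atlas (D : ToricTriple N) (k : Type u) [CommRing k] [Nontrivial k]
    (I : (D.scheme k).IdealSheafData) (S : D.cones → Finset (CharLattice N))
    (hne : ∀ σ, (S σ).Nonempty) (hS : ∀ σ, ∀ m ∈ S σ, m ∈ D.semigroup σ)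
    (hI : ∀ σ, D.chartIdeal k I σ = monomialIdeal k (D.semigroup σ) (S σ)) :
    BlowupAtlas N D.cones where
  cone σ := σ.1
  semigroup := D.semigroup
  exps := S
  isToricPair := D.isToricPair
  exps_nonempty := hne
  exps_mem := hS
  meet := D.meet
  meet_comm σ τ := Subtype.ext (inf_comm _ _)
  cone_meet _ _ := rfl
  isFace_meet σ τ := (D.isFan.inf_face _ σ.2 _ τ.2).1
  semigroup_meet σ τ := D.compatible _ _ (D.isFan.inf_face _ σ.2 _ τ.2).1
  exps_meet σ τ := by
    have hle := D.semigroup_le (D.meet_le_left σ τ)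
    -- Both sets of exponents generate the ideal of `I` on the chart of `σ ∩ τ`.
    refine sameModulo_of_monomialIdeal_eq (A := k) (fun m hm => hle (hS σ m hm)) (hS _) ?_
    rw [← hI, D.chartIdeal_of_le k I (D.meet_le_left σ τ), hI, map_monomialIdeal hle (hS σ)]

/-- The gluing of the charts of a toric scheme. -/
noncomputable def ToricTriple.gluing (D : ToricTriple N) (k : Type u) [CommRing k] [Nontrivial k]
    (I : (D.scheme k).IdealSheafData) (S : D.cones → Finset (CharLattice N))
    (hne : ∀ σ, (S σ).Nonempty) (hS : ∀ σ, ∀ m ∈ S σ, m ∈ D.semigroup σ)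
    (hI : ∀ σ, D.chartIdeal k I σ = monomialIdeal k (D.semigroup σ) (S σ)) :
    (D.atlas k I S hne hS hI).Gluing k (D.scheme k) where
  j := D.chart k
  isOpenImmersion_j σ := inferInstanceAs (IsOpenImmersion (D.chart k σ))
  exists_eq := D.exists_chart_eq k
  j_meet σ τ := D.map_chart k (D.meet_le_left σ τ)
  exists_of_eq σ τ x y h := by
    obtain ⟨ρ, hσ, hτ, z, hz⟩ := D.exists_of_chart_eq k h
    refine ⟨affineToricMap k (D.semigroup_le (D.le_meet hσ hτ)) z, Eq.trans ?_ hz⟩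
    rw [← D.map_chart k (D.le_meet hσ hτ)]
    rfl

end ToricBlowup

theorem mainTheorem4 :
    (∀ (N : Type u) [AddCommGroup N] [Module.Free ℤ N] [Module.Finite ℤ N]
      (σ : PointedCone ℝ (RealSpace N)) (_ : IsRational σ) (_ : IsStrictlyConvex σ)
      (Γ : AddSubmonoid (CharLattice N)) (_ : Γ.FG)
      (_ : AddSubgroup.closure (Γ : Set (CharLattice N)) = ⊤)
      (_ : realCone Γ = dualCone σ)
      (S : Finset (CharLattice N)) (_ : S.Nonempty) (_ : ∀ m ∈ S, m ∈ Γ),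
      (Submodule.span ℝ (σ : Set (RealSpace N)) = ⊤ →
        realify '' vertexExponents σ S = (newtonPolyhedron σ S).extremePoints ℝ) ∧
      ∃ D : ToricTriple N,
        D.cones = blowupFan σ S ∧
        D.HasBlowupSemigroups σ Γ S ∧
        ∀ (A : Type u) [CommRing A], ∃ π : D.scheme A ⟶ affineToric A Γ,
          (∀ τ : D.cones, ∃ h : Γ ≤ D.semigroup τ, D.chart A τ ≫ π = affineToricMap A h) ∧
          π ≫ affineToricStructure A Γ = D.structureMorphism A ∧
          IsBlowup π (specIdealSheaf (monomialIdeal A Γ S))) ∧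
    (∀ (N : Type u) [AddCommGroup N] [Module.Free ℤ N] [Module.Finite ℤ N]
      (k : Type u) [Field k] (D : ToricTriple N) (I : (D.scheme k).IdealSheafData)
      (_ : D.IsEquivariant k I) (_ : I ≠ ⊥),
      ∃ (D' : ToricTriple N) (π : D'.scheme k ⟶ D.scheme k),
        IsBlowup π I ∧
        π ≫ D.structureMorphism k = D'.structureMorphism k ∧
        ∀ σ : D.cones,
          π ⁻¹ᵁ (D.chart k σ).opensRange =
            (⨆ τ : {τ : D'.cones // τ.1 ≤ σ.1}, (D'.chart k τ.1).opensRange) ∧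
          (∀ τ : D'.cones, τ.1 ≤ σ.1 → ∃ h : D.semigroup σ ≤ D'.semigroup τ,
            D'.chart k τ ≫ π = affineToricMap k h ≫ D.chart k σ) ∧
          (∃ S : Finset (CharLattice N), S.Nonempty ∧ (∀ m ∈ S, m ∈ D.semigroup σ) ∧
            D.chartIdeal k I σ = monomialIdeal k (D.semigroup σ) S) ∧
          ∀ S : Finset (CharLattice N), (∀ m ∈ S, m ∈ D.semigroup σ) →
            D.chartIdeal k I σ = monomialIdeal k (D.semigroup σ) S →
              {τ | τ ∈ D'.cones ∧ τ ≤ σ.1} = blowupFan σ.1 S ∧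
              D'.HasBlowupSemigroups σ.1 (D.semigroup σ) S) := by
  refine ⟨fun N _ _ _ σ hσ hσc Γ hfg htop hcone S hS hSΓ => ?_, fun N _ _ _ k _ D I heq hI0 => ?_⟩
  · have h : IsToricPair σ Γ := ⟨hσ, hσc, hfg, htop, hcone⟩
    refine ⟨image_vertexExponents_eq_extremePoints h S, ?_⟩
    let 𝒜 := affineAtlas h S hS hSΓ
    have hle : ∀ ρ ∈ 𝒜.triple.cones, ρ ≤ σ := fun ρ ⟨_, _, hc⟩ => hc.le
    refine ⟨𝒜.triple, ?_, 𝒜.triple_hasBlowupSemigroups PUnit.unit (SameModulo.refl S),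
      fun A _ => ?_⟩
    · refine Eq.trans ?_ (𝒜.triple_cones_le PUnit.unit (SameModulo.refl S))
      exact Set.ext fun ρ => ⟨fun hρ => ⟨hρ, hle ρ hρ⟩, fun hρ => hρ.1⟩
    · let G : 𝒜.Gluing A (affineToric A Γ) :=
        { j := fun _ => 𝟙 _
          isOpenImmersion_j := fun _ => inferInstanceAs (IsOpenImmersion (𝟙 (affineToric A Γ)))
          exists_eq := fun x => ⟨PUnit.unit, x, rfl⟩
          j_meet := fun _ _ => affineToricMap_refl A Γ
          exists_of_eq := fun _ _ x _ _ => ⟨x, rfl⟩ }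
      refine ⟨G.morphism, fun τ => ?_, G.morphism_structure _ fun _ => Category.id_comp _,
        G.isBlowup fun _ => Scheme.IdealSheafData.comap_id _⟩
      have hc := 𝒜.isChart_of_le τ (i := PUnit.unit) (hle τ.1 τ.2)
      exact ⟨hc.semigroup_le, (G.chart_morphism hc).trans (Category.comp_id _)⟩
  · choose S hne hS hI using D.exists_chartIdeal_eq_monomialIdeal k heq hI0
    have : Finite D.cones := D.isFan.finite
    have : Nonempty D.cones := D.isFan.nonempty.to_subtype
    let 𝒜 := D.atlas k I S hne hS hI
    let G := D.gluing k I S hne hS hI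
    have hG : ∀ σ, I.comap (G.j σ) =
        specIdealSheaf (monomialIdeal k (𝒜.semigroup σ) (𝒜.exps σ)) := fun σ => by
      rw [← specIdealSheaf_specIdeal (I.comap _)]
      exact congrArg specIdealSheaf (hI σ)
    refine ⟨𝒜.triple, G.morphism, G.isBlowup hG, G.morphism_structure _
      fun σ => D.chart_structureMorphism k σ, fun σ => ⟨G.preimage_opensRange σ, fun τ hτ => ?_,
        ⟨S σ, hne σ, hS σ, hI σ⟩, fun S' hS' hI' => ?_⟩⟩
    · have hc := 𝒜.isChart_of_le τ (i := σ) hτ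
      exact ⟨hc.semigroup_le, G.chart_morphism hc⟩
    · have hmod : SameModulo (𝒜.semigroup σ) (𝒜.exps σ) S' :=
        sameModulo_of_monomialIdeal_eq (A := k) (hS σ) hS' ((hI σ).symm.trans hI')
      exact ⟨𝒜.triple_cones_le σ hmod, 𝒜.triple_hasBlowupSemigroups σ hmod⟩
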